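/- A \emph{dessin} (hypermap) is a pair of permutations $x,y$ of a finite non-empty set $\Omega$ generating a transitive group, with $z=(xy)^{-1}$; its type is $(o(x),o(y),o(z))$, its automorphism group is the centraliser of $\langle x,y\rangle$ in ${\rm Sym}(\Omega)$, and it is \emph{regular} if this centraliser is transitive. If its type $(l,m,n)$ is hyperbolic, it lies on the Riemann surface $\mathbb H/K$, where $K$ is a point-stabiliser for the action on $\Omega$ of a triangle group $\Delta(l,m,n)\le PSL_2(\mathbb R)$ whose canonical generators induce $x,y,z$. Let $n\ge 3$. There are infinitely many primes $p\equiv 2n+1 \bmod 4n$. Let $p$ be one of them and let $G=PGL_2(p)$. Then $L_2(p)$ is the unique subgroup of index $2$ in $G$, and there are elements $d\in\mathbb F_p^*$ of multiplicative order $2n$. Fix such a $d$, let $a,b,c\in\mathbb F_p$ satisfy $a^2+bc+1=0$, and let $x,y,z$ be the images in $G$ of $$X=\begin{pmatrix}a&b\\c&-a\end{pmatrix},\quad Y=\begin{pmatrix}d&0\\0&1\end{pmatrix},\quad Z=(XY)^{-1}=\begin{pmatrix}-a/d&-b/d\\-c&a\end{pmatrix}.$$ Then $x\in L_2(p)$ has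 order $2$ and $y\in G\setminus L_2(p)$ has order $2n$. Suppose that either (i) $a=(d+1)/(d-1)$, or (ii) $a^2\neq-1$ and $Z$ has eigenvalues $d^{(j-1)/2}$ and $d^{(-j-1)/2}$ for some integer $j$ coprime to $2n$ with $j\not\equiv\pm1 \bmod 2n$. Then $z$ has order $2n$, and $x,y,z$ generate $G$. Consequently there is an epimorphism $\theta:\Delta^*\to G$ from a triangle group $\Delta^*\le PSL_2(\mathbb R)$ of type $(2,2n,2n)$ taking its canonical generators $u,v,w$ to $x,y,z$. Put $L=\ker\theta$, and let $\Delta_1$ and $\Delta_2$ be the normal closures of $v$ and of $w$ in $\Delta^*$; these are distinct triangle groups of type $(n,2n,2n)$ and of index $2$ in $\Delta^*$. Then $K:=\Delta_1\cap L=\Delta_2\cap L$ acts freely, properly discontinuously and cocompactly on $\mathbb H$, and the inclusions $K\le\Delta_i$ give two regular dessins ${\cal H}_1,{\cal H}_2$ of type $(n,2n,2n)$ on the same compact Riemann surface $\mathbb H/K$, both with automorphism group isomorphic to $G$. Moreover ${\cal H}_1\cong{\cal H}_2$ if and only if some automorphism of $G$ transposes $y$ and $z$. In case (i) there is such an automorphism,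 so ${\cal H}_1\cong{\cal H}_2$. In case (ii) there is none, so ${\cal H}_1\not\cong{\cal H}_2$, although ${\rm Aut}\,{\cal H}_1\cong{\rm Aut}\,{\cal H}_2$. For each $d$ there are $a,b,c$ as in (i), and for each integer $j$ coprime to $2n$ with $j\not\equiv n\pm1 \bmod 2n$ there are $a,b,c$ with $a^2+bc+1=0$, $a^2\ne-1$ and $Z$ having eigenvalues $d^{(j-1)/2}, d^{(-j-1)/2}$. For example, let $n=8$, $p=17$, $d=3$, an element of order $16$ in $\mathbb F_{17}^*$. The choices $(a,b,c)=(2,3,4)$, giving $Z=\begin{pmatrix}5&-1\\-4&2\end{pmatrix}$, and $(a,b,c)=(-1,2,-1)$, giving $Z=\begin{pmatrix}6&5\\1&-1\end{pmatrix}$, both give generating triples of $PGL_2(17)$ and hence pairs of regular dessins of type $(8,16,16)$ and genus $1837$ on the same surface, with automorphism group $PGL_2(17)$; the two dessins are isomorphic for the first choice and non-isomorphic for the second. -/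

import Mathlib

open scoped MatrixGroups UpperHalfPlane

/-! ### Hypermaps (dessins) -/

/-- A (finite, oriented) hypermap on the set `Ω`: an ordered pair of permutations generating a
transitive group on a finite non-empty set. -/
structure Hypermap (Ω : Type*) where
  x : Equiv.Perm Ω
  y : Equiv.Perm Ω
  finite : Finite Ω
  nonempty : Nonempty Ω
  transitive : MulAction.IsPretransitive (Subgroup.closure ({x, y} : Set (Equiv.Perm Ω))) Ω

namespace Hypermap

variable {Ω Ω' : Type*}

/-- The third permutation `z`, determined by `x y z = 1`. -/
def z (H : Hypermap Ω) : Equiv.Perm Ω := (H.x * H.y)⁻¹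

/-- `Aut H` is the centraliser of the monodromy group in the symmetric group on `Ω`. -/
def Aut (H : Hypermap Ω) : Subgroup (Equiv.Perm Ω) :=
  Subgroup.centralizer (Subgroup.closure ({H.x, H.y} : Set (Equiv.Perm Ω)) : Set (Equiv.Perm Ω))

/-- `H` is a regular dessin: `Aut H` is transitive on `Ω`. -/
def IsRegular (H : Hypermap Ω) : Prop := MulAction.IsPretransitive H.Aut Ω

/-- `H` has type `(l, m, n)`. -/
def HasType (H : Hypermap Ω) (l m n : ℕ) : Prop :=
  orderOf H.x = l ∧ orderOf H.y = m ∧ orderOf H.z = n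

/-- Isomorphism of dessins (preserving the orientation and the colours). -/
def Iso (H : Hypermap Ω) (H' : Hypermap Ω') : Prop :=
  ∃ e : Ω ≃ Ω', (∀ ω, e (H.x ω) = H'.x (e ω)) ∧ (∀ ω, e (H.y ω) = H'.y (e ω))

/-- The number of cycles of a permutation, fixed points included. -/
noncomputable def cycleCount (σ : Equiv.Perm Ω) : ℕ :=
  Nat.card (MulAction.orbitRel.Quotient (Subgroup.zpowers σ) Ω)

/-- `H` has genus `g`: the Walsh map has the cycles of `x` and `y` as vertices, the elements of `Ω`
as edges and the cycles of `z` as faces, and its Euler characteristic is `2 - 2 g`. -/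
def HasGenus (H : Hypermap Ω) (g : ℕ) : Prop :=
  (cycleCount H.x + cycleCount H.y + cycleCount H.z : ℤ) - Nat.card Ω = 2 - 2 * g

end Hypermap

/-! ### Triangle groups and surface groups in `PSL(2, ℝ)`, the automorphism group of `ℍ` -/

/-- The action of `PSL(2, ℝ)` on the hyperbolic plane by Möbius transformations. -/
noncomputable instance pslAction : MulAction PSL(2, ℝ) ℍ :=
  MulAction.compHom ℍ
    (Matrix.ProjectiveSpecialLinearGroup.toPGL : PSL(2, ℝ) →* PGL(2, ℝ))

/-- `g` is the rotation of `ℍ` about `P` through the angle `θ`: it fixes `P`, and its derivative at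
`P`, which for `t ↦ (a t + b) / (c t + d)` with `a d - b c = 1` is `(c P + d)⁻²`, is `exp (i θ)`. -/
def IsRotation (g : PSL(2, ℝ)) (P : ℍ) (θ : ℝ) : Prop :=
  ∃ A : SL(2, ℝ), (QuotientGroup.mk A : PSL(2, ℝ)) = g ∧ A • P = P ∧
    (((A 1 0 : ℝ) : ℂ) * (P : ℂ) + ((A 1 1 : ℝ) : ℂ)) ^ 2 * Complex.exp (θ * Complex.I) = 1

/-- `u, v, w` are canonical generators of a hyperbolic triangle group of type `(l, m, n)`: they are
rotations through `2π/l`, `2π/m`, `2π/n`, and `u v w = 1`. (In the hyperbolic case the relation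
`u v w = 1` says that the three fixed points are the vertices of a hyperbolic triangle with
internal angles `π/l`, `π/m`, `π/n`.) -/
structure IsCanonicalTriple (l m n : ℕ) (u v w : PSL(2, ℝ)) : Prop where
  two_le_l : 2 ≤ l
  two_le_m : 2 ≤ m
  two_le_n : 2 ≤ n
  hyperbolic : (1 : ℝ) / l + 1 / m + 1 / n < 1
  rot_u : ∃ P : ℍ, IsRotation u P (2 * Real.pi / l)
  rot_v : ∃ P : ℍ, IsRotation v P (2 * Real.pi / m)
  rot_w : ∃ P : ℍ, IsRotation w P (2 * Real.pi / n)
  mul_eq_one : u * v * w = 1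

/-- `K` is a surface group: it acts properly discontinuously and freely on `ℍ`, with compact
quotient, so that `ℍ / K` is a compact Riemann surface uniformised by `K`. -/
structure IsSurfaceGroup (K : Subgroup PSL(2, ℝ)) : Prop where
  properlyDiscontinuous : ProperlyDiscontinuousSMul K ℍ
  free : ∀ (g : K) (P : ℍ), g • P = P → g = 1
  cocompact : CompactSpace (MulAction.orbitRel.Quotient K ℍ)

/-- The dessin `H` lies on the Riemann surface `ℍ / K` and has Belyi function
`ℍ / K → ℍ / Δ ≅ ℙ¹(ℂ)`: `Δ` is a hyperbolic triangle group of the type of `H`, acting on `Ω` with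
its canonical generators inducing `x, y, z`, and `K` is the stabiliser of a point. -/
def Hypermap.IsUniformizedBy {Ω : Type*} (H : Hypermap Ω) (Δ K : Subgroup PSL(2, ℝ)) : Prop :=
  ∃ u v w : Δ,
    IsCanonicalTriple (orderOf H.x) (orderOf H.y) (orderOf H.z) (u : PSL(2, ℝ)) v w ∧
    Subgroup.closure ({u, v, w} : Set Δ) = ⊤ ∧
    ∃ ρ : Δ →* Equiv.Perm Ω, ρ u = H.x ∧ ρ v = H.y ∧ ρ w = H.z ∧
      ∃ ω : Ω, ∀ g : PSL(2, ℝ), g ∈ K ↔ ∃ h : g ∈ Δ, ρ ⟨g, h⟩ ω = ω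

/-! ### Pairs of dessins of type `(n, 2n, 2n)` from a triple of orders `2, 2n, 2n` -/

/-- `H₁` and `H₂` are dessins on the same compact Riemann surface `ℍ / K`, obtained from the triple
`x, y, z` of `G`. Here `Δ` is the triangle group of type `(2, 2n, 2n)`, its canonical generators
`u, v, w` are mapped to `x, y, z` by `θ` with kernel `L`, the distinct triangle groups `Δ₁` and
`Δ₂` of index `2` in `Δ` are the normal closures of `v` and of `w`,
`K = Δ₁ ∩ L = Δ₂ ∩ L`, and `Hᵢ` corresponds to the inclusion of `K` in `Δᵢ`. -/
def ArePairOnSurface {G : Type*} [Group G] {Ω₁ Ω₂ : Type*} (n : ℕ) (x y z : G)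
    (H₁ : Hypermap Ω₁) (H₂ : Hypermap Ω₂) : Prop :=
  ∃ (Δ : Subgroup PSL(2, ℝ)) (u v w : Δ) (θ : Δ →* G) (Δ₁ Δ₂ K : Subgroup Δ),
    IsCanonicalTriple 2 (2 * n) (2 * n) (u : PSL(2, ℝ)) v w ∧
    Subgroup.closure ({u, v, w} : Set Δ) = ⊤ ∧
    θ u = x ∧ θ v = y ∧ θ w = z ∧
    Δ₁ = Subgroup.normalClosure {v} ∧ Δ₂ = Subgroup.normalClosure {w} ∧
    Δ₁.index = 2 ∧ Δ₂.index = 2 ∧ Δ₁ ≠ Δ₂ ∧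
    K = Δ₁ ⊓ θ.ker ∧ K = Δ₂ ⊓ θ.ker ∧
    IsSurfaceGroup (K.map Δ.subtype) ∧
    H₁.IsUniformizedBy (Δ₁.map Δ.subtype) (K.map Δ.subtype) ∧
    H₂.IsUniformizedBy (Δ₂.map Δ.subtype) (K.map Δ.subtype)

/-- `x, y, z` is a generating triple of `G` of orders `2, 2n, 2n` with `x y z = 1`. -/
def IsGeneratingTriple {G : Type*} [Group G] (n : ℕ) (x y z : G) : Prop :=
  x * y * z = 1 ∧ orderOf x = 2 ∧ orderOf y = 2 * n ∧ orderOf z = 2 * n ∧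
    Subgroup.closure ({x, y, z} : Set G) = ⊤

/-- `H₁` and `H₂` are regular dessins of type `(n, 2n, 2n)` with automorphism groups isomorphic
to `G`, obtained from the triple `x, y, z` on the same compact Riemann surface. -/
def IsDessinPair {G : Type*} [Group G] {Ω₁ Ω₂ : Type*} (n : ℕ) (x y z : G)
    (H₁ : Hypermap Ω₁) (H₂ : Hypermap Ω₂) : Prop :=
  ArePairOnSurface n x y z H₁ H₂ ∧
    H₁.IsRegular ∧ H₂.IsRegular ∧
    H₁.HasType n (2 * n) (2 * n) ∧ H₂.HasType n (2 * n) (2 * n) ∧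
    Nonempty (H₁.Aut ≃* G) ∧ Nonempty (H₂.Aut ≃* G)

/-- Some automorphism of `G` transposes `y` and `z`. -/
def HasSwap {G : Type*} [Group G] (y z : G) : Prop := ∃ σ : G ≃* G, σ y = z ∧ σ z = y

/-! ### The matrices -/

def matX {F : Type*} [CommRing F] (a b c : F) : Matrix (Fin 2) (Fin 2) F := !![a, b; c, -a]

def matY {F : Type*} [CommRing F] (d : F) : Matrix (Fin 2) (Fin 2) F := !![d, 0; 0, 1]

/-- The inverse of `matX a b c * matY d` when `a ^ 2 + b * c + 1 = 0` and `d ≠ 0`. -/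
def matZ {F : Type*} [Field F] (a b c d : F) : Matrix (Fin 2) (Fin 2) F :=
  !![-a / d, -b / d; -c, a]

/-- `L₂(F)` as a subgroup of `PGL₂(F)`. -/
def subgroupL2 (F : Type*) [CommRing F] : Subgroup PGL(2, F) :=
  (Matrix.ProjectiveSpecialLinearGroup.toPGL : PSL(2, F) →* PGL(2, F)).range

/-- The image in `PGL₂(F)` of an invertible matrix. -/
abbrev toPGL2 {F : Type*} [CommRing F] (M : GL (Fin 2) F) : PGL(2, F) := Matrix.ProjGenLinGroup.mk M

/-! The proof combines hyperbolic geometry, finite group theory and matrix computations over `ZMod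
p`.

Geometry. The reflection group of a triangle with angles π/2, π/2n, π/2n is taken as an abstract
Coxeter group acting on ℍ, with one function per side whose sign separates the two sides of that
geodesic. These functions transform by the geometric representation, so Tits' lemma
(`CoxeterSystem.mem_cone_of_not_isLeftDescent`) shows that distinct translates of the open triangle
are disjoint and that point stabilisers are generated by reflections. Minimising the distance to an
interior point shows that the translates of the closed triangle cover ℍ. This is Poincaré's theorem
for one triangle. The even subgroup is Δ*; it has the expected presentation (`exists_hom`), and the
kernel of a homomorphism preserving the orders of u, v, w acts freely (`eq_one_of_smul_eq`).

The two dessins. The normal closure Δ₁ of v is generated by w², w⁻¹vw, v, a triple of type (n, 2n,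
2n); Δ₂ is obtained by exchanging v and w. They are the kernels of two sign characters of Δ* whose
product is the pull-back of the character of G with kernel L₂(p). The two signs therefore agree on
L, and Δ₁ ∩ L = Δ₂ ∩ L. As L₂(p) is the only subgroup of index two and contains neither y nor z,
each Δᵢ maps onto G, and the dessins are the regular ones of the pairs (z², z⁻¹yz) and (y², y⁻¹zy).
An isomorphism is an automorphism of G matching these pairs; because y² and y have the same
centraliser and G has trivial centre, it must transpose y and z.

Generation. Suppose p does not divide the order of ⟨x, y⟩. Over the algebraic closure every
non-identity element then has exactly two fixed points on the projective line, and Klein's count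
(`MulAction.card_orbit_le_two`) says that a point with stabiliser of order at least six has at most
two images. But ∞ is fixed by y, of order 2n ≥ 6, and has the three images ∞, x∞, yx∞. So there is
an element of order p, a transvection; x or y moves its axis, and two transvections with different
axes generate L₂(p), which does not contain y.

The swap. Put j = 2k + 1; case (i) is k = 0. There an explicit traceless matrix conjugates y to z
and z to y. In case (ii) an automorphism taking y to z would carry the relation yUy⁻¹ = U^d, with U
unipotent, to one for z, so the eigenvalues of Z would have ratio d; this forces j ≡ ±1 mod 2n. -/

/-! ### Tits' lemma on the chambers of a Coxeter group -/

/-- The alternating product `a b a ⋯` with `k` factors. -/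
def altProd {W : Type*} [Group W] (a b : W) : ℕ → W
  | 0 => 1
  | k + 1 => a * altProd b a k

/-- The last k letters of (ab)^k cancel against the word b a b ⋯ of length k, leaving the first k.
When (ab)^k = 1 this becomes the braid relation. -/
theorem altProd_eq_pow_mul {W : Type*} [Group W] {a b : W} (ha : a * a = 1) (hb : b * b = 1)
    (k : ℕ) : altProd a b k = (a * b) ^ k * altProd b a k := by
  induction k generalizing a b with
  | zero => simp [altProd]
  | succ k ih =>
    have h1 : a * (b * a) ^ k = (a * b) ^ k * a := by
      have : SemiconjBy a (b * a) (a * b) := by simp [SemiconjBy, mul_assoc]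
      exact (this.pow_right k).eq
    calc altProd a b (k + 1) = a * ((b * a) ^ k * altProd a b k) := by rw [altProd, ih hb ha]
      _ = (a * b) ^ k * a * altProd a b k := by rw [← mul_assoc, h1]
      _ = (a * b) ^ k * a * (b * b) * altProd a b k := by rw [hb, mul_one]
      _ = (a * b) ^ (k + 1) * altProd b a (k + 1) := by rw [pow_succ, altProd]; group

theorem altProd_braid {W : Type*} [Group W] {a b : W} (ha : a * a = 1) (hb : b * b = 1)
    {m : ℕ} (h : (a * b) ^ m = 1) : altProd a b m = altProd b a m := by
  rw [altProd_eq_pow_mul ha hb, h, one_mul]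

namespace CoxeterSystem

variable {B W X : Type*} [Group W] {M : CoxeterMatrix B} (cs : CoxeterSystem M W)

theorem length_altProd_mul_le (i j : B) (k : ℕ) (v : W) :
    cs.length (altProd (cs.simple i) (cs.simple j) k * v) ≤ k + cs.length v := by
  induction k generalizing i j with
  | zero => simp [altProd]
  | succ k ih =>
    rw [altProd, mul_assoc]
    have h1 := cs.length_mul_le (cs.simple i) (altProd (cs.simple j) (cs.simple i) k * v)
    have h2 := ih j i
    rw [cs.length_simple] at h1
    omega

theorem altProd_add {W : Type*} [Group W] (a b : W) (m k : ℕ) :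
    ∃ c : W, altProd a b (m + k) = altProd a b m * c ∧ (c = altProd a b k ∨ c = altProd b a k) := by
  induction m generalizing a b with
  | zero => exact ⟨_, by simp [altProd], Or.inl rfl⟩
  | succ m ih =>
    obtain ⟨c, h1, h2⟩ := ih b a
    exact ⟨c, by rw [show m + 1 + k = m + k + 1 by omega, altProd, altProd, h1, mul_assoc],
      h2.symm⟩

/-- A left descent `j` of `w` can be continued, alternating with `i`, down to an element `v` with
neither `i` nor `j` as a left descent. -/
theorem exists_altProd_mul_of_isLeftDescent (i j : B) (w : W) (hj : cs.IsLeftDescent w j) :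
    ∃ (k : ℕ) (v : W), w = altProd (cs.simple j) (cs.simple i) (k + 1) * v ∧
      cs.length w = k + 1 + cs.length v ∧ ¬ cs.IsLeftDescent v i ∧ ¬ cs.IsLeftDescent v j := by
  induction h : cs.length w using Nat.strong_induction_on generalizing i j w with
  | _ N ih =>
    have hl := cs.isLeftDescent_iff.1 hj
    have hw : w = cs.simple j * (cs.simple j * w) := by simp
    have hnj : ¬ cs.IsLeftDescent (cs.simple j * w) j := by
      simp only [IsLeftDescent, simple_mul_simple_cancel_left]; omega
    by_cases hi : cs.IsLeftDescent (cs.simple j * w) i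
    · obtain ⟨k, v, h1, h2, h3, h4⟩ := ih (cs.length (cs.simple j * w)) (by omega) j i _ hi rfl
      refine ⟨k + 1, v, ?_, by omega, h4, h3⟩
      rw [altProd, mul_assoc, ← h1]; exact hw
    · exact ⟨0, cs.simple j * w, by simp [altProd], by omega, hi, hnj⟩

variable [MulAction W X] {f : B → X → ℝ}

/-- In the dihedral group of i and j the coefficients are Chebyshev values sin(kt)/sin t with t =
π/`M i j`. The induction removes two letters at a time and uses sin((k+3)t) = 2 cos t sin((k+2)t) −
sin((k+1)t). Multiplying through by sin t avoids division. -/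
theorem altProd_functional
    (hf : ∀ i j x, f i (cs.simple j • x) = f i x + 2 * Real.cos (Real.pi / M i j) * f j x)
    (i j : B) (k : ℕ) (x : X) :
    f i (altProd (cs.simple j) (cs.simple i) k • x) * Real.sin (Real.pi / M i j) =
      if Even k then Real.sin ((k + 1) * (Real.pi / M i j)) * f i x +
        Real.sin (k * (Real.pi / M i j)) * f j x
      else Real.sin ((k + 1) * (Real.pi / M i j)) * f j x +
        Real.sin (k * (Real.pi / M i j)) * f i x := by
  induction k using Nat.strong_induction_on generalizing i j with
  | _ k ih =>
    match k with
    | 0 => simp [altProd, mul_comm]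
    | 1 =>
      simp only [altProd, mul_one, hf]
      rw [if_neg (by decide)]
      push_cast
      rw [show (1 + 1 : ℝ) * (Real.pi / M i j) = 2 * (Real.pi / M i j) by ring, Real.sin_two_mul]
      ring_nf
    | k + 2 =>
      have h1 := ih (k + 1) (by omega) j i
      have h2 := ih k (by omega) i j
      rw [M.symmetric j i] at h1
      set t := Real.pi / M i j
      have h3 : f i (altProd (cs.simple j) (cs.simple i) (k + 2) • x) =
          - f i (altProd (cs.simple j) (cs.simple i) k • x) +
            2 * Real.cos t * f j (altProd (cs.simple i) (cs.simple j) (k + 1) • x) := by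
        rw [altProd, mul_smul, hf]
        congr 1
        rw [altProd, mul_smul, hf, M.diagonal]
        simp; ring_nf
      have e3 : Real.sin (((k + 2 : ℕ) + 1 : ℝ) * t) =
          2 * Real.cos t * Real.sin (((k + 1 : ℕ) + 1 : ℝ) * t) - Real.sin ((k + 1 : ℝ) * t) := by
        have := Real.sin_add (((k + 1 : ℕ) + 1 : ℝ) * t) t
        have := Real.sin_sub (((k + 1 : ℕ) + 1 : ℝ) * t) t
        push_cast at *
        rw [show (k + 1 + 1 : ℝ) * t - t = (k + 1) * t by ring] at this
        rw [show (k + 2 + 1 : ℝ) * t = (k + 1 + 1) * t + t by ring]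
        linarith
      have e2 : Real.sin ((k + 2 : ℕ) * t) =
          2 * Real.cos t * Real.sin ((k + 1 : ℕ) * t) - Real.sin (k * t) := by
        have := Real.sin_add ((k + 1 : ℕ) * t) t
        have := Real.sin_sub ((k + 1 : ℕ) * t) t
        push_cast at *
        rw [show (k + 1 : ℝ) * t - t = k * t by ring] at this
        rw [show (k + 2 : ℝ) * t = (k + 1) * t + t by ring]
        linarith
      rw [h3, e3, e2, add_mul, mul_assoc (2 * Real.cos t), h1, neg_mul, h2]
      rcases Nat.even_or_odd k with hk | hk
      · rw [if_pos hk, if_neg (by simp [hk, parity_simps]), if_pos (by simp [hk, parity_simps])]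
        ring
      · rw [← Nat.not_even_iff_odd] at hk
        rw [if_neg hk, if_pos (by simp [hk, parity_simps]), if_neg (by simp [hk, parity_simps])]
        ring

/-- **Tits' lemma.** If a Coxeter group acts so that the functionals `f i` transform by the
geometric representation, then a chamber `w • C` lies on the positive side of the wall of `i`
unless `i` is a left descent of `w`. -/
theorem mem_cone_of_not_isLeftDescent (hM : ∀ i j, M i j ≠ 0)
    (hf : ∀ i j x, f i (cs.simple j • x) = f i x + 2 * Real.cos (Real.pi / M i j) * f j x)
    (C : ConvexCone ℝ ℝ) {x : X} (hx : ∀ i, f i x ∈ C) (w : W) (i : B)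
    (hi : ¬ cs.IsLeftDescent w i) : f i (w • x) ∈ C := by
  induction h : cs.length w using Nat.strong_induction_on generalizing i w with
  | _ N ih =>
    rcases eq_or_ne w 1 with rfl | hw
    · simpa using hx i
    obtain ⟨j, hj⟩ := cs.exists_leftDescent_of_ne_one hw
    have hij : i ≠ j := by rintro rfl; exact hi hj
    obtain ⟨k, v, h1, h2, h3, h4⟩ := cs.exists_altProd_mul_of_isLeftDescent i j w hj
    have hm : 1 < M i j := by
      have := M.off_diagonal i j hij
      have := hM i j
      omega
    -- An alternating word of at least `M i j` letters could be made to begin with i by the braid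
    -- relation, and i would be a left descent of w.
    have hk : k + 1 < M i j := by
      by_contra! hle
      obtain ⟨r, hr⟩ := Nat.exists_eq_add_of_le hle
      apply hi
      obtain ⟨c, hc1, hc2⟩ := altProd_add (cs.simple j) (cs.simple i) (M i j) r
      have hb : altProd (cs.simple j) (cs.simple i) (M i j) =
          cs.simple i * altProd (cs.simple j) (cs.simple i) (M i j - 1) := by
        rw [altProd_braid (cs.simple_mul_simple_self j) (cs.simple_mul_simple_self i)
          (by rw [M.symmetric]; exact cs.simple_mul_simple_pow j i)]
        conv_lhs => rw [show M i j = M i j - 1 + 1 by omega]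
        rw [altProd]
      have : cs.simple i * w = altProd (cs.simple j) (cs.simple i) (M i j - 1) * (c * v) := by
        rw [h1, hr, hc1, hb]; simp [mul_assoc]
      rw [IsLeftDescent, this]
      have l1 := cs.length_altProd_mul_le j i (M i j - 1) (c * v)
      have l2 : cs.length (c * v) ≤ r + cs.length v := by
        rcases hc2 with rfl | rfl
        · exact cs.length_altProd_mul_le _ _ _ _
        · exact cs.length_altProd_mul_le _ _ _ _
      omega
    have g1 := ih (cs.length v) (by omega) v i h3 rfl
    have g2 := ih (cs.length v) (by omega) v j h4 rfl
    have key := altProd_functional cs hf i j (k + 1) (v • x)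
    rw [← mul_smul, ← h1] at key
    have hm0 : (0 : ℝ) < M i j := by exact_mod_cast (by omega : 0 < M i j)
    set t := Real.pi / M i j with ht
    have hsin : ∀ q : ℕ, 0 < q → q < M i j → 0 < Real.sin (q * t) := by
      intro q hq hqm
      apply Real.sin_pos_of_pos_of_lt_pi
      · have : (0 : ℝ) < q := by exact_mod_cast hq
        positivity
      · rw [ht, ← mul_div_assoc, div_lt_iff₀ hm0, mul_comm]
        gcongr
    have hs1 : 0 < Real.sin t := by simpa using hsin 1 one_pos hm
    have hsk := hsin (k + 1) (by omega) hk
    -- Both coefficients are positive unless k + 2 = `M i j`, when the first is sin π = 0. The cone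
    -- need not contain 0, so that term has to be dropped before closure under addition is used.
    have hcomb : ∀ p ∈ C, ∀ q ∈ C, Real.sin (((k + 1 : ℕ) + 1 : ℝ) * t) * p +
        Real.sin ((k + 1 : ℕ) * t) * q ∈ C := by
      intro p hp q hq
      have hq' : Real.sin ((k + 1 : ℕ) * t) * q ∈ C := C.smul_mem hsk hq
      rcases (show k + 1 + 1 ≤ M i j by omega).lt_or_eq with hlt | heq
      · have := hsin (k + 1 + 1) (by omega) hlt
        push_cast at this ⊢
        push_cast at hq'
        exact C.add_mem (C.smul_mem this hp) hq'
      · have : ((k + 1 : ℕ) + 1 : ℝ) * t = Real.pi := by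
          rw [ht, ← heq]
          push_cast
          field_simp
        rw [this]
        simpa using hq'
    have hfin : f i (w • x) * Real.sin t ∈ C := by
      rw [key]
      split_ifs
      · exact hcomb _ g1 _ g2
      · exact hcomb _ g2 _ g1
    have := C.smul_mem (inv_pos.2 hs1) hfin
    rwa [smul_eq_mul, mul_comm, mul_assoc, mul_inv_cancel₀ hs1.ne', mul_one] at this

/-- If i is a left descent of w, it is not one of sᵢw, so Tits' lemma makes fᵢ(sᵢw x) = −fᵢ(w x)
positive. -/
theorem eq_one_of_smul_mem_chamber (hM : ∀ i j, M i j ≠ 0)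
    (hf : ∀ i j x, f i (cs.simple j • x) = f i x + 2 * Real.cos (Real.pi / M i j) * f j x)
    {x : X} (hx : ∀ i, 0 < f i x) {w : W} (hw : ∀ i, 0 < f i (w • x)) : w = 1 := by
  by_contra hne
  obtain ⟨i, hi⟩ := cs.exists_leftDescent_of_ne_one hne
  have h1 := cs.mem_cone_of_not_isLeftDescent hM hf (ConvexCone.strictlyPositive ℝ ℝ) (x := x) hx
    (cs.simple i * w) i (cs.isLeftDescent_iff_not_isLeftDescent_mul.1 hi)
  have h2 := hw i
  rw [mul_smul, hf, M.diagonal] at h1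
  simp at h1
  linarith

/-- The same argument with the closed cone gives fᵢ(w x) = 0 for a left descent i. So sᵢ fixes w x,
and induction on the length applies to sᵢw. -/
theorem smul_eq_of_mem_closed_chamber (hM : ∀ i j, M i j ≠ 0)
    (hf : ∀ i j x, f i (cs.simple j • x) = f i x + 2 * Real.cos (Real.pi / M i j) * f j x)
    (hfix : ∀ i x, f i x = 0 → cs.simple i • x = x)
    {x : X} (hx : ∀ i, 0 ≤ f i x) {w : W} (hw : ∀ i, 0 ≤ f i (w • x)) :
    w • x = x ∧ w ∈ Subgroup.closure (cs.simple '' {i | f i x = 0}) := by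
  induction h : cs.length w using Nat.strong_induction_on generalizing w with
  | _ N ih =>
    rcases eq_or_ne w 1 with rfl | hne
    · simp [one_mem]
    obtain ⟨i, hi⟩ := cs.exists_leftDescent_of_ne_one hne
    have h1 := cs.mem_cone_of_not_isLeftDescent hM hf (ConvexCone.positive ℝ ℝ) (x := x) hx
      (cs.simple i * w) i (cs.isLeftDescent_iff_not_isLeftDescent_mul.1 hi)
    rw [mul_smul, hf, M.diagonal] at h1
    simp at h1
    have h0 : f i (w • x) = 0 := by linarith [hw i]
    obtain ⟨h2, h3⟩ := ih _ (h ▸ hi) (w := cs.simple i * w) (fun j => by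
      rw [mul_smul, hf, h0]; simpa using hw j) rfl
    have h4 : cs.simple i • (w • x) = w • x := hfix i _ h0
    have h5 : w • x = x := by rw [← h4, ← mul_smul, h2]
    refine ⟨h5, ?_⟩
    have h6 : w = cs.simple i * (cs.simple i * w) := by simp
    rw [h6]
    exact mul_mem (Subgroup.subset_closure ⟨i, by simpa [h5] using h0, rfl⟩) h3

end CoxeterSystem

/-! ### Reflections of the upper half-plane -/

namespace UpperHalfPlane

/-- The matrix of the reflection of `ℍ` in the geodesic `r |τ|² - 2 p Re τ - q = 0`. -/
noncomputable def reflection (p q r : ℝ) (h : p ^ 2 + q * r = 1) : GL (Fin 2) ℝ :=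
  .mkOfDetNeZero !![p, q; r, -p] (by
    rw [Matrix.det_fin_two_of]; intro h'; linarith)

/-- The function on `ℍ` whose sign distinguishes the sides of a geodesic. -/
noncomputable def side (p q r : ℝ) (τ : ℍ) : ℝ :=
  (r * (τ.re ^ 2 + τ.im ^ 2) - 2 * p * τ.re - q) / τ.im

variable {p q r : ℝ} (h : p ^ 2 + q * r = 1)

theorem reflection_mul_self : reflection p q r h * reflection p q r h = 1 := by
  ext i j
  fin_cases i <;> fin_cases j <;> simp [reflection, Matrix.mul_apply, Fin.sum_univ_two] <;> linarith

theorem normSq_denom_reflection (τ : ℍ) : Complex.normSq (denom (reflection p q r h) τ) =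
    (r * τ.re - p) ^ 2 + (r * τ.im) ^ 2 := by
  simp [denom, reflection, Complex.normSq_apply]; ring

theorem reflection_denom_pos (h : p ^ 2 + q * r = 1) (τ : ℍ) : 0 < (r * τ.re - p) ^ 2 + (r * τ.im) ^ 2 := by
  rw [← normSq_denom_reflection h]
  exact normSq_denom_pos _ τ.im_ne_zero

theorem im_reflection_smul (τ : ℍ) : (reflection p q r h • τ).im =
    τ.im / ((r * τ.re - p) ^ 2 + (r * τ.im) ^ 2) := by
  rw [im_smul_eq_div_normSq, normSq_denom_reflection]
  have : (reflection p q r h).det.val = -1 := by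
    simp [reflection, Matrix.det_fin_two]; linarith
  rw [this]; simp

theorem re_reflection_smul (τ : ℍ) : (reflection p q r h • τ).re =
    ((p * τ.re + q) * (r * τ.re - p) + p * r * τ.im ^ 2) /
      ((r * τ.re - p) ^ 2 + (r * τ.im) ^ 2) := by
  rw [re_smul, Complex.div_re, normSq_denom_reflection]
  simp [num, denom, reflection]
  ring

theorem normSq_reflection_smul (τ : ℍ) :
    (reflection p q r h • τ).re ^ 2 + (reflection p q r h • τ).im ^ 2 =
      ((p * τ.re + q) ^ 2 + (p * τ.im) ^ 2) / ((r * τ.re - p) ^ 2 + (r * τ.im) ^ 2) := by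
  have hN := (reflection_denom_pos h τ).ne'
  rw [re_reflection_smul, im_reflection_smul, div_pow, div_pow, ← add_div,
    div_eq_div_iff (pow_ne_zero 2 hN) hN]
  linear_combination (-τ.im ^ 2 * (1 + p ^ 2 + q * r) * ((r * τ.re - p) ^ 2 + (r * τ.im) ^ 2)) * h

/-- The triple (p, q, r) is a unit normal for the quadratic form p² + qr on traceless matrices, and
2p'p + q'r + r'q is twice the polar form: this is the reflection formula in that normal. -/
theorem side_reflection_smul (p' q' r' : ℝ) (τ : ℍ) :
    side p' q' r' (reflection p q r h • τ) =
      side p' q' r' τ - (2 * p' * p + q' * r + r' * q) * side p q r τ := by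
  have hN := (reflection_denom_pos h τ).ne'
  have hy := τ.im_ne_zero
  simp only [side, normSq_reflection_smul]
  rw [re_reflection_smul, im_reflection_smul]
  generalize hD : (r * τ.re - p) ^ 2 + (r * τ.im) ^ 2 = N at hN
  field_simp
  rw [← hD]
  linear_combination (r' * (τ.re ^ 2 + τ.im ^ 2) - 2 * p' * τ.re - q') * h

theorem cosh_dist_eq (z w : ℍ) : Real.cosh (dist z w) =
    ((z.re ^ 2 + z.im ^ 2) + (w.re ^ 2 + w.im ^ 2) - 2 * z.re * w.re) / (2 * z.im * w.im) := by
  rw [cosh_dist']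
  congr 1
  ring

/-- This identity alone shows that a reflection is an isometry, fixes its geodesic pointwise, and
brings points of the negative side closer to points of the positive side. -/
theorem cosh_dist_reflection_smul (τ c : ℍ) : Real.cosh (dist (reflection p q r h • τ) c) =
    Real.cosh (dist τ c) + side p q r τ * side p q r c / 2 := by
  have hN := (reflection_denom_pos h τ).ne'
  have hy := τ.im_ne_zero
  have hc := c.im_ne_zero
  rw [cosh_dist_eq, cosh_dist_eq, normSq_reflection_smul, re_reflection_smul, im_reflection_smul,
    side, side]
  generalize hD : (r * τ.re - p) ^ 2 + (r * τ.im) ^ 2 = N at hN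
  field_simp
  rw [← hD]
  linear_combination (τ.re ^ 2 + τ.im ^ 2 + (c.re ^ 2 + c.im ^ 2) - 2 * τ.re * c.re) * h

theorem dist_reflection_smul_smul (τ c : ℍ) :
    dist (reflection p q r h • τ) (reflection p q r h • c) = dist τ c := by
  apply Real.cosh_strictMonoOn.injOn dist_nonneg dist_nonneg
  rw [cosh_dist_reflection_smul, dist_comm, cosh_dist_reflection_smul, side_reflection_smul,
    dist_comm]
  linear_combination (-side p q r τ * side p q r c) * h

theorem dist_reflection_smul_lt {τ c : ℍ} (hτ : side p q r τ < 0) (hc : 0 < side p q r c) :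
    dist (reflection p q r h • τ) c < dist τ c := by
  rw [← Real.cosh_strictMonoOn.lt_iff_lt (Set.mem_Ici.2 dist_nonneg) (Set.mem_Ici.2 dist_nonneg),
    cosh_dist_reflection_smul]
  linarith [mul_neg_of_neg_of_pos hτ hc]

theorem reflection_smul_eq_self {τ : ℍ} (hτ : side p q r τ = 0) : reflection p q r h • τ = τ := by
  rw [← dist_eq_zero]
  apply Real.cosh_strictMonoOn.injOn (Set.mem_Ici.2 dist_nonneg) (Set.mem_Ici.2 le_rfl)
  rw [cosh_dist_reflection_smul, hτ]
  simp

theorem continuous_side (p q r : ℝ) : Continuous (side p q r) := by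
  unfold side
  exact .div (by fun_prop) (by fun_prop) fun τ => τ.im_ne_zero

end UpperHalfPlane

/-! ### The reflection group of a hyperbolic triangle with angles `π/2, π/2n, π/2n` -/

theorem Matrix.fin_two_mul_self {R : Type*} [CommRing R] (A : Matrix (Fin 2) (Fin 2) R) :
    A * A = A.trace • A - A.det • 1 := by
  ext i j
  fin_cases i <;> fin_cases j <;>
    simp [Matrix.mul_apply, Fin.sum_univ_two, Matrix.trace_fin_two, Matrix.det_fin_two] <;> ring

/-- Cayley–Hamilton turns powers of A into the Chebyshev recursion. At t = π/m it yields A ^ m = −1.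
-/
theorem Matrix.sin_smul_pow {A : Matrix (Fin 2) (Fin 2) ℝ} {t : ℝ} (hdet : A.det = 1)
    (htr : A.trace = 2 * Real.cos t) (k : ℕ) :
    Real.sin t • A ^ (k + 1) = Real.sin ((k + 1) * t) • A - Real.sin (k * t) • 1 := by
  induction k with
  | zero => simp
  | succ k ih =>
    have e : Real.sin (((k + 1 : ℕ) + 1 : ℝ) * t) =
        2 * Real.cos t * Real.sin ((k + 1) * t) - Real.sin (k * t) := by
      have h1 := Real.sin_add ((k + 1) * t) t
      have h2 := Real.sin_sub ((k + 1) * t) t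
      push_cast
      rw [show (k + 1 : ℝ) * t - t = k * t by ring] at h2
      rw [show (k + 1 + 1 : ℝ) * t = (k + 1) * t + t by ring]
      linarith
    rw [pow_succ, ← smul_mul_assoc, ih, sub_mul, smul_mul_assoc, Matrix.fin_two_mul_self, hdet, htr,
      e]
    push_cast
    rw [smul_mul_assoc, one_mul]
    module

namespace HyperbolicTriangle

/-- The Coxeter matrix with entries `2, 2n, 2n`. -/
def coxeterMatrix (n : ℕ) : CoxeterMatrix (Fin 3) where
  M := !![1, 2, 2 * n; 2, 1, 2 * n; 2 * n, 2 * n, 1]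
  isSymm := by ext i j; fin_cases i <;> fin_cases j <;> rfl
  diagonal i := by fin_cases i <;> rfl
  off_diagonal i j h := by
    fin_cases i <;> fin_cases j <;> simp at h ⊢

/-- The abstract reflection group of the triangle. -/
abbrev ReflectionGroup (n : ℕ) : Type := (coxeterMatrix n).Group

def system (n : ℕ) : CoxeterSystem (coxeterMatrix n) (ReflectionGroup n) :=
  (coxeterMatrix n).toCoxeterSystem

/-- The cosine of the two equal angles. -/
noncomputable def κ (n : ℕ) : ℝ := Real.cos (Real.pi / (2 * n))

/-- Chosen so that (−κ, κ − δ, κ + δ) is a unit normal: κ² + (κ² − δ²) = 1. The radicand is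
cos(π/n), positive for n ≥ 3. -/
noncomputable def δ (n : ℕ) : ℝ := √(2 * κ n ^ 2 - 1)

variable (n : ℕ) [hn : Fact (3 ≤ n)]

theorem n_pos : (0 : ℝ) < n := by
  have := hn.out
  exact_mod_cast (by omega : 0 < n)

theorem angle_pos : 0 < Real.pi / (2 * n) := by
  have := n_pos n
  positivity

theorem angle_lt : Real.pi / (2 * n) < Real.pi / 4 := by
  have h3 : (3 : ℝ) ≤ n := by exact_mod_cast hn.out
  apply div_lt_div_of_pos_left Real.pi_pos (by norm_num)
  linarith

theorem κ_pos : 0 < κ n := by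
  apply Real.cos_pos_of_mem_Ioo
  constructor <;> linarith [angle_pos n, angle_lt n, Real.pi_pos]

theorem one_lt_two_mul_κ_sq : 1 < 2 * κ n ^ 2 := by
  have h : 2 * κ n ^ 2 - 1 = Real.cos (2 * (Real.pi / (2 * n))) := by rw [Real.cos_two_mul]; rfl
  have : 0 < Real.cos (2 * (Real.pi / (2 * n))) := by
    apply Real.cos_pos_of_mem_Ioo
    constructor <;> linarith [angle_pos n, angle_lt n, Real.pi_pos]
  linarith

theorem κ_lt_one : κ n < 1 := by
  rw [κ, ← Real.cos_zero]
  exact Real.cos_lt_cos_of_nonneg_of_le_pi_div_two le_rfl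
    (by linarith [angle_lt n, Real.pi_pos]) (angle_pos n)

theorem δ_sq : δ n ^ 2 = 2 * κ n ^ 2 - 1 :=
  Real.sq_sqrt (by linarith [one_lt_two_mul_κ_sq n])

theorem δ_pos : 0 < δ n := Real.sqrt_pos.2 (by linarith [one_lt_two_mul_κ_sq n])

theorem δ_lt_κ : δ n < κ n := by
  apply lt_of_pow_lt_pow_left₀ 2 (κ_pos n).le
  rw [δ_sq]
  nlinarith [κ_pos n, κ_lt_one n]

/-- The coefficients of the three sides. -/
noncomputable def cp : Fin 3 → ℝ := ![1, 0, -κ n]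
noncomputable def cq : Fin 3 → ℝ := ![0, -1, κ n - δ n]
noncomputable def cr : Fin 3 → ℝ := ![0, -1, κ n + δ n]

theorem coeff_eq_one (i : Fin 3) : cp n i ^ 2 + cq n i * cr n i = 1 := by
  have := δ_sq n
  fin_cases i <;> simp [cp, cq, cr]
  linarith

noncomputable def mirror (i : Fin 3) : GL (Fin 2) ℝ :=
  UpperHalfPlane.reflection (cp n i) (cq n i) (cr n i) (coeff_eq_one n i)

noncomputable def wall (i : Fin 3) : ℍ → ℝ := UpperHalfPlane.side (cp n i) (cq n i) (cr n i)

omit hn in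
theorem cos_coxeterMatrix (i j : Fin 3) (h : i ≠ j) :
    2 * Real.cos (Real.pi / coxeterMatrix n i j) =
      -(2 * cp n i * cp n j + cq n i * cr n j + cr n i * cq n j) := by
  fin_cases i <;> fin_cases j <;> simp at h <;>
    simp [coxeterMatrix, cp, cq, cr, κ] <;> ring

theorem cos_coxeterMatrix' (i j : Fin 3) :
    2 * Real.cos (Real.pi / coxeterMatrix n i j) =
      -(2 * cp n i * cp n j + cq n i * cr n j + cr n i * cq n j) := by
  rcases eq_or_ne i j with rfl | h
  · rw [(coxeterMatrix n).diagonal]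
    simp
    linarith [coeff_eq_one n i]
  · exact cos_coxeterMatrix n i j h

theorem wall_mirror_smul (i j : Fin 3) (τ : ℍ) : wall n i (mirror n j • τ) =
    wall n i τ + 2 * Real.cos (Real.pi / coxeterMatrix n i j) * wall n j τ := by
  rw [cos_coxeterMatrix', wall, mirror, UpperHalfPlane.side_reflection_smul]
  simp only [wall]
  ring

theorem coxeterMatrix_ne_zero (i j : Fin 3) : coxeterMatrix n i j ≠ 0 := by
  have := hn.out
  fin_cases i <;> fin_cases j <;> simp [coxeterMatrix] <;> omega

/-- For i ≠ j the product of two mirrors has determinant 1 and trace −2 cos(π/m). Its negative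
therefore has m-th power −1, and the product itself has order dividing m modulo scalars. -/
theorem isLiftable_mirror : (coxeterMatrix n).IsLiftable
    fun i => (Matrix.ProjGenLinGroup.mk (mirror n i) : PGL(2, ℝ)) := by
  intro i j
  rcases eq_or_ne i j with rfl | h
  · rw [← map_mul, ← map_pow, mirror, UpperHalfPlane.reflection_mul_self]
    simp
  rw [← map_mul, ← map_pow, Matrix.ProjGenLinGroup.mk_eq_one,
    Matrix.GeneralLinearGroup.center_eq_range_scalar]
  set m := coxeterMatrix n i j with hm
  have hm0 : 1 < m := by
    have := (coxeterMatrix n).off_diagonal i j h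
    have := coxeterMatrix_ne_zero n i j
    omega
  have hmr : (1 : ℝ) < m := by exact_mod_cast hm0
  set A : Matrix (Fin 2) (Fin 2) ℝ := -(mirror n i * mirror n j).val with hA
  have hdet : A.det = 1 := by
    rw [hA, Matrix.det_neg, Units.val_mul, Matrix.det_mul]
    simp [mirror, UpperHalfPlane.reflection, Matrix.det_fin_two]
    linear_combination (cp n i ^ 2 + cq n i * cr n i) * coeff_eq_one n j + coeff_eq_one n i
  have htr : A.trace = 2 * Real.cos (Real.pi / m) := by
    rw [cos_coxeterMatrix n i j h, hA, Matrix.trace_fin_two]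
    simp [mirror, UpperHalfPlane.reflection]
    ring
  have key := Matrix.sin_smul_pow hdet htr (m - 1)
  have e1 : (((m - 1 : ℕ) : ℝ) + 1) * (Real.pi / m) = Real.pi := by
    rw [Nat.cast_pred (by omega)]
    field_simp
    ring
  have hs : 0 < Real.sin (Real.pi / m) := by
    apply Real.sin_pos_of_pos_of_lt_pi (div_pos Real.pi_pos (by linarith))
    exact div_lt_self Real.pi_pos hmr
  rw [show m - 1 + 1 = m by omega, e1, Real.sin_pi, zero_smul, zero_sub] at key
  have e2 : Real.sin (((m - 1 : ℕ) : ℝ) * (Real.pi / m)) = Real.sin (Real.pi / m) := by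
    rw [show ((m - 1 : ℕ) : ℝ) * (Real.pi / m) = Real.pi - Real.pi / m by linarith,
      Real.sin_pi_sub]
  rw [e2, ← smul_neg] at key
  have key2 : A ^ m = -1 := smul_right_injective _ hs.ne' key
  have key3 : ((mirror n i * mirror n j) ^ m).val = (-1) ^ m * -1 := by
    rw [Units.val_pow_eq_pow_val, ← neg_neg (mirror n i * mirror n j).val, ← hA, neg_pow, key2]
  refine ⟨(-1) ^ (m + 1), Units.ext ?_⟩
  rw [key3, Matrix.GeneralLinearGroup.coe_scalar]
  push_cast
  rw [map_pow, map_neg, map_one, pow_succ]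

noncomputable def toPGL : ReflectionGroup n →* PGL(2, ℝ) :=
  (system n).lift ⟨_, isLiftable_mirror n⟩

theorem toPGL_simple (i : Fin 3) :
    toPGL n ((system n).simple i) = Matrix.ProjGenLinGroup.mk (mirror n i) :=
  (system n).lift_apply_simple (isLiftable_mirror n) i

noncomputable instance : MulAction (ReflectionGroup n) ℍ := MulAction.compHom ℍ (toPGL n)

theorem smul_def (g : ReflectionGroup n) (τ : ℍ) : g • τ = toPGL n g • τ := rfl

theorem simple_smul (i : Fin 3) (τ : ℍ) : (system n).simple i • τ = mirror n i • τ := by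
  rw [smul_def, toPGL_simple, UpperHalfPlane.pglMk_smul]

theorem wall_simple_smul (i j : Fin 3) (τ : ℍ) : wall n i ((system n).simple j • τ) =
    wall n i τ + 2 * Real.cos (Real.pi / coxeterMatrix n i j) * wall n j τ := by
  rw [simple_smul, wall_mirror_smul]

theorem dist_smul_smul (g : ReflectionGroup n) (τ c : ℍ) : dist (g • τ) (g • c) = dist τ c := by
  induction g using (system n).simple_induction_left with
  | one => simp
  | mul_simple_left g i ih =>
    rw [mul_smul, mul_smul, simple_smul, simple_smul, mirror,
      UpperHalfPlane.dist_reflection_smul_smul, ih]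

/-- The chamber is given by Re τ < 0, |τ| < 1 and (κ + δ)|τ|² + 2κ Re τ > κ − δ. The witness has
small negative real part −δ/4 and |τ|² = 1 − δ/4. -/
theorem exists_mem_chamber : ∃ c : ℍ, ∀ i, 0 < wall n i c := by
  have hκ := κ_pos n
  have hδ := δ_pos n
  have hδκ := δ_lt_κ n
  have hκ1 := κ_lt_one n
  have hy : 0 < 1 - δ n / 4 - (δ n / 4) ^ 2 := by nlinarith
  refine ⟨⟨⟨-(δ n / 4), √(1 - δ n / 4 - (δ n / 4) ^ 2)⟩, Real.sqrt_pos.2 hy⟩, fun i => ?_⟩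
  apply div_pos _ (Real.sqrt_pos.2 hy)
  have hsq := Real.sq_sqrt hy.le
  fin_cases i <;> simp [cp, cq, cr, UpperHalfPlane.re, UpperHalfPlane.im, hδ]
  · rw [hsq]
    nlinarith
  · rw [hsq]
    nlinarith

/-- The first two sides meet only at i, where the third function has the value 2δ. Hence at most two
sides pass through a point. -/
theorem wall_ne_zero (τ : ℍ) : ∃ i, wall n i τ ≠ 0 := by
  have hδ := δ_pos n
  by_contra! h
  have h0 := h 0
  have h1 := h 1
  have h2 := h 2
  simp [wall, UpperHalfPlane.side, cp, cq, cr, UpperHalfPlane.im_ne_zero] at h0 h1 h2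
  rw [h0] at h1 h2
  have h3 : τ.im ^ 2 = 1 := by linarith
  rw [h3] at h2
  linarith

/-- The height on the triangle is at least √e, the height of the vertex on sides 0 and 2. Inside the
unit disc cosh dist(τ, i) = (|τ|² + 1)/(2 Im τ) ≤ 1/Im τ, so the triangle is bounded. -/
theorem isCompact_closedChamber : IsCompact {τ : ℍ | ∀ i, 0 ≤ wall n i τ} := by
  have hκ := κ_pos n
  have hδ := δ_pos n
  have hδκ := δ_lt_κ n
  have hclosed : IsClosed {τ : ℍ | ∀ i, 0 ≤ wall n i τ} := by
    simp only [Set.ofPred_forall]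
    exact isClosed_iInter fun i =>
      isClosed_le continuous_const (UpperHalfPlane.continuous_side _ _ _)
  set e : ℝ := (κ n - δ n) / (κ n + δ n) with he
  have he0 : 0 < e := div_pos (by linarith) (by linarith)
  refine (isCompact_closedBall UpperHalfPlane.I (1 / √e)).of_isClosed_subset hclosed fun τ hτ => ?_
  have hy := τ.im_pos
  have h0 := hτ 0
  have h1 := hτ 1
  have h2 := hτ 2
  rw [wall, UpperHalfPlane.side, le_div_iff₀ hy, zero_mul] at h0 h1 h2
  simp [cp, cq, cr] at h0 h1 h2
  have hx : -1 ≤ τ.re := by nlinarith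
  have hy2 : e ≤ τ.im ^ 2 := by
    rw [he, div_le_iff₀ (by linarith)]
    have : 0 ≤ (-τ.re) * (1 + τ.re) * (κ n + δ n) :=
      mul_nonneg (mul_nonneg (by linarith) (by linarith)) (by linarith)
    nlinarith
  have hy3 : √e ≤ τ.im := by
    rw [Real.sqrt_le_left hy.le]
    exact hy2
  have hse : 0 < √e := Real.sqrt_pos.2 he0
  rw [Metric.mem_closedBall]
  calc dist τ UpperHalfPlane.I ≤ Real.sinh (dist τ UpperHalfPlane.I) :=
        Real.self_le_sinh_iff.2 dist_nonneg
    _ ≤ Real.cosh (dist τ UpperHalfPlane.I) := (Real.sinh_lt_cosh _).le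
    _ ≤ 1 / τ.im := by
      rw [UpperHalfPlane.cosh_dist_eq]
      simp
      rw [div_le_iff₀ (by positivity)]
      field_simp
      linarith
    _ ≤ 1 / √e := one_div_le_one_div_of_le hse hy3

end HyperbolicTriangle

/-! ### The tessellation: faithfulness, local finiteness and covering -/

namespace HyperbolicTriangle

variable (n : ℕ) [hn : Fact (3 ≤ n)]

theorem eq_one_of_smul_mem_chamber {c : ℍ} (hc : ∀ i, 0 < wall n i c) {g : ReflectionGroup n}
    (hg : ∀ i, 0 < wall n i (g • c)) : g = 1 :=
  (system n).eq_one_of_smul_mem_chamber (coxeterMatrix_ne_zero n) (wall_simple_smul n) hc hg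

theorem toPGL_injective : Function.Injective (toPGL n) := by
  rw [injective_iff_map_eq_one]
  intro g hg
  obtain ⟨c, hc⟩ := exists_mem_chamber n
  exact eq_one_of_smul_mem_chamber n hc (by rwa [smul_def, hg, one_smul])

/-- Orbits of points in the open chamber are locally finite. -/
theorem finite_dist_smul_le {c : ℍ} (hc : ∀ i, 0 < wall n i c) (R : ℝ) :
    {g : ReflectionGroup n | dist (g • c) c ≤ R}.Finite := by
  have hopen : IsOpen {τ : ℍ | ∀ i, 0 < wall n i τ} := by
    simp only [Set.ofPred_forall]
    exact isOpen_iInter_of_finite fun i =>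
      isOpen_lt continuous_const (UpperHalfPlane.continuous_side _ _ _)
  obtain ⟨ε, hε, hball⟩ := Metric.isOpen_iff.1 hopen c hc
  -- Pigeonhole: two orbit points in one ball of radius ε/2 differ by an element moving c by less
  -- than ε, hence within its open chamber, and such an element is 1.
  obtain ⟨t, -, htf, hcov⟩ :=
    (isCompact_closedBall c R).finite_cover_balls (half_pos hε)
  choose! φ hφ using fun (g : ReflectionGroup n) (hg : dist (g • c) c ≤ R) =>
    Set.mem_iUnion₂.1 (hcov (Metric.mem_closedBall.2 hg))
  refine Set.Finite.of_finite_image (f := φ) (htf.subset ?_) ?_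
  · rintro _ ⟨g, hg, rfl⟩
    exact (hφ g hg).1
  · intro g hg g' hg' heq
    have h1 := Metric.mem_ball.1 (hφ g hg).2
    have h2 := Metric.mem_ball.1 (hφ g' hg').2
    rw [← heq] at h2
    have h3 : dist ((g'⁻¹ * g) • c) c < ε := by
      rw [← dist_smul_smul n g', ← mul_smul, mul_inv_cancel_left]
      linarith [dist_triangle_right (g • c) (g' • c) (φ g)]
    have h4 := eq_one_of_smul_mem_chamber n hc (hball (Metric.mem_ball.2 h3))
    exact (inv_mul_eq_one.1 h4).symm

/-- A translate of τ nearest to an interior point c lies in the closed chamber, since reflection in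
a violated side would bring it nearer. Local finiteness provides the minimum. -/
theorem exists_smul_mem_closedChamber (τ : ℍ) :
    ∃ g : ReflectionGroup n, ∀ i, 0 ≤ wall n i (g • τ) := by
  obtain ⟨c, hc⟩ := exists_mem_chamber n
  have hfin : {g : ReflectionGroup n | dist (g • τ) c ≤ dist τ c}.Finite := by
    have h := (finite_dist_smul_le n hc (2 * dist τ c)).preimage
      (f := fun g : ReflectionGroup n => g) (Function.injective_id.injOn)
    refine h.subset fun g hg => ?_
    have h1 := dist_triangle_left (g • c) c (g • τ)
    rw [dist_smul_smul] at h1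
    have h2 : dist (g • τ) c ≤ dist τ c := hg
    exact h1.trans (by linarith)
  obtain ⟨g, hg, hmin⟩ := hfin.exists_minimalFor (fun g : ReflectionGroup n => dist (g • τ) c) _
    ⟨1, by simp⟩
  refine ⟨g, fun i => ?_⟩
  by_contra! hneg
  have hlt : dist ((system n).simple i • g • τ) c < dist (g • τ) c := by
    rw [simple_smul]
    exact UpperHalfPlane.dist_reflection_smul_lt _ hneg (hc i)
  rw [← mul_smul] at hlt
  exact absurd (hmin (j := (system n).simple i * g)
    (hlt.le.trans hg) hlt.le) (not_le.2 hlt)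

/-! ### The triangle group -/

/-- The three matrices are the negatives of the products of consecutive mirrors. This sign makes the
traces 2 cos(π/2), 2 cos(π/2n), 2 cos(π/2n) and the lower left entries negative, so that the
rotations are in the positive sense. -/
noncomputable def matU : SL(2, ℝ) := ⟨!![0, 1; -1, 0], by simp⟩

noncomputable def matV : SL(2, ℝ) := ⟨!![κ n + δ n, κ n; -κ n, κ n - δ n], by
  rw [Matrix.det_fin_two_of]; linear_combination -δ_sq n⟩

noncomputable def matW : SL(2, ℝ) := ⟨!![κ n, κ n - δ n; -(κ n + δ n), κ n], by
  rw [Matrix.det_fin_two_of]; linear_combination -δ_sq n⟩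

/-- The triangle group of type `(2, 2n, 2n)`. -/
noncomputable def triangleGroup : Subgroup PSL(2, ℝ) :=
  Subgroup.closure {QuotientGroup.mk matU, QuotientGroup.mk (matV n), QuotientGroup.mk (matW n)}

noncomputable def genU : triangleGroup n := ⟨_, Subgroup.subset_closure (Or.inl rfl)⟩
noncomputable def genV : triangleGroup n := ⟨_, Subgroup.subset_closure (Or.inr (Or.inl rfl))⟩
noncomputable def genW : triangleGroup n := ⟨_, Subgroup.subset_closure (Or.inr (Or.inr rfl))⟩

theorem closure_gen : Subgroup.closure {genU n, genV n, genW n} = ⊤ := by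
  have := Subgroup.closure_closure_coe_preimage
    (k := {QuotientGroup.mk matU, QuotientGroup.mk (matV n), (QuotientGroup.mk (matW n) : PSL(2, ℝ))})
  refine Eq.trans ?_ this
  congr 1
  ext g
  simp only [Set.mem_insert_iff, Set.mem_singleton_iff, Subtype.ext_iff]
  rfl

open Matrix in
theorem toPGL_genU : ProjectiveSpecialLinearGroup.toPGL (genU n : PSL(2, ℝ)) =
    toPGL n ((system n).simple 0 * (system n).simple 1) := by
  rw [map_mul, toPGL_simple, toPGL_simple, ← map_mul]
  refine ProjGenLinGroup.mk_eq_mk_iff.2 ⟨-1, Units.ext ?_⟩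
  change !![0, 1; -1, 0] * ((GeneralLinearGroup.scalar (Fin 2) (-1 : ℝˣ)).val) = _
  ext i j
  fin_cases i <;> fin_cases j <;>
    simp [mirror, UpperHalfPlane.reflection, cp, cq, cr, sub_eq_add_neg, add_comm]

open Matrix in
theorem toPGL_genV : ProjectiveSpecialLinearGroup.toPGL (genV n : PSL(2, ℝ)) =
    toPGL n ((system n).simple 1 * (system n).simple 2) := by
  rw [map_mul, toPGL_simple, toPGL_simple, ← map_mul]
  refine ProjGenLinGroup.mk_eq_mk_iff.2 ⟨-1, Units.ext ?_⟩
  change !![κ n + δ n, κ n; -κ n, κ n - δ n] * ((GeneralLinearGroup.scalar (Fin 2) (-1 : ℝˣ)).val) = _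
  ext i j
  fin_cases i <;> fin_cases j <;>
    simp [mirror, UpperHalfPlane.reflection, cp, cq, cr, sub_eq_add_neg, add_comm]

open Matrix in
theorem toPGL_genW : ProjectiveSpecialLinearGroup.toPGL (genW n : PSL(2, ℝ)) =
    toPGL n ((system n).simple 2 * (system n).simple 0) := by
  rw [map_mul, toPGL_simple, toPGL_simple, ← map_mul]
  refine ProjGenLinGroup.mk_eq_mk_iff.2 ⟨-1, Units.ext ?_⟩
  change !![κ n, κ n - δ n; -(κ n + δ n), κ n] * ((GeneralLinearGroup.scalar (Fin 2) (-1 : ℝˣ)).val) = _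
  ext i j
  fin_cases i <;> fin_cases j <;>
    simp [mirror, UpperHalfPlane.reflection, cp, cq, cr, sub_eq_add_neg, add_comm]

theorem toPGL_mem_range (g : triangleGroup n) :
    Matrix.ProjectiveSpecialLinearGroup.toPGL (g : PSL(2, ℝ)) ∈ (toPGL n).range := by
  have : triangleGroup n ≤ (toPGL n).range.comap Matrix.ProjectiveSpecialLinearGroup.toPGL := by
    rw [triangleGroup, Subgroup.closure_le]
    rintro _ (rfl | rfl | rfl)
    · exact ⟨_, (toPGL_genU n).symm⟩
    · exact ⟨_, (toPGL_genV n).symm⟩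
    · exact ⟨_, (toPGL_genW n).symm⟩
  exact this g.2

/-- The inclusion of the triangle group in the abstract reflection group. -/
noncomputable def toReflection : triangleGroup n →* ReflectionGroup n :=
  (MonoidHom.ofInjective (toPGL_injective n)).symm.toMonoidHom.comp
    ((Matrix.ProjectiveSpecialLinearGroup.toPGL.comp (triangleGroup n).subtype).codRestrict
      (toPGL n).range (toPGL_mem_range n))

theorem toPGL_toReflection (g : triangleGroup n) :
    toPGL n (toReflection n g) = Matrix.ProjectiveSpecialLinearGroup.toPGL (g : PSL(2, ℝ)) :=
  congrArg Subtype.val ((MonoidHom.ofInjective (toPGL_injective n)).apply_symm_apply _)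

theorem toReflection_injective : Function.Injective (toReflection n) := by
  intro g g' h
  have := congrArg (toPGL n) h
  rw [toPGL_toReflection, toPGL_toReflection] at this
  exact Subtype.ext (Matrix.ProjectiveSpecialLinearGroup.toPGL_injective this)

theorem toReflection_smul (g : triangleGroup n) (τ : ℍ) :
    toReflection n g • τ = (g : PSL(2, ℝ)) • τ := by
  rw [smul_def, toPGL_toReflection]
  rfl

theorem toReflection_genU :
    toReflection n (genU n) = (system n).simple 0 * (system n).simple 1 :=
  toPGL_injective n (by rw [toPGL_toReflection, toPGL_genU])

theorem toReflection_genV :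
    toReflection n (genV n) = (system n).simple 1 * (system n).simple 2 :=
  toPGL_injective n (by rw [toPGL_toReflection, toPGL_genV])

theorem toReflection_genW :
    toReflection n (genW n) = (system n).simple 2 * (system n).simple 0 :=
  toPGL_injective n (by rw [toPGL_toReflection, toPGL_genW])

theorem genU_mul_genV_mul_genW : genU n * genV n * genW n = 1 := by
  apply toReflection_injective n
  rw [map_mul, map_mul, toReflection_genU, toReflection_genV, toReflection_genW]
  simp [mul_assoc, CoxeterSystem.simple_mul_simple_self]

theorem simple_mul_simple_mem_range (i j : Fin 3) :
    (system n).simple i * (system n).simple j ∈ (toReflection n).range := by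
  have h01 := MonoidHom.mem_range.2 ⟨_, toReflection_genU n⟩
  have h12 := MonoidHom.mem_range.2 ⟨_, toReflection_genV n⟩
  have h20 := MonoidHom.mem_range.2 ⟨_, toReflection_genW n⟩
  have h10 := inv_mem h01
  have h21 := inv_mem h12
  have h02 := inv_mem h20
  simp only [mul_inv_rev, CoxeterSystem.inv_simple] at h10 h21 h02
  fin_cases i <;> fin_cases j <;> 
    first | assumption | simp [CoxeterSystem.simple_mul_simple_self, -MonoidHom.mem_range, one_mem]

/-- The triangle group has index at most two in the reflection group, and any single reflection can
be used to change coset. -/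
theorem mem_range_or_mul_simple_mem_range (g : ReflectionGroup n) (i : Fin 3) :
    g ∈ (toReflection n).range ∨ g * (system n).simple i ∈ (toReflection n).range := by
  induction g using (system n).simple_induction_right with
  | one => exact Or.inl (one_mem _)
  | mul_simple_right g j ih =>
    rcases ih with h | h
    · right
      rw [mul_assoc]
      exact mul_mem h (simple_mul_simple_mem_range n j i)
    · left
      have := mul_mem h (simple_mul_simple_mem_range n i j)
      rwa [mul_assoc, CoxeterSystem.simple_mul_simple_cancel_left] at this

theorem lengthParity_toReflection (g : triangleGroup n) :
    (system n).lengthParity (toReflection n g) = 1 := by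
  have h : Subgroup.closure {genU n, genV n, genW n} ≤
      ((system n).lengthParity.comp (toReflection n)).ker := by
    rw [Subgroup.closure_le]
    rintro _ (rfl | rfl | rfl) <;>
      simp [MonoidHom.mem_ker, toReflection_genU, toReflection_genV, toReflection_genW,
        CoxeterSystem.lengthParity_simple] <;> rfl
  rw [closure_gen] at h
  exact h (Subgroup.mem_top g)

end HyperbolicTriangle

namespace HyperbolicTriangle

variable (n : ℕ) [hn : Fact (3 ≤ n)]

/-! ### Homomorphisms from the triangle group -/

/-- The involution `(a, ±) ↦ (g^{∓1} a, ∓)` of `G × {±}`. -/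
def flipPerm {G : Type*} [Group G] (g : G) : Equiv.Perm (G × Bool) :=
  Function.Involutive.toPerm (fun a => (cond a.2 g⁻¹ g * a.1, !a.2)) (by
    rintro ⟨a, _ | _⟩ <;> simp)

theorem flipPerm_mul_flipPerm_pow {G : Type*} [Group G] (g h a : G) (m : ℕ) :
    ((flipPerm g * flipPerm h) ^ m) (a, true) = ((g * h⁻¹) ^ m * a, true) ∧
    ((flipPerm g * flipPerm h) ^ m) (a, false) = ((g⁻¹ * h) ^ m * a, false) := by
  induction m with
  | zero => simp
  | succ m ih =>
    have ht : ∀ g a : G, flipPerm g (a, true) = (g⁻¹ * a, false) := fun _ _ => rfl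
    have hf : ∀ g a : G, flipPerm g (a, false) = (g * a, true) := fun _ _ => rfl
    simp [pow_succ', ih, ht, hf, mul_assoc]

theorem flipPerm_mul_flipPerm_pow_eq_one {G : Type*} [Group G] {g h : G} {m : ℕ}
    (hm : (g * h⁻¹) ^ m = 1) : (flipPerm g * flipPerm h) ^ m = 1 := by
  have h2 : (g⁻¹ * h) ^ m = 1 := by
    rw [show g⁻¹ * h = g⁻¹ * (g * h⁻¹)⁻¹ * g⁻¹⁻¹ by group, conj_pow, inv_pow, hm]
    simp
  ext ⟨a, _ | _⟩ : 1
  · rw [(flipPerm_mul_flipPerm_pow g h a m).2, h2]; simp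
  · rw [(flipPerm_mul_flipPerm_pow g h a m).1, hm]; simp

/-- The relations x² = y²ⁿ = z²ⁿ = xyz = 1 suffice for Δ*. The Coxeter group acts on G × {±} by
`flipPerm (g i)`; a product of generators i and j acts on the positive copy as left multiplication
by gᵢgⱼ⁻¹, and g = (x, 1, y⁻¹) makes these x, y, z. Evaluation at 1 then recovers the homomorphism.
-/
theorem exists_hom {G : Type*} [Group G] {x y z : G} (hxyz : x * y * z = 1) (hx : x ^ 2 = 1)
    (hy : y ^ (2 * n) = 1) (hz : z ^ (2 * n) = 1) :
    ∃ θ : triangleGroup n →* G, θ (genU n) = x ∧ θ (genV n) = y ∧ θ (genW n) = z := by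
  set g : Fin 3 → G := ![x, 1, y⁻¹] with hg
  have hz' : z = y⁻¹ * x⁻¹ := by
    rw [← mul_inv_rev]; exact eq_inv_of_mul_eq_one_right hxyz
  have key : ∀ i j, (g i * (g j)⁻¹) ^ coxeterMatrix n i j = 1 := by
    have h01 : (g 0 * (g 1)⁻¹) ^ coxeterMatrix n 0 1 = 1 := by
      rw [show g 0 * (g 1)⁻¹ = x by simp [hg]]; exact hx
    have h12 : (g 1 * (g 2)⁻¹) ^ coxeterMatrix n 1 2 = 1 := by
      rw [show g 1 * (g 2)⁻¹ = y by simp [hg]]; exact hy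
    have h20 : (g 2 * (g 0)⁻¹) ^ coxeterMatrix n 2 0 = 1 := by
      rw [show g 2 * (g 0)⁻¹ = z by simp [hg, hz']]; exact hz
    have hinv : ∀ i j, (g i * (g j)⁻¹) ^ coxeterMatrix n i j = 1 →
        (g j * (g i)⁻¹) ^ coxeterMatrix n j i = 1 := by
      intro i j h
      rw [(coxeterMatrix n).symmetric j i, ← inv_inj, ← inv_pow, mul_inv_rev, inv_inv, h, inv_one]
    intro i j
    fin_cases i <;> fin_cases j <;>
      first | exact h01 | exact h12 | exact h20 | exact hinv _ _ h01 | exact hinv _ _ h12 |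
        exact hinv _ _ h20 | simp
  have hlift : (coxeterMatrix n).IsLiftable fun i => flipPerm (g i) := fun i j =>
    flipPerm_mul_flipPerm_pow_eq_one (key i j)
  set Θ := ((system n).lift ⟨_, hlift⟩).comp (toReflection n) with hΘ
  have hgen : ∀ (γ : triangleGroup n) (i j : Fin 3),
      toReflection n γ = (system n).simple i * (system n).simple j →
      ∀ a, Θ γ (a, true) = (g i * (g j)⁻¹ * a, true) := by
    intro γ i j h a
    have := (flipPerm_mul_flipPerm_pow (g i) (g j) a 1).1
    rw [pow_one, pow_one] at this
    rw [hΘ, MonoidHom.comp_apply, h, map_mul, CoxeterSystem.lift_apply_simple,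
      CoxeterSystem.lift_apply_simple, this]
  have hall : ∀ γ : triangleGroup n, ∃ b : G, ∀ a, Θ γ (a, true) = (b * a, true) := by
    intro γ
    have hγ : γ ∈ Subgroup.closure {genU n, genV n, genW n} := by
      rw [closure_gen]; exact Subgroup.mem_top γ
    induction hγ using Subgroup.closure_induction with
    | mem γ h =>
      rcases h with rfl | rfl | rfl
      · exact ⟨_, hgen _ _ _ (toReflection_genU n)⟩
      · exact ⟨_, hgen _ _ _ (toReflection_genV n)⟩
      · exact ⟨_, hgen _ _ _ (toReflection_genW n)⟩
    | one => exact ⟨1, by simp⟩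
    | mul γ γ' _ _ h h' =>
      obtain ⟨b, hb⟩ := h
      obtain ⟨b', hb'⟩ := h'
      exact ⟨b * b', fun a => by rw [map_mul, Equiv.Perm.mul_apply, hb', hb, mul_assoc]⟩
    | inv γ _ h =>
      obtain ⟨b, hb⟩ := h
      refine ⟨b⁻¹, fun a => ?_⟩
      rw [map_inv, Equiv.Perm.inv_eq_iff_eq, hb, mul_inv_cancel_left]
  have hval : ∀ (γ : triangleGroup n) (a : G), Θ γ (a, true) = ((Θ γ (1, true)).1 * a, true) := by
    intro γ a
    obtain ⟨b, hb⟩ := hall γ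
    rw [hb, hb, mul_one]
  refine ⟨MonoidHom.mk' (fun γ => (Θ γ (1, true)).1) ?_, ?_, ?_, ?_⟩
  · intro γ γ'
    rw [map_mul, Equiv.Perm.mul_apply, hval γ', hval γ, mul_one]
  · exact congrArg Prod.fst (hgen _ _ _ (toReflection_genU n) 1) |>.trans (by simp [hg])
  · exact congrArg Prod.fst (hgen _ _ _ (toReflection_genV n) 1) |>.trans (by simp [hg])
  · exact congrArg Prod.fst (hgen _ _ _ (toReflection_genW n) 1) |>.trans (by simp [hg, hz'])

/-! ### Torsion-free subgroups of the triangle group -/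

/-- Used for the stabiliser of a vertex: the rotations and reflections of a dihedral group are told
apart by parity. -/
theorem mem_closure_pair_of_involutions {W : Type*} [Group W] {a b : W} (ha : a * a = 1)
    (hb : b * b = 1) {g : W} (hg : g ∈ Subgroup.closure {a, b}) :
    ∃ k : ℤ, g = (a * b) ^ k ∨ g = (a * b) ^ k * a := by
  have ha' : a⁻¹ = a := inv_eq_of_mul_eq_one_right ha
  have hb' : b⁻¹ = b := inv_eq_of_mul_eq_one_right hb
  have hsemi : ∀ k : ℤ, a * (a * b) ^ k = (a * b) ^ (-k) * a := by
    intro k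
    have : SemiconjBy a (a * b) (a * b)⁻¹ := by
      simp [SemiconjBy, ha', hb', ← mul_assoc, ha]
      simp [mul_assoc, ha]
    rw [zpow_neg, ← inv_zpow]
    exact (this.zpow_right k).eq
  induction hg using Subgroup.closure_induction_left with
  | one => exact ⟨0, by simp⟩
  | mul_left c hc g _ ih =>
    obtain ⟨k, hk⟩ := ih
    have hcase : c = a ∨ c = (a * b) ^ (-1 : ℤ) * a := by
      rcases hc with rfl | rfl
      · exact Or.inl rfl
      · right; simp [ha', hb', mul_assoc, ha]
    rcases hcase with rfl | rfl <;> rcases hk with rfl | rfl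
    · exact ⟨-k, Or.inr (hsemi k)⟩
    · exact ⟨-k, Or.inl (by rw [← mul_assoc, hsemi, mul_assoc, ha, mul_one])⟩
    · exact ⟨-1 + -k, Or.inr (by rw [mul_assoc, hsemi, ← mul_assoc, zpow_add])⟩
    · exact ⟨-1 + -k, Or.inl (by
        rw [mul_assoc, ← mul_assoc a, hsemi, mul_assoc _ a a, ha, mul_one, zpow_add])⟩
  | inv_mul_cancel c hc g _ ih =>
    obtain ⟨k, hk⟩ := ih
    have hcase : c⁻¹ = a ∨ c⁻¹ = (a * b) ^ (-1 : ℤ) * a := by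
      rcases hc with rfl | rfl
      · exact Or.inl ha'
      · right; simp [ha', hb', mul_assoc, ha]
    rcases hcase with h | h <;> rw [h] <;> rcases hk with rfl | rfl
    · exact ⟨-k, Or.inr (hsemi k)⟩
    · exact ⟨-k, Or.inl (by rw [← mul_assoc, hsemi, mul_assoc, ha, mul_one])⟩
    · exact ⟨-1 + -k, Or.inr (by rw [mul_assoc, hsemi, ← mul_assoc, zpow_add])⟩
    · exact ⟨-1 + -k, Or.inl (by
        rw [mul_assoc, ← mul_assoc a, hsemi, mul_assoc _ a a, ha, mul_one, zpow_add])⟩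

omit hn in
theorem lengthParity_simple_ne_one (i : Fin 3) :
    (system n).lengthParity ((system n).simple i) ≠ 1 := by
  rw [CoxeterSystem.lengthParity_simple]
  decide

/-- A homomorphism preserving the orders of the canonical generators has a kernel acting freely. -/
theorem eq_one_of_smul_eq {G : Type*} [Group G] (θ : triangleGroup n →* G)
    (hu : orderOf (θ (genU n)) = 2) (hv : orderOf (θ (genV n)) = 2 * n)
    (hw : orderOf (θ (genW n)) = 2 * n) {γ : triangleGroup n} (hγ : θ γ = 1) {τ : ℍ}
    (hτ : (γ : PSL(2, ℝ)) • τ = τ) : γ = 1 := by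
  obtain ⟨g₀, hg₀⟩ := exists_smul_mem_closedChamber n τ
  set x := g₀ • τ with hx
  have hpair : ∀ l : Fin 3, ∃ t : triangleGroup n,
      toReflection n t = (system n).simple (l + 1) * (system n).simple (l + 2) ∧
      orderOf (θ t) = coxeterMatrix n (l + 1) (l + 2) := by
    intro l
    fin_cases l
    · exact ⟨genV n, toReflection_genV n, hv⟩
    · exact ⟨genW n, toReflection_genW n, hw⟩
    · exact ⟨genU n, toReflection_genU n, hu⟩
  -- If an element of Δ* carries x to τ, conjugating γ by it gives an even element a fixing x, hence
  -- one generated by the reflections in the at most two sides through x.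
  have main : ∀ g : ReflectionGroup n, g ∈ (toReflection n).range → g • x = τ → γ = 1 := by
    rintro _ ⟨ω, rfl⟩ hgx
    set a := toReflection n (ω⁻¹ * γ * ω) with ha
    have hax : a • x = x := by
      rw [ha, map_mul, map_mul, mul_smul, hgx, mul_smul, toReflection_smul n γ, hτ, map_inv,
        inv_smul_eq_iff, hgx]
    have hmem := ((system n).smul_eq_of_mem_closed_chamber (coxeterMatrix_ne_zero n)
      (wall_simple_smul n) (fun i c hc => by
        rw [simple_smul]; exact UpperHalfPlane.reflection_smul_eq_self _ hc)
      hg₀ (w := a) (by rw [hax]; exact hg₀)).2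
    obtain ⟨l, hl⟩ := wall_ne_zero n x
    have hsub : (system n).simple '' {i | wall n i x = 0} ⊆
        {(system n).simple (l + 1), (system n).simple (l + 2)} := by
      rintro _ ⟨i, hi, rfl⟩
      have hil : i ≠ l := by rintro rfl; exact hl hi
      have : i = l + 1 ∨ i = l + 2 := by omega
      rcases this with rfl | rfl <;> simp
    obtain ⟨k, hk⟩ := mem_closure_pair_of_involutions
      ((system n).simple_mul_simple_self _) ((system n).simple_mul_simple_self _)
      (Subgroup.closure_mono hsub hmem)
    obtain ⟨t, ht, hord⟩ := hpair l
    rw [← ht, ← map_zpow] at hk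
    -- A rotation is a power of t, one of the three generators; θ kills it and preserves the order
    -- of t, so it is trivial. A reflection is excluded by parity.
    rcases hk with hk | hk
    · rw [ha] at hk
      have h1 := toReflection_injective n hk
      have h2 : θ t ^ k = 1 := by
        rw [← map_zpow, ← h1, map_mul, map_mul, hγ, mul_one, ← map_mul, inv_mul_cancel, map_one]
      have h3 := orderOf_dvd_iff_zpow_eq_one.2 h2
      rw [hord] at h3
      obtain ⟨c, rfl⟩ := h3
      have h4 : t ^ ((coxeterMatrix n (l + 1) (l + 2) : ℤ) * c) = 1 := by
        apply toReflection_injective n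
        rw [map_zpow, ht, zpow_mul, zpow_natCast, CoxeterSystem.simple_mul_simple_pow, one_zpow,
          map_one]
      rw [h4] at h1
      have h5 : γ = ω * (ω⁻¹ * γ * ω) * ω⁻¹ := by group
      rw [h5, h1]
      group
    · have h1 := congrArg (system n).lengthParity hk
      rw [map_mul, ha, lengthParity_toReflection, lengthParity_toReflection, one_mul] at h1
      exact absurd h1.symm (lengthParity_simple_ne_one n _)
  have hgx : g₀⁻¹ • x = τ := inv_smul_smul g₀ τ
  -- On a side, the reflection in it fixes x and corrects the parity of g₀⁻¹ where needed. Off all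
  -- sides, x lies in the open chamber and has trivial stabiliser.
  by_cases hz : ∃ i, wall n i x = 0
  · obtain ⟨i, hi⟩ := hz
    rcases mem_range_or_mul_simple_mem_range n g₀⁻¹ i with h | h
    · exact main _ h hgx
    · refine main _ h ?_
      rw [mul_smul, simple_smul, mirror, UpperHalfPlane.reflection_smul_eq_self _ hi, hgx]
  · have hax : (g₀ * toReflection n γ * g₀⁻¹) • x = x := by
      rw [mul_smul, hgx, mul_smul, toReflection_smul, hτ]
    have hpos : ∀ i, 0 < wall n i x := fun i =>
      lt_of_le_of_ne (hg₀ i) fun h => hz ⟨i, h.symm⟩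
    have h1 := eq_one_of_smul_mem_chamber n hpos
      (g := g₀ * toReflection n γ * g₀⁻¹) (by rw [hax]; exact hpos)
    have h2 : toReflection n γ = 1 := by
      rw [mul_inv_eq_one] at h1
      exact mul_eq_left.1 h1
    exact toReflection_injective n (by rw [h2, map_one])

theorem dist_triangleGroup_smul (γ : triangleGroup n) (τ c : ℍ) :
    dist ((γ : PSL(2, ℝ)) • τ) ((γ : PSL(2, ℝ)) • c) = dist τ c := by
  rw [← toReflection_smul, ← toReflection_smul, dist_smul_smul]

/-- The triangle and its mirror image in one side suffice, the image absorbing the odd elements. -/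
theorem exists_compact_fundamental_set :
    ∃ D : Set ℍ, IsCompact D ∧ ∀ τ : ℍ, ∃ γ : triangleGroup n, (γ : PSL(2, ℝ)) • τ ∈ D := by
  set C := {τ : ℍ | ∀ i, 0 ≤ wall n i τ} with hC
  have hCc : IsCompact C := isCompact_closedChamber n
  have hcont : Continuous fun τ : ℍ => (system n).simple 0 • τ :=
    (Isometry.of_dist_eq (dist_smul_smul n _)).continuous
  refine ⟨C ∪ (fun τ => (system n).simple 0 • τ) '' C, hCc.union (hCc.image hcont), fun τ => ?_⟩
  obtain ⟨g, hg⟩ := exists_smul_mem_closedChamber n τ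
  rcases mem_range_or_mul_simple_mem_range n g⁻¹ 0 with ⟨γ, hγ⟩ | ⟨γ, hγ⟩
  · refine ⟨γ⁻¹, Or.inl ?_⟩
    rw [← toReflection_smul, map_inv, hγ, inv_inv]
    exact hg
  · refine ⟨γ⁻¹, Or.inr ⟨g • τ, hg, ?_⟩⟩
    rw [← toReflection_smul, map_inv, hγ, mul_inv_rev, inv_inv, CoxeterSystem.inv_simple, mul_smul]

theorem isSurfaceGroup {G : Type*} [Group G] (θ : triangleGroup n →* G)
    (hu : orderOf (θ (genU n)) = 2) (hv : orderOf (θ (genV n)) = 2 * n)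
    (hw : orderOf (θ (genW n)) = 2 * n) (K : Subgroup (triangleGroup n)) (hK : K ≤ θ.ker)
    [hfin : K.FiniteIndex] : IsSurfaceGroup (K.map (triangleGroup n).subtype) where
  properlyDiscontinuous := ⟨by
    intro A B hA hB
    obtain ⟨c, hc⟩ := exists_mem_chamber n
    obtain ⟨RA, hRA⟩ := hA.isBounded.subset_closedBall c
    obtain ⟨RB, hRB⟩ := hB.isBounded.subset_closedBall c
    have hfin := finite_dist_smul_le n hc (RA + RB)
    set j : K.map (triangleGroup n).subtype → ReflectionGroup n := fun γ =>
      toReflection n ⟨γ.1, Subgroup.map_subtype_le K γ.2⟩ with hj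
    have hjinj : Function.Injective j := fun γ γ' h =>
      Subtype.ext (Subtype.mk.inj (toReflection_injective n h))
    refine (hfin.preimage (f := j) hjinj.injOn).subset ?_
    rintro γ hγ
    obtain ⟨_, ⟨a, ha, rfl⟩, hb⟩ := hγ
    have h1 := Metric.mem_closedBall.1 (hRA ha)
    have h2 := Metric.mem_closedBall.1 (hRB hb)
    change dist (j γ • c) c ≤ RA + RB
    have h3 : dist (j γ • c) (j γ • a) ≤ RA := by
      rw [dist_smul_smul, dist_comm]; exact h1
    have h4 : j γ • a = γ • a := toReflection_smul n _ a
    rw [h4] at h3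
    exact (dist_triangle _ _ _).trans (add_le_add h3 h2)⟩
  free := by
    rintro ⟨_, γ, hγ, rfl⟩ τ hτ
    have := eq_one_of_smul_eq n θ hu hv hw (hK hγ) hτ
    subst this
    rfl
  cocompact := by
    obtain ⟨D, hD, hcov⟩ := exists_compact_fundamental_set n
    have : Finite (triangleGroup n ⧸ K) := Subgroup.finite_quotient_of_finiteIndex
    -- One translate of D for each of the finitely many cosets of K gives a compact set meeting
    -- every K-orbit.
    set E : Set ℍ := ⋃ q : triangleGroup n ⧸ K,
      (fun τ : ℍ => ((q.out⁻¹ : triangleGroup n) : PSL(2, ℝ)) • τ) '' D with hE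
    have hEc : IsCompact E := isCompact_iUnion fun q => hD.image
      (Isometry.of_dist_eq (dist_triangleGroup_smul n q.out⁻¹)).continuous
    have huniv : (Quotient.mk (MulAction.orbitRel (K.map (triangleGroup n).subtype) ℍ)) '' E =
        Set.univ := by
      rw [Set.eq_univ_iff_forall]
      intro q
      obtain ⟨τ, rfl⟩ := Quotient.exists_rep q
      obtain ⟨γ, hγ⟩ := hcov τ
      set q : triangleGroup n ⧸ K := QuotientGroup.mk γ with hq
      have hmem : q.out⁻¹ * γ ∈ K := QuotientGroup.eq.1 (by rw [QuotientGroup.out_eq'])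
      refine ⟨((q.out⁻¹ * γ : triangleGroup n) : PSL(2, ℝ)) • τ, ?_, ?_⟩
      · refine Set.mem_iUnion.2 ⟨q, _, hγ, ?_⟩
        rw [Subgroup.coe_mul, mul_smul]
      · exact Quotient.sound ⟨⟨_, Subgroup.mem_map_of_mem _ hmem⟩, rfl⟩
    exact ⟨huniv ▸ hEc.image continuous_quotient_mk'⟩

end HyperbolicTriangle

/-! ### Rotations -/

/-- The trace makes exp(−it) an eigenvalue of A, and the solution z of cz + d = exp(−it) is then
fixed, with derivative (cz + d)⁻² = exp(2it). The condition c < 0 puts z in the upper half-plane. -/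
theorem IsRotation.exists_of_trace {A : SL(2, ℝ)} {t : ℝ} (h0 : 0 < t) (hpi : t < Real.pi)
    (htr : A 0 0 + A 1 1 = 2 * Real.cos t) (hc : A 1 0 < 0) :
    ∃ P : ℍ, IsRotation (QuotientGroup.mk A) P (2 * t) := by
  have hdet : A 0 0 * A 1 1 - A 0 1 * A 1 0 = 1 := by
    rw [← Matrix.det_fin_two]; exact A.det_coe
  have hs := Real.sin_pos_of_pos_of_lt_pi h0 hpi
  set e : ℂ := Complex.exp (-(t * Complex.I)) with he
  have hecs : e = Real.cos t - Real.sin t * Complex.I := by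
    rw [he, ← neg_mul, Complex.exp_mul_I]; simp; ring
  have hcc : ((A 1 0 : ℝ) : ℂ) ≠ 0 := by exact_mod_cast hc.ne
  set z : ℂ := ((Real.cos t - A 1 1) / A 1 0 : ℝ) + ((-Real.sin t / A 1 0 : ℝ) : ℂ) * Complex.I
    with hz
  have hzim : 0 < z.im := by
    rw [hz]
    simp only [Complex.add_im, Complex.ofReal_im, Complex.im_ofReal_mul,
      Complex.I_im, mul_one, zero_add]
    exact div_pos_of_neg_of_neg (by linarith) hc
  have hcz : ((A 1 0 : ℝ) : ℂ) * z + ((A 1 1 : ℝ) : ℂ) = e := by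
    rw [hecs, hz]
    push_cast
    field_simp
    ring
  have hquad : e ^ 2 - ((A 0 0 : ℝ) + (A 1 1 : ℝ)) * e + 1 = 0 := by
    have h1 : ((A 0 0 : ℝ) + (A 1 1 : ℝ) : ℂ) = 2 * Real.cos t := by exact_mod_cast htr
    have h2 : (Real.cos t : ℂ) ^ 2 + (Real.sin t : ℂ) ^ 2 = 1 := by
      exact_mod_cast Real.cos_sq_add_sin_sq t
    rw [h1, hecs]
    linear_combination (Real.sin t : ℂ) ^ 2 * Complex.I_sq - h2
  refine ⟨⟨z, hzim⟩, A, rfl, ?_, ?_⟩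
  · ext
    rw [UpperHalfPlane.coe_specialLinearGroup_apply]
    simp only [Algebra.algebraMap_self, RingHom.id_apply]
    rw [hcz, div_eq_iff (Complex.exp_ne_zero _)]
    apply mul_left_cancel₀ hcc
    have hd : (A 0 0 : ℂ) * A 1 1 - A 0 1 * A 1 0 = 1 := by exact_mod_cast hdet
    have hz' : ((A 1 0 : ℝ) : ℂ) * z = e - A 1 1 := by linear_combination hcz
    linear_combination ((A 0 0 : ℂ) - e) * hz' - hd - hquad
  · change (_ * z + _) ^ 2 * _ = 1
    rw [hcz, he, ← Complex.exp_nat_mul, ← Complex.exp_add]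
    push_cast
    rw [← Complex.exp_zero]
    congr 1
    ring

open UpperHalfPlane in
-- The factor cτ + d is a cocycle, so its value at a fixed point is invariant under conjugation.
theorem IsRotation.conj {g : PSL(2, ℝ)} {P : ℍ} {t : ℝ} (hg : IsRotation g P t) (h : PSL(2, ℝ)) :
    ∃ Q, IsRotation (h * g * h⁻¹) Q t := by
  obtain ⟨A, rfl, hP, hrot⟩ := hg
  obtain ⟨B, rfl⟩ := QuotientGroup.mk_surjective h
  refine ⟨B • P, B * A * B⁻¹, rfl, ?_, ?_⟩
  · rw [mul_smul, inv_smul_smul, mul_smul, hP]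
  · rw [← hrot]
    congr 2
    have hden : ∀ (C D : SL(2, ℝ)) (τ : ℍ), denom (C * D : SL(2, ℝ)) τ =
        denom C (D • τ : ℍ) * denom D τ := by
      intro C D τ
      have := denom_cocycle_σ (C : GL (Fin 2) ℝ) D τ
      simpa [σ] using! this
    have h1 : denom (B * A * B⁻¹ : SL(2, ℝ)) (B • P : ℍ) = denom A P := by
      rw [hden, hden, inv_smul_smul, hP]
      have h2 := hden B B⁻¹ (B • P)
      rw [inv_smul_smul, mul_inv_cancel] at h2
      have h3 : denom (1 : SL(2, ℝ)) (B • P : ℍ) = 1 := by simp [denom]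
      rw [h3] at h2
      linear_combination (-denom A P) * h2
    exact h1

open UpperHalfPlane in
theorem IsRotation.sq {g : PSL(2, ℝ)} {P : ℍ} {t : ℝ} (hg : IsRotation g P t) :
    IsRotation (g ^ 2) P (2 * t) := by
  obtain ⟨A, rfl, hP, hrot⟩ := hg
  refine ⟨A ^ 2, rfl, by rw [pow_two, mul_smul, hP, hP], ?_⟩
  have h1 : denom (A ^ 2 : SL(2, ℝ)) P = denom A P ^ 2 := by
    have := denom_cocycle_σ (A : GL (Fin 2) ℝ) A P
    rw [pow_two, pow_two]
    have h2 : (A : GL (Fin 2) ℝ) • P = P := hP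
    rw [h2] at this
    simpa [σ] using! this
  change (denom (A ^ 2 : SL(2, ℝ)) P) ^ 2 * _ = 1
  have hrot' : denom A P ^ 2 * Complex.exp (t * Complex.I) = 1 := hrot
  rw [h1, show ((2 * t : ℝ) : ℂ) * Complex.I = (2 : ℕ) * (t * Complex.I) by push_cast; ring,
    Complex.exp_nat_mul, ← mul_pow, hrot', one_pow]

/-! ### The canonical generators as rotations -/

namespace HyperbolicTriangle

variable (n : ℕ) [hn : Fact (3 ≤ n)]

theorem exists_isRotation_genU : ∃ P, IsRotation (genU n) P (2 * Real.pi / (2 : ℕ)) := by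
  obtain ⟨P, hP⟩ := IsRotation.exists_of_trace (A := matU) (t := Real.pi / 2)
    (by positivity) (by linarith [Real.pi_pos]) (by simp [matU]) (by simp [matU])
  refine ⟨P, ?_⟩
  rwa [show 2 * Real.pi / (2 : ℕ) = 2 * (Real.pi / 2) by push_cast; ring]

theorem exists_isRotation_genV : ∃ P, IsRotation (genV n) P (2 * Real.pi / (2 * n : ℕ)) := by
  obtain ⟨P, hP⟩ := IsRotation.exists_of_trace (A := matV n) (t := Real.pi / (2 * n))
    (angle_pos n) (by linarith [angle_lt n, Real.pi_pos])
    (by simp [matV, κ]; ring) (by simp [matV, κ_pos n])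
  refine ⟨P, ?_⟩
  rwa [show 2 * Real.pi / (2 * n : ℕ) = 2 * (Real.pi / (2 * n)) by push_cast; ring]

theorem exists_isRotation_genW : ∃ P, IsRotation (genW n) P (2 * Real.pi / (2 * n : ℕ)) := by
  obtain ⟨P, hP⟩ := IsRotation.exists_of_trace (A := matW n) (t := Real.pi / (2 * n))
    (angle_pos n) (by linarith [angle_lt n, Real.pi_pos])
    (by simp [matW, κ]; ring)
    (by simp [matW]; linarith [κ_pos n, δ_pos n])
  refine ⟨P, ?_⟩
  rwa [show 2 * Real.pi / (2 * n : ℕ) = 2 * (Real.pi / (2 * n)) by push_cast; ring]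

theorem isCanonicalTriple :
    IsCanonicalTriple 2 (2 * n) (2 * n) (genU n : PSL(2, ℝ)) (genV n) (genW n) where
  two_le_l := le_rfl
  two_le_m := by have := hn.out; omega
  two_le_n := by have := hn.out; omega
  hyperbolic := by
    have h3 : (3 : ℝ) ≤ n := by exact_mod_cast hn.out
    push_cast
    have h6 : (1 : ℝ) / (2 * n) ≤ 1 / 6 := one_div_le_one_div_of_le (by norm_num) (by linarith)
    linarith
  rot_u := exists_isRotation_genU n
  rot_v := exists_isRotation_genV n
  rot_w := exists_isRotation_genW n
  mul_eq_one := by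
    rw [← Subgroup.coe_mul, ← Subgroup.coe_mul, genU_mul_genV_mul_genW, Subgroup.coe_one]

end HyperbolicTriangle

/-- The triple generates the subgroup of index two attached to v: squaring doubles the angle of w to
2π/n, and w² · w⁻¹vw · v is a conjugate of (vw)² = 1. -/
theorem isCanonicalTriple_of_rotations {n : ℕ} (hn : 3 ≤ n) {v w : PSL(2, ℝ)}
    (hv : ∃ P, IsRotation v P (2 * Real.pi / (2 * n : ℕ)))
    (hw : ∃ P, IsRotation w P (2 * Real.pi / (2 * n : ℕ))) (hvw : v * w * (v * w) = 1) :
    IsCanonicalTriple n (2 * n) (2 * n) (w ^ 2) (w⁻¹ * v * w) v where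
  two_le_l := by omega
  two_le_m := by omega
  two_le_n := by omega
  hyperbolic := by
    have h3 : (3 : ℝ) ≤ n := by exact_mod_cast hn
    push_cast
    have h3' : (1 : ℝ) / n ≤ 1 / 3 := one_div_le_one_div_of_le (by norm_num) h3
    have h6 : (1 : ℝ) / (2 * n) ≤ 1 / 6 := one_div_le_one_div_of_le (by norm_num) (by linarith)
    linarith
  rot_u := by
    obtain ⟨P, hP⟩ := hw
    refine ⟨P, ?_⟩
    convert hP.sq using 1
    have : (n : ℝ) ≠ 0 := by exact_mod_cast (by omega : n ≠ 0)
    push_cast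
    field_simp
  rot_v := by
    obtain ⟨P, hP⟩ := hv
    simpa using hP.conj w⁻¹
  rot_w := hv
  mul_eq_one := by
    have h1 : w ^ 2 * (w⁻¹ * v * w) * v = w * (v * w * (v * w)) * w⁻¹ := by group
    rw [h1, hvw, mul_one, mul_inv_cancel]

/-! ### Regular dessins -/

theorem MulAction.toPermHom_self_injective (G : Type*) [Group G] :
    Function.Injective (MulAction.toPermHom G G) := MulAction.toPerm_injective

theorem MulAction.closure_toPermHom_pair {G : Type*} [Group G] {a b : G}
    (hab : Subgroup.closure {a, b} = ⊤) :
    Subgroup.closure {toPermHom G G a, toPermHom G G b} = (toPermHom G G).range := by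
  rw [MonoidHom.range_eq_map, ← hab, MonoidHom.map_closure, Set.image_pair]

namespace Hypermap

variable {G : Type*} [Group G] [Finite G]

/-- The regular dessin given by a pair of generators of a finite group, acting on the group by left
multiplication. -/
def regular (a b : G) (hab : Subgroup.closure {a, b} = ⊤) : Hypermap G where
  x := MulAction.toPermHom G G a
  y := MulAction.toPermHom G G b
  finite := inferInstance
  nonempty := inferInstance
  transitive := by
    rw [MulAction.closure_toPermHom_pair hab]
    exact ⟨fun g h => ⟨⟨_, h * g⁻¹, rfl⟩, inv_mul_cancel_right h g⟩⟩

variable {a b : G} (hab : Subgroup.closure {a, b} = ⊤)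

theorem regular_x : (regular a b hab).x = MulAction.toPermHom G G a := rfl

theorem regular_y : (regular a b hab).y = MulAction.toPermHom G G b := rfl

theorem regular_z : (regular a b hab).z = MulAction.toPermHom G G (a * b)⁻¹ := by
  rw [z, regular_x, regular_y, ← map_mul, ← map_inv]

/-- The centraliser of the left regular representation consists of the right multiplications. -/
theorem mem_Aut_regular_iff (σ : Equiv.Perm G) :
    σ ∈ (regular a b hab).Aut ↔ ∀ g, σ g = g * σ 1 := by
  rw [Aut, regular_x, regular_y, MulAction.closure_toPermHom_pair hab,
    Subgroup.mem_centralizer_iff]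
  constructor
  · intro h g
    have := Equiv.congr_fun (h _ ⟨g, rfl⟩) 1
    simpa [eq_comm] using this
  · rintro h _ ⟨g, rfl⟩
    ext k
    simp only [Equiv.Perm.mul_apply, MulAction.toPermHom_apply, MulAction.toPerm_apply, smul_eq_mul]
    rw [h k, h (g * k), mul_assoc]

/-- The automorphism group of a regular dessin. -/
def autRegularEquiv : (regular a b hab).Aut ≃* G where
  -- Evaluation at 1 reverses products; the inverse restores their order.
  toFun σ := (σ.1 1)⁻¹
  invFun g := ⟨Equiv.mulRight g⁻¹, by rw [mem_Aut_regular_iff]; simp⟩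
  left_inv σ := by
    ext g
    simp [(mem_Aut_regular_iff hab σ.1).1 σ.2 g]
  right_inv g := by simp
  map_mul' σ τ := by
    rw [Subgroup.coe_mul, Equiv.Perm.mul_apply, (mem_Aut_regular_iff hab σ.1).1 σ.2 (τ.1 1),
      mul_inv_rev]

theorem isRegular_regular : (regular a b hab).IsRegular := by
  refine ⟨fun g h => ⟨⟨Equiv.mulRight (g⁻¹ * h), ?_⟩, mul_inv_cancel_left g h⟩⟩
  rw [mem_Aut_regular_iff]
  simp [mul_assoc]

theorem hasType_regular {l m n : ℕ} (ha : orderOf a = l) (hb : orderOf b = m)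
    (hc : orderOf (a * b) = n) : (regular a b hab).HasType l m n := by
  refine ⟨?_, ?_, ?_⟩
  · rw [regular_x, orderOf_injective _ (MulAction.toPermHom_self_injective G), ha]
  · rw [regular_y, orderOf_injective _ (MulAction.toPermHom_self_injective G), hb]
  · rw [regular_z, orderOf_injective _ (MulAction.toPermHom_self_injective G), orderOf_inv, hc]

/-- A dessin isomorphism e need not fix 1. The identity `key`, proved by induction over the
generators, says that e followed by right multiplication by (e 1)⁻¹ is a homomorphism. -/
theorem iso_regular_iff {a' b' : G} (hab' : Subgroup.closure {a', b'} = ⊤) :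
    (regular a b hab).Iso (regular a' b' hab') ↔ ∃ σ : G ≃* G, σ a = a' ∧ σ b = b' := by
  constructor
  · rintro ⟨e, hx, hy⟩
    have hx' : ∀ g, e (a * g) = a' * e g := hx
    have hy' : ∀ g, e (b * g) = b' * e g := hy
    have key : ∀ g h, e (g * h) = e g * (e 1)⁻¹ * e h := by
      intro g
      have hg : g ∈ Subgroup.closure {a, b} := by rw [hab]; exact Subgroup.mem_top g
      induction hg using Subgroup.closure_induction with
      | mem g hg =>
        intro h
        rcases hg with rfl | rfl
        · have := hx' 1
          rw [mul_one] at this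
          rw [hx', this, mul_inv_cancel_right]
        · have := hy' 1
          rw [mul_one] at this
          rw [hy', this, mul_inv_cancel_right]
      | one => simp
      | mul g g' _ _ ih ih' =>
        intro h
        rw [mul_assoc, ih, ih', ih g']
        group
      | inv g _ ih =>
        intro h
        have h1 := ih (g⁻¹ * h)
        have h2 := ih g⁻¹
        rw [mul_inv_cancel] at h2
        rw [mul_inv_cancel_left] at h1
        rw [eq_inv_mul_of_mul_eq h1.symm, eq_inv_mul_of_mul_eq h2.symm]
        group
    refine ⟨{ toEquiv := e.trans (Equiv.mulRight (e 1)⁻¹), map_mul' := fun g h => ?_ }, ?_, ?_⟩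
    · simp [key g h, mul_assoc]
    · have := hx' 1
      rw [mul_one] at this
      simp [this]
    · have := hy' 1
      rw [mul_one] at this
      simp [this]
  · rintro ⟨σ, rfl, rfl⟩
    exact ⟨σ.toEquiv, fun g => map_mul σ a g, fun g => map_mul σ b g⟩

omit [Finite G] in
-- The cycles of left multiplication by g are the right cosets of ⟨g⟩.
theorem cycleCount_mul_orderOf (g : G) :
    cycleCount (MulAction.toPermHom G G g) * orderOf g = Nat.card G := by
  have h : Nat.card (MulAction.orbitRel.Quotient
      (Subgroup.zpowers (MulAction.toPermHom G G g)) G) = (Subgroup.zpowers g).index := by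
    rw [Subgroup.index, ← Nat.card_congr
      (QuotientGroup.quotientRightRelEquivQuotientLeftRel (Subgroup.zpowers g))]
    refine Nat.card_congr (Quotient.congr (Equiv.refl G) fun h k => ?_)
    change _ ↔ QuotientGroup.rightRel _ h k
    rw [MulAction.orbitRel_apply, QuotientGroup.rightRel_apply]
    constructor
    · rintro ⟨⟨_, i, rfl⟩, rfl⟩
      refine ⟨-i, ?_⟩
      change g ^ (-i) = k * (((MulAction.toPermHom G G g) ^ i) k)⁻¹
      rw [← map_zpow]
      simp
    · rintro ⟨i, hi⟩
      refine ⟨⟨_, -i, rfl⟩, ?_⟩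
      change ((MulAction.toPermHom G G g) ^ (-i)) k = h
      rw [← map_zpow, zpow_neg]
      simp only at hi
      simp [hi]
  rw [cycleCount, h, ← Nat.card_zpowers, mul_comm, Subgroup.card_mul_index]

end Hypermap

/-! ### The subgroups of index two -/

section

variable {D : Type*} [Group D] {v w : D}

/-- Two identities carry this: w² · w⁻¹vw · v = w(vw)²w⁻¹ = 1 puts w² in the normal closure of v,
and wvw⁻¹ = w²(w⁻¹vw)w⁻² makes the left side stable under conjugation by w. -/
theorem closure_eq_normalClosure (hcl : Subgroup.closure {v, w} = ⊤)
    (hvw : v * w * (v * w) = 1) :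
    Subgroup.closure {w ^ 2, w⁻¹ * v * w, v} = Subgroup.normalClosure {v} := by
  set N := Subgroup.closure {w ^ 2, w⁻¹ * v * w, v} with hN
  have h1 : w ^ 2 ∈ N := Subgroup.subset_closure (by simp)
  have h2 : w⁻¹ * v * w ∈ N := Subgroup.subset_closure (by simp)
  have h3 : v ∈ N := Subgroup.subset_closure (by simp)
  apply le_antisymm
  · have hv : v ∈ Subgroup.normalClosure {v} := Subgroup.subset_normalClosure rfl
    have hn : (Subgroup.normalClosure {v}).Normal := inferInstance
    have hc : w⁻¹ * v * w ∈ Subgroup.normalClosure {v} := by simpa using hn.conj_mem v hv w⁻¹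
    rw [hN, Subgroup.closure_le]
    rintro _ (rfl | rfl | rfl)
    · have : w ^ 2 = (w⁻¹ * v * w * v)⁻¹ * (w⁻¹ * (v * w * (v * w)) * w) := by
        rw [pow_two]; group
      rw [this, hvw]
      have := inv_mem (mul_mem hc hv)
      simpa using this
    · exact hc
    · exact hv
  · have hnorm : N.Normal := by
      rw [← Subgroup.normalizer_eq_top_iff, eq_top_iff, ← hcl, Subgroup.closure_le]
      rintro g (rfl | rfl)
      · exact Subgroup.le_normalizer h3
      · have hconj : ∀ k ∈ N, g * k * g⁻¹ ∈ N := by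
          intro k hk
          induction hk using Subgroup.closure_induction with
          | mem k hk =>
            rcases hk with rfl | rfl | rfl
            · rwa [show g * g ^ 2 * g⁻¹ = g ^ 2 by group]
            · rwa [show g * (g⁻¹ * v * g) * g⁻¹ = v by group]
            · rw [show g * k * g⁻¹ = g ^ 2 * (g⁻¹ * k * g) * (g ^ 2)⁻¹ by group]
              exact mul_mem (mul_mem h1 h2) (inv_mem h1)
          | one => simp [one_mem]
          | mul k k' _ _ ih ih' =>
            rw [show g * (k * k') * g⁻¹ = (g * k * g⁻¹) * (g * k' * g⁻¹) by group]
            exact mul_mem ih ih'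
          | inv k _ ih =>
            rw [show g * k⁻¹ * g⁻¹ = (g * k * g⁻¹)⁻¹ by group]
            exact inv_mem ih
        refine Subgroup.mem_normalizer_iff.2 fun k => ⟨hconj k, fun hk => ?_⟩
        have h4 := hconj _ hk
        have h5 := mul_mem (mul_mem (inv_mem h1) h4) h1
        convert h5 using 1
        group
    exact Subgroup.normalClosure_le_normal (by simpa using h3)

/-- As w² lies in the normal closure of v, that subgroup has index at most two. The character keeps
w outside it, so nothing more is in the kernel. -/
theorem normalClosure_eq_ker_of_sign (hcl : Subgroup.closure {v, w} = ⊤)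
    (hvw : v * w * (v * w) = 1) (ε : D →* ℤˣ) (hv : ε v = 1) (hw : ε w = -1) :
    Subgroup.normalClosure {v} = ε.ker := by
  apply le_antisymm
  · exact Subgroup.normalClosure_le_normal (by simpa [MonoidHom.mem_ker] using hv)
  have hN : (Subgroup.normalClosure {v}).Normal := inferInstance
  have hvm : v ∈ Subgroup.normalClosure {v} := Subgroup.subset_normalClosure rfl
  have hw2 : w ^ 2 ∈ Subgroup.normalClosure {v} := by
    rw [← closure_eq_normalClosure hcl hvw]
    exact Subgroup.subset_closure (by simp)
  have hall : ∀ g : D, g ∈ Subgroup.normalClosure {v} ∨ w * g ∈ Subgroup.normalClosure {v} := by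
    intro g
    have hg : g ∈ Subgroup.closure {v, w} := by rw [hcl]; exact Subgroup.mem_top g
    have hwinv : ∀ g, w * g ∈ Subgroup.normalClosure {v} →
        w⁻¹ * g ∈ Subgroup.normalClosure {v} := by
      intro g h
      rw [show w⁻¹ * g = (w ^ 2)⁻¹ * (w * g) by group]
      exact mul_mem (inv_mem hw2) h
    have hvc : ∀ k ∈ Subgroup.normalClosure {v}, ∀ g, w * g ∈ Subgroup.normalClosure {v} →
        w * (k * g) ∈ Subgroup.normalClosure {v} := by
      intro k hk g h
      rw [show w * (k * g) = (w * k * w⁻¹) * (w * g) by group]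
      exact mul_mem (hN.conj_mem k hk w) h
    induction hg using Subgroup.closure_induction_left with
    | one => exact Or.inl (one_mem _)
    | mul_left c hc g _ ih =>
      rcases hc with rfl | rfl <;> rcases ih with h | h
      · exact Or.inl (mul_mem hvm h)
      · exact Or.inr (hvc _ hvm g h)
      · right
        rw [← mul_assoc, ← pow_two]
        exact mul_mem hw2 h
      · exact Or.inl h
    | inv_mul_cancel c hc g _ ih =>
      rcases hc with rfl | rfl <;> rcases ih with h | h
      · exact Or.inl (mul_mem (inv_mem hvm) h)
      · exact Or.inr (hvc _ (inv_mem hvm) g h)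
      · right
        rwa [mul_inv_cancel_left]
      · exact Or.inl (hwinv g h)
  intro g hg
  rcases hall g with h | h
  · exact h
  · exfalso
    have h1 : ε (w * g) = 1 := by
      have : Subgroup.normalClosure {v} ≤ ε.ker :=
        Subgroup.normalClosure_le_normal (by simpa [MonoidHom.mem_ker] using hv)
      exact this h
    rw [map_mul, hw, MonoidHom.mem_ker.1 hg] at h1
    exact absurd h1 (by decide)

end

theorem MonoidHom.index_ker_of_sign {D : Type*} [Group D] (ε : D →* ℤˣ) {w : D} (hw : ε w = -1) :
    ε.ker.index = 2 := by
  rw [Subgroup.index_ker]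
  have : ε.range = ⊤ := by
    rw [eq_top_iff]
    rintro g -
    rcases Int.units_eq_one_or g with rfl | rfl
    · exact one_mem _
    · exact ⟨w, hw⟩
  rw [this, Subgroup.card_top]
  simp

/-- The action is θ restricted to the normal closure of v, followed by left multiplication on G; the
stabiliser of 1 is the kernel of this restriction. -/
theorem Hypermap.regular_isUniformizedBy {G : Type*} [Group G] [Finite G] {n : ℕ} (hn : 3 ≤ n)
    {Δ : Subgroup PSL(2, ℝ)} {v w : Δ}
    (hv : ∃ P, IsRotation v P (2 * Real.pi / (2 * n : ℕ)))
    (hw : ∃ P, IsRotation w P (2 * Real.pi / (2 * n : ℕ)))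
    (hcl : Subgroup.closure {v, w} = ⊤) (hvw : v * w * (v * w) = 1) (θ : Δ →* G) {a b : G}
    (hab : Subgroup.closure {a, b} = ⊤) (ha : θ (w ^ 2) = a) (hb : θ (w⁻¹ * v * w) = b)
    (htype : (regular a b hab).HasType n (2 * n) (2 * n)) :
    (regular a b hab).IsUniformizedBy ((Subgroup.normalClosure {v}).map Δ.subtype)
      ((Subgroup.normalClosure {v} ⊓ θ.ker).map Δ.subtype) := by
  set N := Subgroup.normalClosure {v} with hN
  have hNc : Subgroup.closure {w ^ 2, w⁻¹ * v * w, v} = N := closure_eq_normalClosure hcl hvw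
  have h1 : w ^ 2 ∈ N := hNc ▸ Subgroup.subset_closure (by simp)
  have h2 : w⁻¹ * v * w ∈ N := hNc ▸ Subgroup.subset_closure (by simp)
  have h3 : v ∈ N := hNc ▸ Subgroup.subset_closure (by simp)
  have hc : θ v = (a * b)⁻¹ := by
    rw [← ha, ← hb, ← map_mul, ← map_inv]
    congr 1
    rw [eq_comm, inv_eq_iff_mul_eq_one]
    calc w ^ 2 * (w⁻¹ * v * w) * v = w * (v * w * (v * w)) * w⁻¹ := by group
      _ = 1 := by rw [hvw]; group
  refine ⟨⟨_, Subgroup.mem_map_of_mem _ h1⟩, ⟨_, Subgroup.mem_map_of_mem _ h2⟩,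
    ⟨_, Subgroup.mem_map_of_mem _ h3⟩, ?_, ?_,
    (MulAction.toPermHom G G).comp (θ.comp (Subgroup.inclusion (Subgroup.map_subtype_le N))),
    ?_, ?_, ?_, 1, ?_⟩
  · rw [htype.1, htype.2.1, htype.2.2]
    exact isCanonicalTriple_of_rotations hn hv hw (by exact_mod_cast congrArg Subtype.val hvw)
  · apply Subgroup.map_injective (Subgroup.subtype_injective (N.map Δ.subtype))
    rw [MonoidHom.map_closure, ← MonoidHom.range_eq_map, Subgroup.range_subtype]
    refine Eq.trans ?_ (congrArg (Subgroup.map Δ.subtype) hNc)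
    rw [MonoidHom.map_closure]
    congr 1
    simp only [Set.image_insert_eq, Set.image_singleton]
    rfl
  · exact congrArg (MulAction.toPermHom G G) ha
  · exact congrArg (MulAction.toPermHom G G) hb
  · rw [regular_z, ← hc]
    rfl
  · intro g
    constructor
    · rintro ⟨γ, ⟨hγN, hγk⟩, rfl⟩
      refine ⟨Subgroup.mem_map_of_mem _ hγN, ?_⟩
      change θ γ * 1 = 1
      rw [MonoidHom.mem_ker.1 hγk, one_mul]
    · rintro ⟨⟨γ, hγN, rfl⟩, h⟩
      have h' : θ γ * 1 = 1 := h
      exact ⟨γ, ⟨hγN, by rwa [mul_one] at h'⟩, rfl⟩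

/-- The hypothesis `hg` is |G|(1/n + 1/2n + 1/2n − 1) = 2 − 2g cleared of denominators. -/
theorem Hypermap.regular_hasGenus {G : Type*} [Group G] [Finite G] {a b : G}
    (hab : Subgroup.closure {a, b} = ⊤) {n g : ℕ} (hn : 0 < n)
    (htype : (regular a b hab).HasType n (2 * n) (2 * n))
    (hg : n * Nat.card G + 2 * n = 2 * Nat.card G + 2 * n * g) : (regular a b hab).HasGenus g := by
  obtain ⟨hx, hy, hz⟩ := htype
  have key : ∀ c : G, cycleCount (MulAction.toPermHom G G c) *
      orderOf (MulAction.toPermHom G G c) = Nat.card G := by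
    intro c
    rw [orderOf_injective _ (MulAction.toPermHom_self_injective G), cycleCount_mul_orderOf]
  rw [regular_z] at hz
  have h1 := hx ▸ key a
  have h2 := hy ▸ key b
  have h3 := hz ▸ key (a * b)⁻¹
  rw [HasGenus, regular_x, regular_y, regular_z]
  zify at h1 h2 h3 hg hn
  have h4 : (2 * n : ℤ) ≠ 0 := by omega
  apply mul_left_cancel₀ h4
  linear_combination 2 * h1 + h2 + h3 - 2 * hg

/-! ### Two-generator form and sign characters of the triangle group -/

namespace HyperbolicTriangle

variable (n : ℕ) [hn : Fact (3 ≤ n)]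

theorem genV_mul_genW : genV n * genW n * (genV n * genW n) = 1 := by
  apply toReflection_injective n
  have h : ((system n).simple 1 * (system n).simple 0) ^ 2 = 1 :=
    (system n).simple_mul_simple_pow 1 0
  rw [pow_two] at h
  rw [map_mul, map_mul, toReflection_genV, toReflection_genW, map_one, ← h]
  simp only [mul_assoc, CoxeterSystem.simple_mul_simple_cancel_left]

theorem closure_genV_genW : Subgroup.closure {genV n, genW n} = ⊤ := by
  rw [eq_top_iff, ← closure_gen, Subgroup.closure_le]
  have hv : genV n ∈ Subgroup.closure {genV n, genW n} := Subgroup.subset_closure (by simp)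
  have hw : genW n ∈ Subgroup.closure {genV n, genW n} := Subgroup.subset_closure (by simp)
  rintro _ (rfl | rfl | rfl)
  · have : genU n = (genV n * genW n)⁻¹ :=
      eq_inv_of_mul_eq_one_left (by rw [← mul_assoc, genU_mul_genV_mul_genW])
    rw [this]
    exact inv_mem (mul_mem hv hw)
  · exact hv
  · exact hw

theorem exists_sign {a b c : ℤˣ} (h : a * b * c = 1) :
    ∃ ε : triangleGroup n →* ℤˣ, ε (genU n) = a ∧ ε (genV n) = b ∧ ε (genW n) = c :=
  exists_hom n h (by simp) (by rw [pow_mul]; simp) (by rw [pow_mul]; simp)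

end HyperbolicTriangle

/-! ### From a generating triple to a pair of dessins -/

section

variable {G : Type*} [Group G] {n : ℕ} {x y z : G}

theorem IsGeneratingTriple.yz (h : IsGeneratingTriple n x y z) : y * z * (y * z) = 1 := by
  have hx : x ^ 2 = 1 := h.2.1 ▸ pow_orderOf_eq_one x
  have : y * z = x⁻¹ := eq_inv_of_mul_eq_one_right (by rw [← mul_assoc]; exact h.1)
  rw [this, ← mul_inv_rev, ← pow_two, hx, inv_one]

theorem IsGeneratingTriple.zy (h : IsGeneratingTriple n x y z) : z * y * (z * y) = 1 := by
  rw [show z * y * (z * y) = z * (y * z * (y * z)) * z⁻¹ by group, h.yz, mul_one, mul_inv_cancel]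

theorem IsGeneratingTriple.closure_yz (h : IsGeneratingTriple n x y z) :
    Subgroup.closure {y, z} = ⊤ := by
  rw [eq_top_iff, ← h.2.2.2.2, Subgroup.closure_le]
  have hv : y ∈ Subgroup.closure {y, z} := Subgroup.subset_closure (by simp)
  have hw : z ∈ Subgroup.closure {y, z} := Subgroup.subset_closure (by simp)
  rintro _ (rfl | rfl | rfl)
  · have : _ = (y * z)⁻¹ := eq_inv_of_mul_eq_one_left (by rw [← mul_assoc]; exact h.1)
    rw [this]
    exact inv_mem (mul_mem hv hw)
  · exact hv
  · exact hw

/-- Together with y these elements generate the normal closure of y, which is everything; and y is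
the inverse of their product. -/
theorem closure_sq_conj_eq_top (hcl : Subgroup.closure {y, z} = ⊤) (hyz : y * z * (y * z) = 1)
    (hN : ∀ N : Subgroup G, N.Normal → y ∈ N → N = ⊤) :
    Subgroup.closure {z ^ 2, z⁻¹ * y * z} = ⊤ := by
  have h1 : Subgroup.closure {z ^ 2, z⁻¹ * y * z, y} = ⊤ := by
    rw [closure_eq_normalClosure hcl hyz]
    exact hN _ inferInstance (Subgroup.subset_normalClosure rfl)
  rw [eq_top_iff, ← h1, Subgroup.closure_le]
  have hv : z ^ 2 ∈ Subgroup.closure {z ^ 2, z⁻¹ * y * z} := Subgroup.subset_closure (by simp)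
  have hw : z⁻¹ * y * z ∈ Subgroup.closure {z ^ 2, z⁻¹ * y * z} :=
    Subgroup.subset_closure (by simp)
  rintro g (rfl | rfl | rfl)
  · exact hv
  · exact hw
  · have h2 : z ^ 2 * (z⁻¹ * g * z) * g = 1 := by
      rw [show z ^ 2 * (z⁻¹ * g * z) * g = z * (g * z * (g * z)) * z⁻¹ by group, hyz, mul_one,
        mul_inv_cancel]
    have h3 := inv_mem (mul_mem hv hw)
    rwa [← eq_inv_of_mul_eq_one_right h2] at h3

theorem hasType_regular_sq_conj [Finite G] (hyz : y * z * (y * z) = 1)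
    (hy : orderOf y = 2 * n) (hz : orderOf z = 2 * n)
    (hab : Subgroup.closure {z ^ 2, z⁻¹ * y * z} = ⊤) :
    (Hypermap.regular _ _ hab).HasType n (2 * n) (2 * n) := by
  apply Hypermap.hasType_regular
  · rw [orderOf_pow, hz, Nat.gcd_mul_right_left, Nat.mul_div_cancel_left _ two_pos]
  · rw [← hy]
    have := orderOf_injective (MulAut.conj z⁻¹).toMonoidHom (MulAut.conj z⁻¹).injective y
    simpa using this
  · have h2 : z ^ 2 * (z⁻¹ * y * z) * y = 1 := by
      rw [show z ^ 2 * (z⁻¹ * y * z) * y = z * (y * z * (y * z)) * z⁻¹ by group, hyz, mul_one,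
        mul_inv_cancel]
    rw [← hy, eq_inv_of_mul_eq_one_left h2, orderOf_inv]

/-- The two dessins on a common surface attached to a generating triple of a finite group. -/
theorem exists_isDessinPair [Finite G] (hn : 3 ≤ n) (h : IsGeneratingTriple n x y z)
    (χ : G →* ℤˣ) (hχx : χ x = 1) (hχy : χ y = -1) (hχz : χ z = -1)
    (hNy : ∀ N : Subgroup G, N.Normal → y ∈ N → N = ⊤)
    (hNz : ∀ N : Subgroup G, N.Normal → z ∈ N → N = ⊤)
    (hcent : ∀ g, Commute g (y ^ 2) → Commute g y) (hbot : Subgroup.center G = ⊥) :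
    ∃ H₁ H₂ : Hypermap G, IsDessinPair n x y z H₁ H₂ ∧ (H₁.Iso H₂ ↔ HasSwap y z) ∧
      ∀ g : ℕ, n * Nat.card G + 2 * n = 2 * Nat.card G + 2 * n * g →
        H₁.HasGenus g ∧ H₂.HasGenus g := by
  have hfact : Fact (3 ≤ n) := ⟨hn⟩
  have hcl := h.closure_yz
  have hab₁ := closure_sq_conj_eq_top hcl h.yz hNy
  have hab₂ := closure_sq_conj_eq_top (Set.pair_comm y z ▸ hcl) h.zy hNz
  obtain ⟨hxyz, hx, hy, hz, -⟩ := id h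
  have ht₁ := hasType_regular_sq_conj h.yz hy hz hab₁
  have ht₂ := hasType_regular_sq_conj h.zy hz hy hab₂
  refine ⟨_, _, ⟨?_, Hypermap.isRegular_regular hab₁, Hypermap.isRegular_regular hab₂, ht₁, ht₂,
    ⟨Hypermap.autRegularEquiv hab₁⟩, ⟨Hypermap.autRegularEquiv hab₂⟩⟩, ?_, fun g hg =>
    ⟨Hypermap.regular_hasGenus _ (by omega) ht₁ hg, Hypermap.regular_hasGenus _ (by omega) ht₂ hg⟩⟩
  · open HyperbolicTriangle in
    obtain ⟨θ, hθu, hθv, hθw⟩ := exists_hom n hxyz (hx ▸ pow_orderOf_eq_one x)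
      (hy ▸ pow_orderOf_eq_one y) (hz ▸ pow_orderOf_eq_one z)
    -- The kernels of ε₁ and ε₂ will be the normal closures of v and of w.
    obtain ⟨ε₁, hu₁, hv₁, hw₁⟩ := exists_sign n (a := -1) (b := 1) (c := -1) (by decide)
    obtain ⟨ε₂, hu₂, hv₂, hw₂⟩ := exists_sign n (a := -1) (b := -1) (c := 1) (by decide)
    have hvw := genV_mul_genW n
    have hwv : genW n * genV n * (genW n * genV n) = 1 := by
      rw [show genW n * genV n * (genW n * genV n) =
        genW n * (genV n * genW n * (genV n * genW n)) * (genW n)⁻¹ by group, hvw, mul_one,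
        mul_inv_cancel]
    have hΔ₁ := normalClosure_eq_ker_of_sign (closure_genV_genW n) hvw ε₁ hv₁ hw₁
    have hΔ₂ := normalClosure_eq_ker_of_sign (Set.pair_comm (genV n) (genW n) ▸ closure_genV_genW n)
      hwv ε₂ hw₂ hv₂
    have hi₁ : (Subgroup.normalClosure {genV n}).index = 2 := by
      rw [hΔ₁]; exact ε₁.index_ker_of_sign hw₁
    have hi₂ : (Subgroup.normalClosure {genW n}).index = 2 := by
      rw [hΔ₂]; exact ε₂.index_ker_of_sign hv₂
    -- On the kernel of θ this product is trivial, so ε₁ and ε₂ agree there; hence the two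
    -- intersections with it coincide.
    have hprod : χ.comp θ = ε₁ * ε₂ := by
      refine MonoidHom.eq_of_eqOn_dense (closure_gen n) ?_
      rintro _ (rfl | rfl | rfl)
      · simp [hθu, hχx, hu₁, hu₂]
      · simp [hθv, hχy, hv₁, hv₂]
      · simp [hθw, hχz, hw₁, hw₂]
    have hK : Subgroup.normalClosure {genV n} ⊓ θ.ker =
        Subgroup.normalClosure {genW n} ⊓ θ.ker := by
      rw [hΔ₁, hΔ₂]
      ext γ
      simp only [Subgroup.mem_inf, MonoidHom.mem_ker, and_congr_left_iff]
      intro hγ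
      have h1 := DFunLike.congr_fun hprod γ
      rw [MonoidHom.comp_apply, hγ, map_one, MonoidHom.mul_apply] at h1
      rw [eq_inv_of_mul_eq_one_left h1.symm, inv_eq_one]
    have hf₁ : (Subgroup.normalClosure {genV n}).FiniteIndex := ⟨by rw [hi₁]; decide⟩
    have hfθ : θ.ker.FiniteIndex := inferInstance
    refine ⟨triangleGroup n, genU n, genV n, genW n, θ, _, _, _, isCanonicalTriple n,
      closure_gen n, hθu, hθv, hθw, rfl, rfl, hi₁, hi₂, ?_, rfl, hK, ?_, ?_, ?_⟩
    · intro heq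
      have h1 : genV n ∈ Subgroup.normalClosure {genW n} :=
        heq ▸ Subgroup.subset_normalClosure rfl
      rw [hΔ₂, MonoidHom.mem_ker, hv₂] at h1
      exact absurd h1 (by decide)
    · exact isSurfaceGroup n θ (by rw [hθu, hx]) (by rw [hθv, hy]) (by rw [hθw, hz]) _ inf_le_right
    · exact Hypermap.regular_isUniformizedBy hn (exists_isRotation_genV n)
        (exists_isRotation_genW n) (closure_genV_genW n) hvw θ hab₁ (by simp [hθw])
        (by simp [hθv, hθw]) ht₁
    · rw [hK]
      exact Hypermap.regular_isUniformizedBy hn (exists_isRotation_genW n)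
        (exists_isRotation_genV n) (Set.pair_comm (genV n) (genW n) ▸ closure_genV_genW n) hwv θ
        hab₂ (by simp [hθv]) (by simp [hθv, hθw]) ht₂
  · rw [Hypermap.iso_regular_iff]
    constructor
    · rintro ⟨σ, h1, h2⟩
      have hyz' : y = (z ^ 2 * (z⁻¹ * y * z))⁻¹ := by
        rw [← mul_eq_one_iff_eq_inv]
        calc y * (z ^ 2 * (z⁻¹ * y * z)) = y * z * (y * z) := by group
          _ = 1 := h.yz
      have hσy : σ y = z := by
        rw [hyz', map_inv, map_mul, h1, h2, inv_eq_iff_mul_eq_one]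
        calc y ^ 2 * (y⁻¹ * z * y) * z = y * (z * y * (z * y)) * y⁻¹ := by group
          _ = 1 := by rw [h.zy]; group
      refine ⟨σ, hσy, ?_⟩
      rw [map_pow] at h1
      rw [map_mul, map_mul, map_inv, hσy] at h2
      have c1 : Commute (σ z) y := hcent _ (by rw [← h1]; exact Commute.self_pow _ _)
      have c2 : Commute (σ z * y⁻¹) y := c1.mul_left (Commute.inv_left (Commute.refl y))
      have c3 : Commute (σ z * y⁻¹) z := by
        have h3 : z * σ z * y⁻¹ = σ z * y⁻¹ * z := by
          have : z * σ z = σ z * (y⁻¹ * z * y) := by rw [← h2]; group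
          rw [this]; group
        rw [Commute, SemiconjBy, ← mul_assoc, h3]
      have hcen : σ z * y⁻¹ ∈ Subgroup.center G := by
        rw [Subgroup.mem_center_iff]
        intro g
        have hg : g ∈ Subgroup.closure {y, z} := by rw [hcl]; exact Subgroup.mem_top g
        have hle : Subgroup.closure {y, z} ≤ Subgroup.centralizer {σ z * y⁻¹} := by
          rw [Subgroup.closure_le]
          rintro _ (rfl | rfl)
          · exact Subgroup.mem_centralizer_singleton_iff.2 c2.eq.symm
          · exact Subgroup.mem_centralizer_singleton_iff.2 c3.eq.symm
        exact Subgroup.mem_centralizer_singleton_iff.1 (hle hg)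
      rw [hbot, Subgroup.mem_bot, mul_inv_eq_one] at hcen
      exact hcen
    · rintro ⟨σ, h1, h2⟩
      exact ⟨σ, by rw [map_pow, h2], by rw [map_mul, map_mul, map_inv, h1, h2]⟩

end

/-! ### Klein's counting argument -/

namespace MulAction

open Classical in
theorem card_orbit_le_two_of_fintype {G Y : Type*} [Group G] [Fintype G] [Fintype Y] [MulAction G Y]
    (hfix : ∀ g : G, g ≠ 1 → (fixedBy Y g).ncard = 2)
    (hstab : ∀ y : Y, stabilizer G y ≠ ⊥) (y₀ : Y) (hy₀ : 6 ≤ Nat.card (stabilizer G y₀)) :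
    Nat.card (orbit G y₀) ≤ 2 := by
  set N := Nat.card G with hN
  have hNpos : 0 < N := Nat.card_pos
  let Q := Quotient (orbitRel G Y)
  let o : Q → ℕ := fun q => Nat.card (orbit G q.out)
  have hmul : ∀ y : Y, Nat.card (orbit G y) * Nat.card (stabilizer G y) = N := fun y => by
    rw [hN, ← Nat.card_prod]
    exact Nat.card_congr (orbitProdStabilizerEquivGroup G y)
  have hpos : ∀ y : Y, 0 < Nat.card (orbit G y) := fun y => by
    have : Nonempty (orbit G y) := ⟨⟨y, mem_orbit_self y⟩⟩
    exact Nat.card_pos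
  have hsum : Nat.card Y = ∑ q, o q := by
    rw [Nat.card_congr (selfEquivSigmaOrbits G Y), Nat.card_sigma]
  -- Burnside's count: the identity fixes every point and each other element exactly two.
  have hburn : Nat.card Y + 2 * (N - 1) = Fintype.card Q * N := by
    have h := sum_card_fixedBy_eq_card_orbits_mul_card_group G Y
    rw [← Finset.add_sum_erase _ _ (Finset.mem_univ (1 : G)),
      Finset.sum_congr rfl (g := fun _ => 2) (fun g hg => by
        rw [← hfix g (Finset.ne_of_mem_erase hg), ← Nat.card_coe_set_eq, Nat.card_eq_fintype_card]),
      Finset.sum_const, Finset.card_erase_of_mem (Finset.mem_univ _), Finset.card_univ] at h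
    have h1 : Fintype.card (fixedBy Y (1 : G)) = Nat.card Y := by
      rw [Nat.card_eq_fintype_card]
      exact Fintype.card_congr ((Equiv.setCongr (fixedBy_one_eq_univ Y G)).trans
        (Equiv.Set.univ Y))
    rw [h1, smul_eq_mul, ← Nat.card_eq_fintype_card (α := G)] at h
    rw [hN, ← h, mul_comm 2]
  let q₀ : Q := Quotient.mk _ y₀
  have ho₀ : o q₀ = Nat.card (orbit G y₀) := by
    have h : orbit G q₀.out = orbit G y₀ := by
      rw [orbit_eq_iff]
      exact Quotient.mk_out (s := orbitRel G Y) y₀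
    simp only [o, h]
  have h6 : 6 * o q₀ ≤ N := by
    rw [ho₀, ← hmul y₀, mul_comm]
    exact Nat.mul_le_mul_left _ hy₀
  have h23 : ∀ q, 2 * o q = N ∨ 3 * o q ≤ N := by
    intro q
    have h2 : 2 ≤ Nat.card (stabilizer G q.out) := by
      have := (stabilizer G q.out).one_lt_card_iff_ne_bot.2 (hstab q.out)
      omega
    rcases h2.eq_or_lt with h | h
    · left
      rw [← hmul q.out, ← h, mul_comm]
    · right
      rw [← hmul q.out, mul_comm]
      exact Nat.mul_le_mul_left _ h
  have h0 := hpos y₀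
  rw [← ho₀] at h0 ⊢
  rw [hsum, ← Finset.add_sum_erase _ _ (Finset.mem_univ q₀)] at hburn
  have hcard : Fintype.card Q = (Finset.univ.erase q₀).card + 1 := by
    rw [Finset.card_erase_of_mem (Finset.mem_univ _), Finset.card_univ]
    have : 0 < Fintype.card Q := Fintype.card_pos_iff.2 ⟨q₀⟩
    omega
  rw [hcard] at hburn
  have hle : 2 * ∑ q ∈ Finset.univ.erase q₀, o q ≤ (Finset.univ.erase q₀).card * N := by
    rw [Finset.mul_sum, ← smul_eq_mul, ← Finset.sum_const]
    refine Finset.sum_le_sum fun q _ => ?_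
    have := h23 q
    omega
  generalize Finset.univ.erase q₀ = T at *
  -- The orbit of y₀ has at most N/6 points and every other at most N/2, so the count leaves room
  -- for at most two others.
  have hT : T.card ≤ 2 := by
    by_contra! h3
    have : 3 * N ≤ T.card * N := Nat.mul_le_mul_right _ h3
    have e : (T.card + 1) * N = T.card * N + N := by ring
    omega
  -- With two other orbits the count reads o₀ + o₁ + o₂ = N + 2. If one of them had at most N/3
  -- points the sum would be at most N/6 + N/2 + N/3 = N; so both have N/2 and o₀ = 2. This is where
  -- the bound six is needed.
  interval_cases hc : T.card
  · rw [Finset.card_eq_zero.1 hc] at hburn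
    simp at hburn
    omega
  · obtain ⟨q₁, rfl⟩ := Finset.card_eq_one.1 hc
    simp at hburn
    omega
  · obtain ⟨q₁, q₂, h12, rfl⟩ := Finset.card_eq_two.1 hc
    rw [Finset.sum_pair h12] at hburn
    have := h23 q₁
    have := h23 q₂
    omega

/-- If every non-identity element of a finite group has exactly two fixed points, then a point with
stabiliser of order at least six has an orbit of at most two points. -/
theorem card_orbit_le_two {G X : Type*} [Group G] [Finite G] [MulAction G X]
    (hfix : ∀ g : G, g ≠ 1 → (fixedBy X g).ncard = 2) (x₀ : X)
    (hx₀ : 6 ≤ Nat.card (stabilizer G x₀)) : (orbit G x₀).ncard ≤ 2 := by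
  classical
  -- Only points with non-trivial stabiliser matter. They are finite in number, each being among the
  -- two fixed points of one of finitely many elements.
  let S : SubMulAction G X :=
    { carrier := {x | stabilizer G x ≠ ⊥}
      smul_mem' := fun g x hx h => hx (by
        rw [stabilizer_smul_eq_stabilizer_map_conj, Subgroup.map_eq_bot_iff_of_injective _
          (MulAut.conj g).injective] at h
        exact h) }
  have hSmem : ∀ x, x ∈ S ↔ stabilizer G x ≠ ⊥ := fun x => Iff.rfl
  have hmemS : ∀ (g : G) (x : X), g ≠ 1 → g • x = x → x ∈ S := fun g x hg hx =>
    (hSmem x).2 fun h => hg (by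
      have : g ∈ stabilizer G x := hx
      rwa [h, Subgroup.mem_bot] at this)
  have hfin : (S : Set X).Finite := by
    refine Set.Finite.subset (Set.finite_iUnion fun g : {g : G // g ≠ 1} =>
      Set.finite_of_ncard_pos (s := fixedBy X g.1) (by rw [hfix g.1 g.2]; exact two_pos)) ?_
    intro x hx
    obtain ⟨g, hg1⟩ := Subgroup.ne_bot_iff_exists_ne_one.1 hx
    exact Set.mem_iUnion.2 ⟨⟨g.1, fun h => hg1 (Subtype.ext h)⟩, g.2⟩
  have : Fintype G := Fintype.ofFinite G
  have : Finite S := hfin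
  have : Fintype S := Fintype.ofFinite S
  have hx₀S : x₀ ∈ S := (hSmem x₀).2 fun h => by
    rw [h, Subgroup.card_bot] at hx₀
    omega
  have hstabS : ∀ y : S, stabilizer G y = stabilizer G (y : X) := fun y => by
    ext g
    simp [mem_stabilizer_iff, Subtype.ext_iff]
  have h := card_orbit_le_two_of_fintype (G := G) (Y := S) (fun (g : G) hg => by
    rw [← Nat.card_coe_set_eq, ← hfix g hg]
    exact Nat.card_congr
      { toFun := fun y => ⟨y.1.1, congrArg Subtype.val y.2⟩
        invFun := fun x => ⟨⟨x.1, hmemS g x.1 hg x.2⟩, Subtype.ext x.2⟩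
        left_inv := fun _ => rfl
        right_inv := fun _ => rfl })
    (fun y => by rw [hstabS]; exact y.2) ⟨x₀, hx₀S⟩ (by rwa [hstabS])
  refine le_trans (le_of_eq ?_) h
  have himg : orbit G x₀ = Subtype.val '' orbit G (⟨x₀, hx₀S⟩ : S) := by
    ext x
    constructor
    · rintro ⟨g, rfl⟩
      exact ⟨g • ⟨x₀, hx₀S⟩, ⟨g, rfl⟩, rfl⟩
    · rintro ⟨_, ⟨g, rfl⟩, rfl⟩
      exact ⟨g, rfl⟩
  rw [himg, Set.ncard_image_of_injective _ Subtype.val_injective, Nat.card_coe_set_eq]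

end MulAction

/-! ### The action of `PGL(2, K)` on the projective line -/

namespace Matrix.ProjGenLinGroup

open scoped OnePoint

theorem mk_eq_one_iff_fin_two {R : Type*} [CommRing R] {g : GL (Fin 2) R} :
    mk g = 1 ↔ g 0 1 = 0 ∧ g 1 0 = 0 ∧ g 0 0 = g 1 1 := by
  rw [mk_eq_one, GeneralLinearGroup.mem_center_iff_val_mem_range_scalar]
  constructor
  · rintro ⟨r, hr⟩
    simp [← hr]
  · rintro ⟨h1, h2, h3⟩
    refine ⟨g 0 0, ?_⟩
    ext i j
    fin_cases i <;> fin_cases j <;> simp [*]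

theorem map_injective {R S : Type*} [CommRing R] [CommRing S] {f : R →+* S}
    (hf : Function.Injective f) : Function.Injective (map (n := Fin 2) f) := by
  rw [injective_iff_map_eq_one]
  intro g
  induction g using induction_on with | mk g =>
  rw [map_mk, mk_eq_one_iff_fin_two, mk_eq_one_iff_fin_two]
  simp [map_eq_zero_iff f hf, hf.eq_iff]

instance {R : Type*} [CommRing R] [Finite R] : Finite PGL(2, R) :=
  Finite.of_surjective _ mk_surjective

variable {K : Type*} [Field K]

open Classical in
noncomputable instance onePointAction : MulAction PGL(2, K) (OnePoint K) :=
  mulActionOfGL fun u a => by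
    cases a with
    | infty => simp [OnePoint.smul_infty_eq_ite]
    | coe a => simp [OnePoint.smul_some_eq_ite]

theorem mk_smul_infty_eq_iff {g : GL (Fin 2) K} :
    (mk g) • (∞ : OnePoint K) = ∞ ↔ g 1 0 = 0 := by
  classical
  have h : (mk g) • (∞ : OnePoint K) = g • (∞ : OnePoint K) := rfl
  rw [h, OnePoint.smul_infty_eq_self_iff]

theorem mk_smul_infty {g : GL (Fin 2) K} (hg : g 1 0 ≠ 0) :
    (mk g) • (∞ : OnePoint K) = ↑(g 0 0 / g 1 0) := by
  classical
  have h : (mk g) • (∞ : OnePoint K) = g • (∞ : OnePoint K) := rfl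
  rw [h, OnePoint.smul_infty_eq_ite, if_neg hg]

theorem mk_smul_coe_eq_iff {g : GL (Fin 2) K} {k : K} :
    (mk g) • (k : OnePoint K) = k ↔ g 1 0 * k ^ 2 + (g 1 1 - g 0 0) * k - g 0 1 = 0 := by
  classical
  have h : (mk g) • (k : OnePoint K) = g • (k : OnePoint K) := rfl
  rw [h, ← GeneralLinearGroup.fixpointPolynomial_aeval_eq_zero_iff]
  simp [GeneralLinearGroup.fixpointPolynomial]

/-- The finite fixed points are the roots of ck² + (d − a)k − b, whose discriminant is the given
expression; when c = 0 one of the two fixed points is ∞. -/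
theorem ncard_fixedBy [IsAlgClosed K] {g : GL (Fin 2) K} (hg : (g 0 0 - g 1 1) ^ 2 + 4 * g 0 1 * g 1 0 ≠ 0) :
    (MulAction.fixedBy (OnePoint K) (mk g)).ncard = 2 := by
  rw [Set.ncard_eq_two]
  by_cases hc : g 1 0 = 0
  · have ha : g 1 1 - g 0 0 ≠ 0 := fun h => hg (by rw [hc]; linear_combination (g 1 1 - g 0 0) * h)
    refine ⟨∞, ↑(g 0 1 / (g 1 1 - g 0 0)), OnePoint.infty_ne_coe _, ?_⟩
    ext k
    rw [MulAction.mem_fixedBy]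
    cases k with
    | infty => simp [mk_smul_infty_eq_iff, hc]
    | coe k =>
      rw [mk_smul_coe_eq_iff, hc]
      simp only [Set.mem_insert_iff, Set.mem_singleton_iff, OnePoint.coe_ne_infty, false_or,
        OnePoint.coe_eq_coe, eq_div_iff ha]
      constructor <;> intro h <;> linear_combination h
  · obtain ⟨r, hr⟩ : ∃ r, g 1 0 * r ^ 2 + (g 1 1 - g 0 0) * r - g 0 1 = 0 := by
      obtain ⟨r, hr⟩ := IsAlgClosed.exists_root
        (Polynomial.C (g 1 0) * Polynomial.X ^ 2 + Polynomial.C (g 1 1 - g 0 0) * Polynomial.X +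
          Polynomial.C (-g 0 1)) (by rw [Polynomial.degree_quadratic hc]; decide)
      refine ⟨r, ?_⟩
      simpa [Polynomial.IsRoot, sub_eq_add_neg] using hr
    have hs : ∀ k, g 1 0 * k ^ 2 + (g 1 1 - g 0 0) * k - g 0 1 =
        g 1 0 * ((k - r) * (k - ((g 0 0 - g 1 1) / g 1 0 - r))) := fun k => by
      field_simp
      linear_combination hr
    refine ⟨r, ↑((g 0 0 - g 1 1) / g 1 0 - r), ?_, ?_⟩
    · rw [Ne, OnePoint.coe_eq_coe]
      intro h
      have h' : 2 * g 1 0 * r = g 0 0 - g 1 1 := by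
        field_simp at h
        linear_combination h
      apply hg
      linear_combination (-4 * g 1 0) * hr + (2 * g 1 0 * r - (g 0 0 - g 1 1)) * h'
    · ext k
      rw [MulAction.mem_fixedBy]
      cases k with
      | infty => simp [mk_smul_infty_eq_iff, hc]
      | coe k =>
        rw [mk_smul_coe_eq_iff, hs]
        simp [hc, sub_eq_zero]

/-- Such a matrix is a scalar r plus N with N² = 0, and its p-th power is the scalar r^p by the
Frobenius identity. -/
theorem mk_pow_eq_one_of_discr_eq_zero (p : ℕ) [Fact p.Prime] [CharP K p] (hp : p ≠ 2)
    {g : GL (Fin 2) K} (hg : (g 0 0 - g 1 1) ^ 2 + 4 * g 0 1 * g 1 0 = 0) : mk g ^ p = 1 := by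
  have h2 : (2 : K) ≠ 0 := Ring.two_ne_zero ((CharP.eq K ‹CharP K p› (ringChar.charP K)) ▸ hp)
  set N : Matrix (Fin 2) (Fin 2) K := !![(g 0 0 - g 1 1) / 2, g 0 1; g 1 0, (g 1 1 - g 0 0) / 2]
    with hN
  have hgN : g.val = N + scalar (Fin 2) ((g 0 0 + g 1 1) / 2) := by
    ext i j
    fin_cases i <;> fin_cases j <;> simp [hN] <;> field_simp <;> ring
  have hNN : N ^ 2 = 0 := by
    rw [sq, hN]
    ext i j
    fin_cases i <;> fin_cases j <;> simp [Matrix.mul_apply, Fin.sum_univ_two] <;> field_simp <;>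
      first | ring1 | linear_combination hg
  have hp2 : 2 ≤ p := (Fact.out : p.Prime).two_le
  rw [← map_pow, mk_eq_one, GeneralLinearGroup.mem_center_iff_val_mem_range_scalar]
  generalize (g 0 0 + g 1 1) / 2 = r at hgN
  clear_value N
  refine ⟨r ^ p, ?_⟩
  rw [Units.val_pow_eq_pow_val, hgN, add_pow_char_of_commute (p := p)
    (scalar_commute _ (fun r => Commute.all _ _) _).symm, pow_eq_zero_of_le hp2 hNN, zero_add,
    map_pow]

/-- If p did not divide the order, no non-identity element would have zero discriminant and Klein's
count would apply to ∞, whose orbit contains three points. -/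
theorem dvd_card_of_mem [IsAlgClosed K] (p : ℕ) [Fact p.Prime] [CharP K p] (hp : p ≠ 2)
    (H : Subgroup PGL(2, K)) [Finite H] {X Y : GL (Fin 2) K} (hX : mk X ∈ H) (hY : mk Y ∈ H)
    (hY1 : Y 1 0 = 0) (hY6 : 6 ≤ orderOf (mk Y)) (hX1 : X 1 0 ≠ 0)
    (hXY : mk Y • mk X • (∞ : OnePoint K) ≠ mk X • (∞ : OnePoint K)) : p ∣ Nat.card H := by
  by_contra hdvd
  have hYi : mk Y • (∞ : OnePoint K) = ∞ := mk_smul_infty_eq_iff.2 hY1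
  have hXi : mk X • (∞ : OnePoint K) ≠ ∞ := mk_smul_infty_eq_iff.not.2 hX1
  have hfix : ∀ g : H, g ≠ 1 → (MulAction.fixedBy (OnePoint K) g).ncard = 2 := by
    rintro ⟨g, hgH⟩ hg
    induction g using induction_on with | mk g =>
    refine ncard_fixedBy (g := g) fun h0 => hdvd ?_
    rw [← orderOf_eq_prime (p := p) (x := (⟨mk g, hgH⟩ : H)) (Subtype.ext
      (mk_pow_eq_one_of_discr_eq_zero p hp h0)) hg]
    exact orderOf_dvd_natCard _
  have h6 : 6 ≤ Nat.card (MulAction.stabilizer H (∞ : OnePoint K)) := by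
    refine hY6.trans ?_
    have h1 : (⟨mk Y, hY⟩ : H) ∈ MulAction.stabilizer H (∞ : OnePoint K) := hYi
    have h2 : orderOf (mk Y) = orderOf (⟨⟨mk Y, hY⟩, h1⟩ : MulAction.stabilizer H (∞ : OnePoint K)) := by
      rw [Subgroup.orderOf_mk, Subgroup.orderOf_mk]
    rw [h2]
    exact Nat.le_of_dvd Nat.card_pos (orderOf_dvd_natCard _)
  have hle := MulAction.card_orbit_le_two hfix ∞ h6
  have hsub : ({∞, mk X • ∞, mk Y • mk X • ∞} : Set (OnePoint K)) ⊆
      MulAction.orbit H (∞ : OnePoint K) := by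
    rintro k (rfl | rfl | rfl)
    · exact MulAction.mem_orbit_self _
    · exact ⟨⟨mk X, hX⟩, rfl⟩
    · exact ⟨⟨mk Y, hY⟩ * ⟨mk X, hX⟩, mul_smul (mk Y) (mk X) (∞ : OnePoint K)⟩
  have h3 : ({∞, mk X • ∞, mk Y • mk X • ∞} : Set (OnePoint K)).ncard = 3 := by
    rw [Set.ncard_eq_three]
    refine ⟨_, _, _, hXi.symm, fun h => hXi ?_, hXY.symm, rfl⟩
    exact MulAction.injective (mk Y) (h.symm.trans hYi.symm)
  have hfin : (MulAction.orbit H (∞ : OnePoint K)).Finite := Set.finite_range _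
  have := Set.ncard_le_ncard hsub hfin
  omega

end Matrix.ProjGenLinGroup

/-! ### The group `PGL(2, F)` -/

namespace Matrix.ProjGenLinGroup

variable {F : Type*} [Field F]

/-- This is interpolation of t^k at the two eigenvalues, justified by Cayley–Hamilton and cleared of
the denominator α − β. -/
theorem sub_smul_pow {R : Type*} [CommRing R] {M : Matrix (Fin 2) (Fin 2) R} {α β : R}
    (ht : M.trace = α + β) (hd : M.det = α * β) (k : ℕ) :
    (α - β) • M ^ k = (α ^ k - β ^ k) • M + (α * β ^ k - β * α ^ k) • 1 := by
  induction k with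
  | zero => simp
  | succ k ih =>
    rw [pow_succ, ← smul_mul_assoc, ih, add_mul, smul_mul_assoc, fin_two_mul_self, ht, hd,
      smul_mul_assoc, one_mul]
    module

/-- The order of the image in `PGL(2, F)` of a matrix with distinct eigenvalues. -/
theorem orderOf_mk {g : GL (Fin 2) F} {α β : F} (ht : g.val.trace = α + β)
    (hd : g.val.det = α * β) (hαβ : α ≠ β) : orderOf (mk g) = orderOf (α / β) := by
  have hβ : β ≠ 0 := fun h => g.det_ne_zero (by rw [hd, h, mul_zero])
  rw [orderOf_eq_orderOf_iff]
  intro k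
  have h := sub_smul_pow ht hd k
  have hab : α - β ≠ 0 := sub_ne_zero.2 hαβ
  have h00 := congrFun₂ h 0 0
  have h01 := congrFun₂ h 0 1
  have h10 := congrFun₂ h 1 0
  have h11 := congrFun₂ h 1 1
  simp only [smul_apply, add_apply, smul_eq_mul, one_apply_eq, Fin.isValue, ne_eq, zero_ne_one,
    one_ne_zero, not_false_eq_true, one_apply_ne, mul_zero, mul_one, add_zero] at h00 h01 h10 h11
  rw [← map_pow, mk_eq_one_iff_fin_two, Units.val_pow_eq_pow_val, div_pow,
    div_eq_one_iff_eq (pow_ne_zero _ hβ)]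
  constructor
  · rintro ⟨e01, e10, e⟩
    -- If α^k ≠ β^k while g^k is scalar, the formula makes g itself scalar, so its discriminant (α −
    -- β)² vanishes.
    by_contra hne
    rw [← sub_eq_zero] at hne
    rw [e01, mul_zero] at h01
    rw [e10, mul_zero] at h10
    have f01 := (mul_eq_zero.1 h01.symm).resolve_left hne
    have f10 := (mul_eq_zero.1 h10.symm).resolve_left hne
    have f : (α ^ k - β ^ k) * (g.val 0 0 - g.val 1 1) = 0 := by
      linear_combination h11 - h00 + (α - β) * e
    have f := (mul_eq_zero.1 f).resolve_left hne
    rw [trace_fin_two] at ht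
    rw [det_fin_two] at hd
    apply hab
    rw [← sq_eq_zero_iff]
    linear_combination (-(α + β) - (g.val 0 0 + g.val 1 1)) * ht + 4 * hd +
      (g.val 0 0 - g.val 1 1) * f + 4 * g.val 1 0 * f01
  · intro hk
    rw [hk, sub_self, zero_mul] at h01 h10
    rw [hk, sub_self, zero_mul] at h00 h11
    exact ⟨(mul_eq_zero.1 h01).resolve_left hab, (mul_eq_zero.1 h10).resolve_left hab,
      mul_left_cancel₀ hab (h00.trans h11.symm)⟩

theorem mk_mem_subgroupL2 {g : GL (Fin 2) F} : mk g ∈ subgroupL2 F ↔ IsSquare g.val.det := by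
  constructor
  · rintro ⟨q, hq⟩
    induction q using QuotientGroup.induction_on with | H A =>
    rw [ProjectiveSpecialLinearGroup.toPGL_mk, mk_eq_mk_iff] at hq
    obtain ⟨u, rfl⟩ := hq
    exact ⟨u, by simp [sq]⟩
  · rintro ⟨r, hr⟩
    have hr0 : r ≠ 0 := fun h => g.det_ne_zero (by rw [hr, h, mul_zero])
    have hd : (r⁻¹ • g.val).det = 1 := by
      rw [det_smul, hr, Fintype.card_fin]
      field_simp
    refine ⟨QuotientGroup.mk (⟨r⁻¹ • g.val, hd⟩ : SL(2, F)),
      (mk_eq_mk_iff (g₁ := SpecialLinearGroup.toGL ⟨r⁻¹ • g.val, hd⟩)).2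
        ⟨Units.mk0 r hr0, Units.ext ?_⟩⟩
    ext i j
    fin_cases i <;> fin_cases j <;> simp [Matrix.mul_apply, mul_comm] <;>
      exact mul_inv_cancel_left₀ hr0 _

theorem subgroupL2_le {S : Subgroup PGL(2, F)}
    (hu : ∀ g : GL (Fin 2) F, g 0 0 = 1 → g 1 1 = 1 → g 1 0 = 0 → mk g ∈ S)
    (hl : ∀ g : GL (Fin 2) F, g 0 0 = 1 → g 1 1 = 1 → g 0 1 = 0 → mk g ∈ S) :
    subgroupL2 F ≤ S := by
  rintro _ ⟨q, rfl⟩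
  induction q using QuotientGroup.induction_on with | H A =>
  rw [ProjectiveSpecialLinearGroup.toPGL_mk]
  induction A using SL2.transvection_induction with
  | htransvec i j hij a =>
    fin_cases i <;> fin_cases j
    · exact absurd rfl hij
    · exact hu _ (by simp [SpecialLinearGroup.transvection_coe]) (by simp [SpecialLinearGroup.transvection_coe]) (by simp [SpecialLinearGroup.transvection_coe])
    · exact hl _ (by simp [SpecialLinearGroup.transvection_coe]) (by simp [SpecialLinearGroup.transvection_coe]) (by simp [SpecialLinearGroup.transvection_coe])
    · exact absurd rfl hij
  | hmul A B hA hB =>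
    rw [map_mul, map_mul]
    exact mul_mem hA hB

theorem upper_pow (s : F) (k : ℕ) : (!![1, s; 0, 1] : Matrix (Fin 2) (Fin 2) F) ^ k = !![1, k * s; 0, 1] := by
  induction k with
  | zero => simp [one_fin_two]
  | succ k ih =>
    rw [pow_succ, ih, mul_fin_two]
    simp
    ring

theorem lower_pow (s : F) (k : ℕ) : (!![1, 0; s, 1] : Matrix (Fin 2) (Fin 2) F) ^ k = !![1, 0; k * s, 1] := by
  induction k with
  | zero => simp [one_fin_two]
  | succ k ih =>
    rw [pow_succ, ih, mul_fin_two]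
    simp
    ring

instance subgroupL2_normal : (subgroupL2 F).Normal := by
  refine ⟨fun n hn g => ?_⟩
  induction n using induction_on with | mk n =>
  induction g using induction_on with | mk g =>
  rw [← map_mul, ← map_inv, ← map_mul]
  rw [mk_mem_subgroupL2] at hn ⊢
  rw [Units.val_mul, Units.val_mul, det_mul, det_mul, mul_right_comm, ← det_mul, Units.mul_inv, det_one, one_mul]
  exact hn

theorem eq_upper {A : Matrix (Fin 2) (Fin 2) F} (hd : A.det = 1) (hA : A *ᵥ ![1, 0] = ![1, 0]) :
    A = !![1, A 0 1; 0, 1] := by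
  have h0 := congrFun hA 0
  have h1 := congrFun hA 1
  rw [det_fin_two] at hd
  simp at h0 h1
  rw [h0, h1, one_mul, mul_zero, sub_zero] at hd
  ext i j
  fin_cases i <;> fin_cases j <;> simp [*]

theorem eq_lower {A : Matrix (Fin 2) (Fin 2) F} (hd : A.det = 1) (hA : A *ᵥ ![0, 1] = ![0, 1]) :
    A = !![1, 0; A 1 0, 1] := by
  have h0 := congrFun hA 0
  have h1 := congrFun hA 1
  rw [det_fin_two] at hd
  simp at h0 h1
  rw [h0, h1, mul_one, zero_mul, sub_zero] at hd
  ext i j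
  fin_cases i <;> fin_cases j <;> simp [*]

variable {p : ℕ} [Fact p.Prime]

/-- Over the prime field the powers of one transvection exhaust its root subgroup, and the two
opposite root subgroups generate SL₂. -/
theorem subgroupL2_le_of_upper_of_lower {S : Subgroup PGL(2, ZMod p)} {g h : GL (Fin 2) (ZMod p)} {s t : ZMod p}
    (hs : s ≠ 0) (ht : t ≠ 0) (hg : g.val = !![1, s; 0, 1]) (hh : h.val = !![1, 0; t, 1])
    (hgS : mk g ∈ S) (hhS : mk h ∈ S) : subgroupL2 (ZMod p) ≤ S := by
  refine subgroupL2_le (fun f h0 h1 h2 => ?_) fun f h0 h1 h2 => ?_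
  · have : f = g ^ (f 0 1 / s).val := Units.ext (by
      rw [Units.val_pow_eq_pow_val, hg, upper_pow, ZMod.natCast_zmod_val, div_mul_cancel₀ _ hs]
      ext i j
      fin_cases i <;> fin_cases j <;> simp [*])
    rw [this, map_pow]
    exact pow_mem hgS _
  · have : f = h ^ (f 1 0 / t).val := Units.ext (by
      rw [Units.val_pow_eq_pow_val, hh, lower_pow, ZMod.natCast_zmod_val, div_mul_cancel₀ _ ht]
      ext i j
      fin_cases i <;> fin_cases j <;> simp [*])
    rw [this, map_pow]
    exact pow_mem hhS _

/-- In the basis v, kv the transvection g is upper unipotent and kgk⁻¹ is lower unipotent. -/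
theorem subgroupL2_le_of_transvection {S : Subgroup PGL(2, ZMod p)} {g k : GL (Fin 2) (ZMod p)}
    (hg1 : g ≠ 1) (hgd : g.val.det = 1) (hgS : mk g ∈ S) (hkS : mk k ∈ S) {v : Fin 2 → ZMod p}
    (hgv : g.val *ᵥ v = v) (hkv : v 0 * (k.val *ᵥ v) 1 - (k.val *ᵥ v) 0 * v 1 ≠ 0) :
    subgroupL2 (ZMod p) ≤ S := by
  set w := k.val *ᵥ v with hw
  let P : GL (Fin 2) (ZMod p) := GeneralLinearGroup.mkOfDetNeZero !![v 0, w 0; v 1, w 1]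
    (by rwa [det_fin_two_of])
  have hP : P.val = !![v 0, w 0; v 1, w 1] := rfl
  have hP0 : P.val *ᵥ ![1, 0] = v := by
    ext i
    fin_cases i <;> simp [hP]
  have hP1 : P.val *ᵥ ![0, 1] = w := by
    ext i
    fin_cases i <;> simp [hP]
  have key : ∀ f : GL (Fin 2) (ZMod p), (P⁻¹ * f * P).val.det = f.val.det := fun f => by
    rw [Units.val_mul, Units.val_mul, det_mul, det_mul, mul_right_comm, ← det_mul, Units.inv_mul, det_one, one_mul]
  have hcol : ∀ (f : GL (Fin 2) (ZMod p)) (e v : Fin 2 → ZMod p), P.val *ᵥ e = v → f.val *ᵥ v = v →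
      (P⁻¹ * f * P).val *ᵥ e = e := fun f e v he hf => by
    rw [Units.val_mul, Units.val_mul, ← mulVec_mulVec, he, ← mulVec_mulVec, hf, ← he, mulVec_mulVec,
      Units.inv_mul, one_mulVec]
  have hne : ∀ f : GL (Fin 2) (ZMod p), f ≠ 1 → P⁻¹ * f * P ≠ 1 := fun f hf h => hf (by
    rwa [mul_assoc, inv_mul_eq_one, right_eq_mul] at h)
  have hg0 : (P⁻¹ * g * P).val = !![1, (P⁻¹ * g * P).val 0 1; 0, 1] :=
    eq_upper ((key g).trans hgd) (hcol g _ v hP0 hgv)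
  have hkw : (k * g * k⁻¹).val *ᵥ w = w := by
    rw [Units.val_mul, Units.val_mul, hw, mulVec_mulVec, mul_assoc, mul_assoc, Units.inv_mul, mul_one,
      ← mulVec_mulVec, hgv]
  have hk0 : (P⁻¹ * (k * g * k⁻¹) * P).val = !![1, 0; (P⁻¹ * (k * g * k⁻¹) * P).val 1 0, 1] := by
    refine eq_lower ((key _).trans ?_) (hcol _ _ w hP1 hkw)
    rw [Units.val_mul, Units.val_mul, det_mul, det_mul, mul_right_comm, ← det_mul, Units.mul_inv,
      det_one, one_mul, hgd]
  have hle := subgroupL2_le_of_upper_of_lower (S := S.comap (MulAut.conj (mk P)).toMonoidHom)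
    (g := P⁻¹ * g * P) (h := P⁻¹ * (k * g * k⁻¹) * P) (fun h => ?_) (fun h => ?_) hg0 hk0 ?_ ?_
  · intro l hl
    have h := hle (subgroupL2_normal.conj_mem l hl (mk P)⁻¹)
    simpa [mul_assoc] using h
  · rw [h, ← one_fin_two] at hg0
    exact hne g hg1 (Units.ext hg0)
  · rw [h, ← one_fin_two] at hk0
    refine hne _ (fun hk => hg1 ?_) (Units.ext hk0)
    rwa [mul_inv_eq_one, mul_eq_left] at hk
  · simpa [mul_assoc] using hgS
  · simpa [mul_assoc] using mul_mem (mul_mem hkS hgS) (inv_mem hkS)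

end Matrix.ProjGenLinGroup

/-- Modulo N the element y disappears, so the quotient is generated by z with z² = 1. -/
theorem Subgroup.Normal.index_eq_two_of_mem {G : Type*} [Group G] {y z : G}
    (hG : Subgroup.closure {y, z} = ⊤) (hyz : y * z * (y * z) = 1) {N : Subgroup G} (hN : N.Normal)
    (hy : y ∈ N) (hNtop : N ≠ ⊤) : N.index = 2 := by
  have hz : z ∉ N := fun hz => hNtop (by
    rw [eq_top_iff, ← hG, Subgroup.closure_le]
    rintro g (rfl | rfl)
    exacts [hy, hz])
  have hz2 : z * z ∈ N := by
    have h := hN.conj_mem _ hy z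
    have e : z * z = (y * (z * y * z⁻¹))⁻¹ := by
      rw [eq_inv_iff_mul_eq_one]
      have : z * (y * z * (y * z)) * z⁻¹ = 1 := by rw [hyz]; group
      have e2 : z * z * (y * (z * y * z⁻¹)) = z * (z * (y * z * (y * z)) * z⁻¹) * z⁻¹ := by group
      rw [e2, this]; group
    rw [e]
    exact inv_mem (mul_mem hy h)
  have hpow : ∀ k : ℤ, Even k → z ^ k ∈ N := by
    rintro k ⟨m, rfl⟩
    rw [← two_mul, zpow_mul, zpow_two]
    exact zpow_mem hz2 m
  have hsup : N ⊔ Subgroup.zpowers z = ⊤ := by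
    rw [eq_top_iff, ← hG, Subgroup.closure_le]
    rintro g (rfl | rfl)
    · exact Subgroup.mem_sup_left hy
    · exact Subgroup.mem_sup_right (Subgroup.mem_zpowers _)
  rw [Subgroup.index_eq_two_iff]
  refine ⟨z, fun g => ?_⟩
  have hg : g ∈ N ⊔ Subgroup.zpowers z := hsup ▸ Subgroup.mem_top g
  rw [Subgroup.mem_sup_of_normal_left] at hg
  obtain ⟨m, hm, _, ⟨k, rfl⟩, rfl⟩ := hg
  by_cases hk : Even k
  · refine Or.inr ⟨mul_mem hm (hpow k hk), fun h => hz ?_⟩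
    exact (N.mul_mem_cancel_left (mul_mem hm (hpow k hk))).1 h
  · have h1 : m * z ^ k * z ∈ N := by
      rw [mul_assoc, ← zpow_add_one]
      exact mul_mem hm (hpow _ (Int.not_even_iff_odd.1 hk).add_one)
    exact Or.inl ⟨h1, fun h => hz ((N.mul_mem_cancel_left h).1 h1)⟩

/-! ### Commutation, the centre, and the subgroup of index two -/

namespace Matrix.ProjGenLinGroup

section Field

variable {F : Type*} [Field F]

/-- M must preserve the line fixed by both unipotent matrices. Equality in `PGL` holds only up to a
scalar u, which comparison of entries shows to be 1. -/
theorem eq_of_mk_mul_upper {M U V : GL (Fin 2) F} {s t : F} (hs : s ≠ 0)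
    (hU : U.val = !![1, s; 0, 1]) (hV : V.val = !![1, t; 0, 1])
    (h : mk M * mk U = mk V * mk M) : M 1 0 = 0 ∧ M 0 0 * s = t * M 1 1 := by
  rw [← map_mul, ← map_mul, mk_eq_mk_iff] at h
  obtain ⟨u, hu⟩ := h
  have hd := M.det_ne_zero
  rw [det_fin_two] at hd
  have e := congrArg Units.val hu
  rw [Units.val_mul, Units.val_mul, Units.val_mul, hU, hV] at e
  have h00 := congrFun₂ e 0 0
  have h01 := congrFun₂ e 0 1
  have h10 := congrFun₂ e 1 0
  have h11 := congrFun₂ e 1 1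
  simp [Matrix.mul_apply] at h00 h01 h10 h11
  have hm : M 1 0 = 0 := by
    by_contra hm
    have hu1 : (u : F) = 1 := mul_left_cancel₀ hm (by rw [mul_one]; exact h10)
    rw [hu1] at h11
    exact mul_ne_zero hm hs (by linear_combination h11)
  refine ⟨hm, ?_⟩
  rw [hm] at h00 hd
  have h0 : M 0 0 ≠ 0 := fun h => hd (by rw [h]; ring)
  have hu1 : (u : F) = 1 := mul_left_cancel₀ h0 (by linear_combination h00)
  rw [hu1] at h01
  linear_combination h01

/-- The condition on e excludes −1, because diag(−1, 1) commutes modulo scalars with antidiagonal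
matrices. -/
theorem eq_zero_of_commute_diagonal {M D : GL (Fin 2) F} {e : F} (he : e ^ 2 ≠ 1)
    (hD : D.val = matY e) (h : Commute (mk M) (mk D)) : M 0 1 = 0 ∧ M 1 0 = 0 := by
  have h' : mk M * mk D = mk D * mk M := h
  rw [← map_mul, ← map_mul, mk_eq_mk_iff] at h'
  obtain ⟨u, hu⟩ := h'
  have hd := M.det_ne_zero
  have hd' := D.det_ne_zero
  rw [det_fin_two] at hd hd'
  have e' := congrArg Units.val hu
  rw [Units.val_mul, Units.val_mul, Units.val_mul, hD] at e'
  have h00 := congrFun₂ e' 0 0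
  have h01 := congrFun₂ e' 0 1
  have h10 := congrFun₂ e' 1 0
  have h11 := congrFun₂ e' 1 1
  rw [hD] at hd'
  simp [Matrix.mul_apply, matY] at h00 h01 h10 h11 hd'
  have hu1 : (u : F) ≠ 1 → M 0 0 = 0 ∧ M 1 1 = 0 := fun hu1 => by
    rw [← sub_ne_zero] at hu1
    exact ⟨(mul_eq_zero.1 (by linear_combination h00 : e * (u - 1) * M 0 0 = 0)).resolve_left
      (mul_ne_zero hd' hu1), (mul_eq_zero.1 (by linear_combination h11 :
      ((u : F) - 1) * M 1 1 = 0)).resolve_left hu1⟩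
  by_cases h1 : (u : F) = 1
  · have he1 : e - 1 ≠ 0 := fun h => he (by linear_combination (e + 1) * h)
    rw [h1] at h01 h10
    exact ⟨(mul_eq_zero.1 (by linear_combination -h01 : (e - 1) * M 0 1 = 0)).resolve_left he1,
      (mul_eq_zero.1 (by linear_combination h10 : (e - 1) * M 1 0 = 0)).resolve_left he1⟩
  · rw [(hu1 h1).1, zero_mul, zero_sub, neg_ne_zero, mul_ne_zero_iff] at hd
    exfalso
    apply he
    have ue : (u : F) = e := mul_left_cancel₀ hd.1 (by linear_combination h01)
    rw [ue] at h10
    exact mul_left_cancel₀ hd.2 (by linear_combination h10)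

theorem commute_of_commute_sq {M D : GL (Fin 2) F} {d : F} (hd : d ^ 4 ≠ 1)
    (hD : D.val = matY d) (h : Commute (mk M) (mk D ^ 2)) : Commute (mk M) (mk D) := by
  rw [← map_pow] at h
  obtain ⟨h01, h10⟩ := eq_zero_of_commute_diagonal (e := d ^ 2) (by rwa [← pow_mul]) (by
    rw [Units.val_pow_eq_pow_val, hD, sq, matY, matY, mul_fin_two]
    simp [sq]) h
  refine Commute.map (f := mk) (Units.ext ?_)
  rw [Units.val_mul, Units.val_mul, hD, matY]
  ext i j
  fin_cases i <;> fin_cases j <;> simp [Matrix.mul_apply, h01, h10, mul_comm]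

theorem center_eq_bot {d : F} (hd0 : d ≠ 0) (hd : d ^ 2 ≠ 1) : Subgroup.center PGL(2, F) = ⊥ := by
  rw [eq_bot_iff]
  intro g hg
  induction g using induction_on with | mk M =>
  rw [Subgroup.mem_center_iff] at hg
  have h := eq_zero_of_commute_diagonal (M := M)
    (D := GeneralLinearGroup.mkOfDetNeZero (matY d) (by simpa [matY] using hd0)) hd rfl
    (hg _).symm
  let U : GL (Fin 2) F := GeneralLinearGroup.mkOfDetNeZero !![1, 1; 0, 1] (by simp)
  have h' := eq_of_mk_mul_upper (U := U) (V := U) one_ne_zero rfl rfl (hg (mk U)).symm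
  rw [mul_one, one_mul] at h'
  rw [Subgroup.mem_bot, mk_eq_one_iff_fin_two]
  exact ⟨h.1, h.2, h'.2⟩

/-- The character of `PGL(2, F)` given by the quadratic character of the determinant. -/
noncomputable def quadraticSign (F : Type*) [Field F] [Fintype F] [DecidableEq F] :
    PGL(2, F) →* ℤˣ :=
  lift ((quadraticChar F).toUnitHom.comp GeneralLinearGroup.det) (by
    ext u
    simp)

theorem quadraticSign_mk_eq_neg_one [Fintype F] [DecidableEq F] {g : GL (Fin 2) F} :
    quadraticSign F (mk g) = -1 ↔ ¬ IsSquare g.val.det := by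
  rw [quadraticSign, lift_mk, ← quadraticChar_neg_one_iff_not_isSquare, Units.ext_iff]
  simp

theorem ker_quadraticSign [Fintype F] [DecidableEq F] :
    (quadraticSign F).ker = subgroupL2 F := by
  ext g
  induction g using induction_on with | mk g =>
  rw [mk_mem_subgroupL2, MonoidHom.mem_ker]
  rcases Int.units_eq_one_or (quadraticSign F (mk g)) with h | h
  · simp only [h, true_iff]
    by_contra hs
    rw [← quadraticSign_mk_eq_neg_one, h] at hs
    exact absurd hs (by decide)
  · exact iff_of_false (by rw [h]; decide) (quadraticSign_mk_eq_neg_one.1 h)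

end Field

section ZMod

variable {p : ℕ} [Fact p.Prime]

theorem index_subgroupL2 (hp : p ≠ 2) : (subgroupL2 (ZMod p)).index = 2 := by
  obtain ⟨d, hd⟩ := FiniteField.exists_nonsquare (F := ZMod p) (by rwa [ZMod.ringChar_zmod_n])
  have hd0 : d ≠ 0 := fun h => hd (by rw [h]; exact IsSquare.zero)
  rw [← ker_quadraticSign]
  refine MonoidHom.index_ker_of_sign _
    (w := mk (GeneralLinearGroup.mkOfDetNeZero (matY d) (by simpa [matY] using hd0))) ?_
  rw [quadraticSign_mk_eq_neg_one]
  simpa [GeneralLinearGroup.mkOfDetNeZero, matY] using hd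

/-- A subgroup of index two contains all squares, and for odd p the square of a non-trivial
transvection is a non-trivial transvection. -/
theorem subgroupL2_le_of_index_eq_two (hp : p ≠ 2) {S : Subgroup PGL(2, ZMod p)} (hS : S.index = 2) :
    subgroupL2 (ZMod p) ≤ S := by
  have h2 : (2 : ZMod p) ≠ 0 := Ring.two_ne_zero (by rwa [ZMod.ringChar_zmod_n])
  let U : GL (Fin 2) (ZMod p) := GeneralLinearGroup.mkOfDetNeZero !![1, 1; 0, 1] (by simp)
  let L : GL (Fin 2) (ZMod p) := GeneralLinearGroup.mkOfDetNeZero !![1, 0; 1, 1] (by simp)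
  have hU : U.val = !![1, 1; 0, 1] := rfl
  have hL : L.val = !![1, 0; 1, 1] := rfl
  refine subgroupL2_le_of_upper_of_lower h2 h2 (g := U ^ 2) (h := L ^ 2) ?_ ?_ ?_ ?_
  · rw [Units.val_pow_eq_pow_val, hU, upper_pow, mul_one, Nat.cast_two]
  · rw [Units.val_pow_eq_pow_val, hL, lower_pow, mul_one, Nat.cast_two]
  · rw [map_pow]
    exact Subgroup.sq_mem_of_index_two hS _
  · rw [map_pow]
    exact Subgroup.sq_mem_of_index_two hS _

theorem index_eq_two_iff (hp : p ≠ 2) (S : Subgroup PGL(2, ZMod p)) :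
    S.index = 2 ↔ S = subgroupL2 (ZMod p) := by
  constructor
  · intro hS
    have hle := subgroupL2_le_of_index_eq_two hp hS
    refine le_antisymm ?_ hle
    have h := Subgroup.relIndex_mul_index hle
    rw [hS, index_subgroupL2 hp] at h
    rw [← Subgroup.relIndex_eq_one]
    omega
  · rintro rfl
    exact index_subgroupL2 hp

/-- If g^p is the scalar c, then c^p = c and f = c⁻¹g satisfies f^p = 1. Hence (f − 1)^p = 0, which
gives the fixed vector, and det f = (det f)^p = 1. -/
theorem exists_fixed_vector {q : PGL(2, ZMod p)} (hq : orderOf q = p) :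
    ∃ f : GL (Fin 2) (ZMod p), mk f = q ∧ f ≠ 1 ∧ f.val.det = 1 ∧ ∃ v ≠ 0, f.val *ᵥ v = v := by
  have hp1 : p ≠ 1 := (Fact.out : p.Prime).ne_one
  induction q using induction_on with | mk g =>
  have hgp : mk (g ^ p) = 1 := by
    rw [map_pow, ← orderOf_dvd_iff_pow_eq_one, hq]
  rw [← map_one mk, eq_comm, mk_eq_mk_iff] at hgp
  obtain ⟨c, hc⟩ := hgp
  rw [one_mul] at hc
  set f := g * GeneralLinearGroup.scalar (Fin 2) c⁻¹ with hf
  have hfg : mk f = mk g := by rw [hf, map_mul, mk_scalar, mul_one]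
  have hfp : f ^ p = 1 := by
    have hcp : c ^ p = c := Units.ext (by rw [Units.val_pow_eq_pow_val, ZMod.pow_card])
    have hcomm : Commute g (GeneralLinearGroup.scalar (Fin 2) c⁻¹) :=
      (GeneralLinearGroup.scalar_commute _ _).symm
    rw [hf, hcomm.mul_pow, ← hc, ← map_pow, inv_pow, hcp, ← map_mul, mul_inv_cancel, map_one]
  have hfp' : f.val ^ p = 1 := by rw [← Units.val_pow_eq_pow_val, hfp, Units.val_one]
  have hf1 : f ≠ 1 := fun h => hp1 (by rw [← hq, ← hfg, h, map_one, orderOf_one])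
  refine ⟨f, hfg, hf1, ?_, ?_⟩
  · rw [← ZMod.pow_card f.val.det, ← det_pow, hfp', det_one]
  · have h0 : (f.val - 1).det = 0 := by
      have h : (f.val - 1) ^ p = 0 := by
        rw [sub_pow_char_of_commute p (Commute.one_right _), hfp', one_pow, sub_self]
      have h' := congrArg det h
      rw [det_pow, det_zero] at h'
      exact pow_eq_zero_iff (Fact.out : p.Prime).ne_zero |>.1 h'
    obtain ⟨v, hv, hfv⟩ := exists_mulVec_eq_zero_iff.2 h0
    refine ⟨v, hv, ?_⟩
    rwa [sub_mulVec, one_mulVec, sub_eq_zero] at hfv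

end ZMod

end Matrix.ProjGenLinGroup

/-! ### Generation of `PGL(2, p)` -/

namespace Matrix.ProjGenLinGroup

open scoped OnePoint

variable {p : ℕ} [Fact p.Prime]

/-- Cauchy's theorem gives a transvection. If its axis is a coordinate axis, X moves it because b
and c are non-zero; otherwise Y does because d ≠ 1. -/
theorem subgroupL2_le_of_dvd_card {S : Subgroup PGL(2, ZMod p)} {X Y : GL (Fin 2) (ZMod p)}
    {a b c d : ZMod p} (hX : X.val = matX a b c) (hY : Y.val = matY d) (hb : b ≠ 0) (hc : c ≠ 0)
    (hd : d ≠ 1) (hXS : mk X ∈ S) (hYS : mk Y ∈ S) (hdvd : p ∣ Nat.card S) :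
    subgroupL2 (ZMod p) ≤ S := by
  obtain ⟨q, hq⟩ := exists_prime_orderOf_dvd_card' p hdvd
  rw [← Subgroup.orderOf_coe] at hq
  obtain ⟨f, hfq, hf1, hfd, v, hv, hfv⟩ := exists_fixed_vector hq
  have hfS : mk f ∈ S := hfq ▸ q.2
  by_cases h1 : v 1 = 0
  · have h0 : v 0 ≠ 0 := fun h0 => hv (by ext i; fin_cases i <;> simp [h0, h1])
    exact subgroupL2_le_of_transvection hf1 hfd hfS hXS hfv (by simp [hX, matX, vecHead, vecTail, h0, h1, hc])
  · by_cases h0 : v 0 = 0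
    · exact subgroupL2_le_of_transvection hf1 hfd hfS hXS hfv (by simp [hX, matX, vecHead, vecTail, h0, h1, hb])
    · refine subgroupL2_le_of_transvection hf1 hfd hfS hYS hfv ?_
      have h : v 0 * v 1 - d * v 0 * v 1 = (1 - d) * (v 0 * v 1) := by ring
      have hY' : v 0 * (Y.val *ᵥ v) 1 - (Y.val *ᵥ v) 0 * v 1 = v 0 * v 1 - d * v 0 * v 1 := by
        simp [hY, matY, vecHead, vecTail]
      rw [hY', h]
      exact mul_ne_zero (sub_ne_zero.2 hd.symm) (mul_ne_zero h0 h1)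

/-- The fixed-point count needs an algebraically closed field, so S is mapped there. The image of ∞
under X is a/c, which Y moves since a ≠ 0 and d ≠ 1. -/
theorem dvd_card_of_mem_of_mem (hp : p ≠ 2) {S : Subgroup PGL(2, ZMod p)}
    {X Y : GL (Fin 2) (ZMod p)} {a b c d : ZMod p} (hX : X.val = matX a b c) (hY : Y.val = matY d)
    (ha : a ≠ 0) (hc : c ≠ 0) (hd : d ≠ 1) (hY6 : 6 ≤ orderOf (mk Y)) (hXS : mk X ∈ S)
    (hYS : mk Y ∈ S) : p ∣ Nat.card S := by
  let f := algebraMap (ZMod p) (AlgebraicClosure (ZMod p))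
  have hf : Function.Injective f := f.injective
  have : CharP (AlgebraicClosure (ZMod p)) p := charP_of_injective_algebraMap hf p
  have : Finite (S.map (map (n := Fin 2) f)) :=
    ((S : Set PGL(2, ZMod p)).toFinite.image (map f)).to_subtype
  have hX' : (GeneralLinearGroup.map f X).val = !![f a, f b; f c, -f a] := by
    ext i j
    fin_cases i <;> fin_cases j <;> simp [hX, matX]
  have hY' : (GeneralLinearGroup.map f Y).val = !![f d, 0; 0, 1] := by
    ext i j
    fin_cases i <;> fin_cases j <;> simp [hY, matY]
  refine (dvd_card_of_mem p hp (S.map (map f)) (X := GeneralLinearGroup.map f X)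
    (Y := GeneralLinearGroup.map f Y) ⟨_, hXS, map_mk f X⟩ ⟨_, hYS, map_mk f Y⟩ ?_ ?_ ?_ ?_).trans
    (S.card_map_dvd _)
  · rw [hY']; simp
  · rwa [← map_mk, orderOf_injective _ (map_injective hf)]
  · rw [hX']
    simpa using (map_ne_zero f).2 hc
  · have hc' : f c ≠ 0 := (map_ne_zero f).2 hc
    rw [mk_smul_infty (by rw [hX']; simpa using hc'), Ne, mk_smul_coe_eq_iff, hX', hY']
    have : 1 - f d ≠ 0 := by
      rw [← map_one f, ← map_sub, map_ne_zero, sub_ne_zero]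
      exact hd.symm
    simp [this, hc', ha]

theorem closure_eq_top (hp : p ≠ 2) {X Y Z : GL (Fin 2) (ZMod p)} {a b c d : ZMod p}
    (hX : X.val = matX a b c) (hY : Y.val = matY d) (ha : a ≠ 0) (hb : b ≠ 0) (hc : c ≠ 0)
    (hd : ¬ IsSquare d) (hY6 : 6 ≤ orderOf (mk Y)) :
    Subgroup.closure {mk X, mk Y, mk Z} = ⊤ := by
  set S : Subgroup PGL(2, ZMod p) := Subgroup.closure {mk X, mk Y, mk Z}
  have hXS : mk X ∈ S := Subgroup.subset_closure (by simp)
  have hYS : mk Y ∈ S := Subgroup.subset_closure (by simp)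
  have hd1 : d ≠ 1 := fun h => hd (by rw [h]; exact IsSquare.one)
  have hle := subgroupL2_le_of_dvd_card hX hY hb hc hd1 hXS hYS
    (dvd_card_of_mem_of_mem hp hX hY ha hc hd1 hY6 hXS hYS)
  have hYL : mk Y ∉ subgroupL2 (ZMod p) := by
    rw [mk_mem_subgroupL2, hY]
    simpa [matY] using hd
  have h := Subgroup.relIndex_mul_index hle
  rw [index_subgroupL2 hp] at h
  rw [← Subgroup.index_eq_one]
  have h1 : (subgroupL2 (ZMod p)).relIndex S ≠ 1 := fun h1 =>
    hYL (Subgroup.relIndex_eq_one.1 h1 hYS)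
  have h2 : S.index ∣ 2 := Dvd.intro_left _ h
  rcases (Nat.dvd_prime Nat.prime_two).1 h2 with h3 | h3
  · exact h3
  · rw [h3] at h
    omega

/-- An automorphism of `PGL(2, p)` preserves the ratio of the squared trace and the determinant of
a diagonal element. -/
theorem trace_sq_mul_eq_of_mulEquiv {Y Z : GL (Fin 2) (ZMod p)} {d : ZMod p}
    (hY : Y.val = matY d) (σ : PGL(2, ZMod p) ≃* PGL(2, ZMod p)) (hσ : σ (mk Y) = mk Z) :
    Z.val.trace ^ 2 * d = Z.val.det * (d + 1) ^ 2 := by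
  let U : GL (Fin 2) (ZMod p) := GeneralLinearGroup.mkOfDetNeZero !![1, 1; 0, 1] (by simp)
  have hU : U.val = !![1, 1; 0, 1] := rfl
  have hUp : orderOf (mk U) = p := by
    refine orderOf_eq_prime ?_ ?_
    · rw [← map_pow]
      rw [show U ^ p = 1 from Units.ext (by
        rw [Units.val_pow_eq_pow_val, hU, upper_pow, CharP.cast_eq_zero, zero_mul, ← one_fin_two,
          Units.val_one]), map_one]
    · rw [Ne, mk_eq_one_iff_fin_two, hU]
      simp
  -- This relation determines d, and σ carries it to one for Z and an element of order p, which is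
  -- again unipotent. In a basis starting with its fixed vector Z is triangular with diagonal
  -- entries in ratio d, so the classification of automorphisms is not needed.
  have hYU : mk Y * mk U = mk U ^ d.val * mk Y := by
    rw [← map_pow, ← map_mul, ← map_mul]
    refine congrArg mk (Units.ext ?_)
    rw [Units.val_mul, Units.val_mul, Units.val_pow_eq_pow_val, hU, upper_pow, mul_one,
      ZMod.natCast_zmod_val, hY, matY]
    simp
  obtain ⟨f, hf, hf1, hfd, v, hv, hfv⟩ := exists_fixed_vector
    (q := σ (mk U)) (by rw [MulEquiv.orderOf_eq, hUp])
  have hZf : mk Z * mk f = mk f ^ d.val * mk Z := by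
    rw [← hσ, hf, ← map_mul, hYU, map_mul, map_pow]
  obtain ⟨w, hw⟩ : ∃ w : Fin 2 → ZMod p, v 0 * w 1 - w 0 * v 1 ≠ 0 := by
    by_cases h0 : v 0 = 0
    · refine ⟨![1, 0], fun h1 => hv ?_⟩
      ext i
      fin_cases i
      · exact h0
      · simpa using h1
    · exact ⟨![0, 1], by simpa using h0⟩
  let P : GL (Fin 2) (ZMod p) := GeneralLinearGroup.mkOfDetNeZero !![v 0, w 0; v 1, w 1]
    (by rwa [det_fin_two_of])
  have hPv : P.val *ᵥ ![1, 0] = v := by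
    ext i
    fin_cases i <;> simp [P, GeneralLinearGroup.mkOfDetNeZero]
  have hdet : ∀ f : GL (Fin 2) (ZMod p), (P⁻¹ * f * P).val.det = f.val.det := fun f => by
    rw [Units.val_mul, Units.val_mul, det_mul, det_mul, mul_right_comm, ← det_mul, Units.inv_mul,
      det_one, one_mul]
  set s := (P⁻¹ * f * P).val 0 1 with hs
  have hfP : (P⁻¹ * f * P).val = !![1, s; 0, 1] := by
    refine eq_upper ((hdet f).trans hfd) ?_
    rw [Units.val_mul, Units.val_mul, ← mulVec_mulVec, hPv, ← mulVec_mulVec, hfv, ← hPv,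
      mulVec_mulVec, Units.inv_mul, one_mulVec]
  have hs0 : s ≠ 0 := fun h => hf1 (by
    rw [h, ← one_fin_two, ← Units.val_one, ← Units.ext_iff] at hfP
    rwa [mul_assoc, inv_mul_eq_one, right_eq_mul] at hfP)
  have key := eq_of_mk_mul_upper (M := P⁻¹ * Z * P) (U := P⁻¹ * f * P)
    (V := (P⁻¹ * f * P) ^ d.val) (t := d * s) hs0 hfP (by
      rw [Units.val_pow_eq_pow_val, hfP, upper_pow, ZMod.natCast_zmod_val]) (by
      have e : ∀ g : PGL(2, ZMod p), ((mk P)⁻¹ * g * mk P) ^ d.val = (mk P)⁻¹ * g ^ d.val * mk P :=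
        fun g => by simpa using (conj_pow (a := (mk P)⁻¹) (b := g) (i := d.val))
      simp only [map_mul, map_pow, map_inv, e]
      calc _ = (mk P)⁻¹ * (mk Z * mk f) * mk P := by group
        _ = _ := by rw [hZf]; group)
  have h00 : (P⁻¹ * Z * P).val 0 0 = d * (P⁻¹ * Z * P).val 1 1 :=
    mul_right_cancel₀ hs0 (key.2.trans (by ring))
  have htr : (P⁻¹ * Z * P).val.trace = Z.val.trace := by
    rw [Units.val_mul, Units.val_mul]
    exact trace_units_conj' P Z.val
  rw [← htr, ← hdet Z, trace_fin_two, det_fin_two, h00, key.1]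
  ring

end Matrix.ProjGenLinGroup

/-! ### Elements of order `2 n` in the prime field -/

namespace ZMod

theorem eq_of_modEq {p n : ℕ} (hn : 3 ≤ n) (hp : p ≡ 2 * n + 1 [MOD 4 * n]) :
    ∃ k, p = 4 * n * k + (2 * n + 1) := by
  refine ⟨p / (4 * n), ?_⟩
  have h : p % (4 * n) = 2 * n + 1 := by
    rw [hp, Nat.mod_eq_of_lt]
    omega
  rw [← h, Nat.div_add_mod]

theorem ne_two_of_modEq {p n : ℕ} (hn : 3 ≤ n) (hp : p ≡ 2 * n + 1 [MOD 4 * n]) : p ≠ 2 := by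
  obtain ⟨k, hk⟩ := eq_of_modEq hn hp
  omega

variable {p : ℕ} [Fact p.Prime] {n : ℕ} {d : ZMod p}

theorem ne_zero_of_orderOf (hn : 3 ≤ n) (hd : orderOf d = 2 * n) : d ≠ 0 := by
  rintro rfl
  have h := pow_orderOf_eq_one (0 : ZMod p)
  rw [hd, zero_pow (by omega)] at h
  exact zero_ne_one h

theorem zpow_eq_one_iff_of_orderOf (hn : 3 ≤ n) (hd : orderOf d = 2 * n) (m : ℤ) :
    d ^ m = 1 ↔ (2 * n : ℤ) ∣ m := by
  obtain ⟨u, rfl⟩ := (ne_zero_of_orderOf hn hd).isUnit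
  rw [orderOf_units] at hd
  rw [← Units.val_zpow_eq_zpow_val, Units.val_eq_one, ← orderOf_dvd_iff_zpow_eq_one, hd]
  norm_num

theorem pow_eq_neg_one_of_orderOf (hn : 3 ≤ n) (hd : orderOf d = 2 * n) : d ^ n = -1 := by
  have h1 : d ^ n ≠ 1 := fun h => by
    have := Nat.le_of_dvd (by omega) (orderOf_dvd_of_pow_eq_one h)
    omega
  have h2 : (d ^ n - 1) * (d ^ n + 1) = 0 := by
    have := pow_orderOf_eq_one d
    rw [hd] at this
    linear_combination this
  exact eq_neg_of_add_eq_zero_left ((mul_eq_zero.1 h2).resolve_left (sub_ne_zero.2 h1))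

theorem pow_ne_one_of_orderOf (hn : 3 ≤ n) (hd : orderOf d = 2 * n) {m : ℕ} (hm : 0 < m)
    (hm' : m < 6) : d ^ m ≠ 1 := fun h => by
  have := Nat.le_of_dvd hm (orderOf_dvd_of_pow_eq_one h)
  omega

/-- Here p − 1 = 2n(2k + 1), so d = r² would give r^(p−1) = d^(n(2k+1)) = (−1)^(2k+1) = −1. -/
theorem not_isSquare_of_orderOf (hn : 3 ≤ n) (hp : p ≡ 2 * n + 1 [MOD 4 * n])
    (hd : orderOf d = 2 * n) : ¬ IsSquare d := by
  rintro ⟨r, rfl⟩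
  obtain ⟨k, hk⟩ := eq_of_modEq hn hp
  have hr : r ≠ 0 := fun h => ne_zero_of_orderOf hn hd (by rw [h, zero_mul])
  have h1 := pow_card_sub_one_eq_one hr
  have h2 := pow_orderOf_eq_one (r * r)
  have h3 := pow_eq_neg_one_of_orderOf hn hd
  rw [hd, ← sq, ← pow_mul] at h2
  rw [← sq, ← pow_mul] at h3
  have e : p - 1 = 2 * (2 * n) * k + 2 * n := by
    have : 2 * (2 * n) * k = 4 * n * k := by ring
    omega
  rw [e, pow_add, pow_mul, h2, one_pow, one_mul, h3] at h1
  have h2 : (2 : ZMod p) ≠ 0 :=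
    Ring.two_ne_zero (by rw [ringChar_zmod_n]; exact ne_two_of_modEq hn hp)
  exact h2 (by linear_combination -h1)

theorem exists_orderOf_eq (hn : 3 ≤ n) (hp : p ≡ 2 * n + 1 [MOD 4 * n]) :
    ∃ d : ZMod p, orderOf d = 2 * n := by
  obtain ⟨k, hk⟩ := eq_of_modEq hn hp
  obtain ⟨g, hg⟩ := IsCyclic.exists_ofOrder_eq_natCard (α := (ZMod p)ˣ)
  rw [Nat.card_eq_fintype_card, card_units] at hg
  refine ⟨((g ^ (2 * k + 1) : (ZMod p)ˣ) : ZMod p), ?_⟩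
  have e : p - 1 = (2 * k + 1) * (2 * n) := by
    have : (2 * k + 1) * (2 * n) = 4 * n * k + 2 * n := by ring
    omega
  rw [orderOf_units, orderOf_pow_of_dvd (by omega) (by rw [hg, e]; exact dvd_mul_right _ _), hg, e,
    Nat.mul_div_cancel_left _ (by omega)]

end ZMod

/-! ### The triples `x, y, z` in `PGL(2, p)` -/

namespace Matrix.ProjGenLinGroup

variable {p : ℕ} [Fact p.Prime] {n : ℕ} {a b c d : ZMod p} {X Y Z : GL (Fin 2) (ZMod p)}

theorem val_eq_matZ (hd0 : d ≠ 0) (habc : a ^ 2 + b * c + 1 = 0) (hX : X.val = matX a b c)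
    (hY : Y.val = matY d) (hZ : Z = (X * Y)⁻¹) : Z.val = matZ a b c d := by
  rw [hZ]
  refine Units.inv_eq_of_mul_eq_one_right ?_
  rw [Units.val_mul, hX, hY, matX, matY, matZ, mul_fin_two, mul_fin_two, one_fin_two]
  ext i j
  fin_cases i <;> fin_cases j <;> simp <;> field_simp <;>
    first | ring1 | linear_combination -habc

theorem mk_mem_subgroupL2_of_matX (habc : a ^ 2 + b * c + 1 = 0) (hX : X.val = matX a b c) :
    mk X ∈ subgroupL2 (ZMod p) := by
  rw [mk_mem_subgroupL2, hX]
  exact ⟨1, by rw [matX, det_fin_two_of]; linear_combination -habc⟩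

theorem orderOf_mk_of_matX (hp : p ≠ 2) (habc : a ^ 2 + b * c + 1 = 0) (hX : X.val = matX a b c) :
    orderOf (mk X) = 2 := by
  have h2 : (2 : ZMod p) ≠ 0 := Ring.two_ne_zero (by rwa [ZMod.ringChar_zmod_n])
  refine orderOf_eq_prime ?_ ?_
  · rw [← map_pow, mk_eq_one_iff_fin_two, Units.val_pow_eq_pow_val, hX, matX, sq, mul_fin_two]
    simp
    refine ⟨?_, ?_, ?_⟩ <;> ring
  · rw [Ne, mk_eq_one_iff_fin_two, hX, matX]
    simp only [of_apply, cons_val', cons_val_zero, cons_val_one, cons_val_fin_one]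
    rintro ⟨hb, hc, ha⟩
    have ha0 : a = 0 := (mul_eq_zero.1 (by linear_combination ha : 2 * a = 0)).resolve_left h2
    rw [ha0, hb] at habc
    simp at habc

theorem mk_notMem_subgroupL2_of_matY (hd : ¬ IsSquare d) (hY : Y.val = matY d) :
    mk Y ∉ subgroupL2 (ZMod p) := by
  rw [mk_mem_subgroupL2, hY]
  simpa [matY] using hd

theorem orderOf_mk_of_matY (hd1 : d ≠ 1) (hY : Y.val = matY d) : orderOf (mk Y) = orderOf d := by
  rw [orderOf_mk (α := d) (β := 1) (by simp [hY, matY]) (by simp [hY, matY]) hd1, div_one]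

/-- Common to both cases, with j = 2k + 1 and k = 0 in the first. As det Z = d⁻¹, the trace makes
d^k and d^(−k−1) the eigenvalues; their ratio d^(2k+1) has order 2n because 2k + 1 is prime to 2n.
-/
theorem exists_isDessinPair_of_trace (hn : 3 ≤ n) (hp : p ≡ 2 * n + 1 [MOD 4 * n])
    (hd : orderOf d = 2 * n) (habc : a ^ 2 + b * c + 1 = 0) (hX : X.val = matX a b c)
    (hY : Y.val = matY d) (hZ : Z = (X * Y)⁻¹) (ha : a ^ 2 ≠ -1) {k : ℤ}
    (hk : IsCoprime (2 * k + 1) (2 * n : ℤ)) (htr : a - a / d = d ^ k + d ^ (-k - 1)) :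
    IsGeneratingTriple n (mk X) (mk Y) (mk Z) ∧
      ∃ H₁ H₂ : Hypermap PGL(2, ZMod p), IsDessinPair n (mk X) (mk Y) (mk Z) H₁ H₂ ∧
        (H₁.Iso H₂ ↔ HasSwap (mk Y) (mk Z)) ∧
        ∀ g : ℕ, n * Nat.card PGL(2, ZMod p) + 2 * n = 2 * Nat.card PGL(2, ZMod p) + 2 * n * g →
          H₁.HasGenus g ∧ H₂.HasGenus g := by
  have hp2 := ZMod.ne_two_of_modEq hn hp
  have hd0 := ZMod.ne_zero_of_orderOf hn hd
  have hsq := ZMod.not_isSquare_of_orderOf hn hp hd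
  have hd1 : d ≠ 1 := by simpa using ZMod.pow_ne_one_of_orderOf hn hd one_pos (by norm_num)
  have hZv := val_eq_matZ hd0 habc hX hY hZ
  have hbc : b * c ≠ 0 := fun h => ha (by linear_combination habc - h)
  have hord : ∀ m : ℤ, d ^ ((2 * k + 1) * m) = 1 ↔ d ^ m = 1 := fun m => by
    rw [ZMod.zpow_eq_one_iff_of_orderOf hn hd, ZMod.zpow_eq_one_iff_of_orderOf hn hd]
    exact ⟨hk.symm.dvd_of_dvd_mul_left, fun h => h.mul_left _⟩
  have hk1 : d ^ (2 * k + 1) ≠ 1 := fun h => hd1 (by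
    have := (hord 1).1 (by rwa [mul_one])
    rwa [zpow_one] at this)
  have hkk : d ^ k = d ^ (2 * k + 1) * d ^ (-k - 1) := by
    rw [← zpow_add₀ hd0]
    congr 1
    ring
  have hk0 : d ^ (-k - 1) ≠ 0 := zpow_ne_zero _ hd0
  -- If a = 0 then Z has trace zero and its eigenvalue ratio d^(2k+1) is −1, of order two instead of
  -- 2n.
  have ha0 : a ≠ 0 := fun h => by
    rw [h, zero_div, sub_zero, hkk] at htr
    have h1 : d ^ (2 * k + 1) = -1 := mul_right_cancel₀ hk0 (by linear_combination -htr)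
    have h2 : d ^ ((2 * k + 1) * 2) = 1 := by
      rw [_root_.zpow_mul d, h1]
      norm_num
    exact ZMod.pow_ne_one_of_orderOf hn hd (m := 2) two_pos (by norm_num)
      (by exact_mod_cast (hord 2).1 h2)
  have hYo : orderOf (mk Y) = 2 * n := (orderOf_mk_of_matY hd1 hY).trans hd
  have hZo : orderOf (mk Z) = 2 * n := by
    rw [orderOf_mk (α := d ^ k) (β := d ^ (-k - 1)), hkk, mul_div_cancel_right₀ _ hk0, ← hd,
      orderOf_eq_orderOf_iff]
    · intro m
      have := hord m
      rwa [_root_.zpow_mul d, zpow_natCast, zpow_natCast] at this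
    · rw [hZv, matZ, trace_fin_two_of, ← htr]
      ring
    · rw [hZv, matZ, det_fin_two_of, ← zpow_add₀ hd0]
      have : k + (-k - 1) = -1 := by ring
      rw [this, _root_.zpow_neg_one d]
      field_simp
      linear_combination -habc
    · rw [hkk]
      intro h
      exact hk1 (mul_right_cancel₀ hk0 (by rw [h, one_mul]))
  have hxyz : mk X * mk Y * mk Z = 1 := by
    rw [hZ, map_inv, map_mul, mul_inv_cancel]
  have hXo := orderOf_mk_of_matX hp2 habc hX
  have hgen := closure_eq_top hp2 (Z := Z) hX hY ha0 (left_ne_zero_of_mul hbc)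
    (right_ne_zero_of_mul hbc) hsq (by omega)
  have htriple : IsGeneratingTriple n (mk X) (mk Y) (mk Z) := ⟨hxyz, hXo, hYo, hZo, hgen⟩
  have hYL := mk_notMem_subgroupL2_of_matY hsq hY
  have hXL := mk_mem_subgroupL2_of_matX habc hX
  have hχX : quadraticSign (ZMod p) (mk X) = 1 := by
    rwa [← MonoidHom.mem_ker, ker_quadraticSign]
  have hχY : quadraticSign (ZMod p) (mk Y) = -1 := by
    rw [quadraticSign_mk_eq_neg_one, hY]
    simpa [matY] using hsq
  have hχZ : quadraticSign (ZMod p) (mk Z) = -1 := by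
    have h := congrArg (quadraticSign (ZMod p)) hxyz
    rw [map_mul, map_mul, hχX, hχY, map_one, one_mul] at h
    rw [← mul_right_inj (-1 : ℤˣ), h]
    rfl
  have hZL : mk Z ∉ subgroupL2 (ZMod p) := by
    rw [← ker_quadraticSign, MonoidHom.mem_ker, hχZ]
    decide
  have hX1 : mk X = (mk Y * mk Z)⁻¹ := eq_inv_of_mul_eq_one_left (by rwa [← mul_assoc])
  have hX2 : mk X * mk X = 1 := by
    have h := pow_orderOf_eq_one (mk X)
    rwa [hXo, sq] at h
  have hyz : mk Y * mk Z * (mk Y * mk Z) = 1 := by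
    rw [hX1] at hX2
    have h := congrArg (·⁻¹) hX2
    simpa only [_root_.mul_inv_rev, inv_inv, inv_one] using h
  have hcl : Subgroup.closure {mk Y, mk Z} = ⊤ := by
    rw [eq_top_iff, ← hgen, Subgroup.closure_le]
    have hy : mk Y ∈ Subgroup.closure {mk Y, mk Z} := Subgroup.subset_closure (by simp)
    have hz : mk Z ∈ Subgroup.closure {mk Y, mk Z} := Subgroup.subset_closure (by simp)
    rintro g (rfl | rfl | rfl)
    · rw [hX1]
      exact inv_mem (mul_mem hy hz)
    · exact hy
    · exact hz
  refine ⟨htriple, exists_isDessinPair hn htriple (quadraticSign (ZMod p)) hχX hχY hχZ ?_ ?_ ?_ ?_⟩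
  · intro N hN hyN
    by_contra hNtop
    exact hYL ((index_eq_two_iff hp2 N).1 (hN.index_eq_two_of_mem hcl hyz hyN hNtop) ▸ hyN)
  · intro N hN hzN
    by_contra hNtop
    refine hZL ((index_eq_two_iff hp2 N).1 (hN.index_eq_two_of_mem (z := mk Y) ?_ ?_ hzN hNtop) ▸ hzN)
    · rwa [Set.pair_comm]
    · have : mk Z * mk Y * (mk Z * mk Y) = mk Z * (mk Y * mk Z * (mk Y * mk Z)) * (mk Z)⁻¹ := by
        group
      rw [this, hyz, mul_one, mul_inv_cancel]
  · intro g
    induction g using induction_on with | mk g =>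
    exact commute_of_commute_sq (ZMod.pow_ne_one_of_orderOf hn hd (by norm_num) (by norm_num)) hY
  · exact center_eq_bot hd0 (ZMod.pow_ne_one_of_orderOf hn hd (by norm_num) (by norm_num))

/-- The automorphism of `PGL(2, p)` transposing the two generators when `Z` has eigenvalue `1`. -/
theorem hasSwap_of_eq (hp : p ≠ 2) (hd0 : d ≠ 0) (hd1 : d ≠ 1) (habc : a ^ 2 + b * c + 1 = 0)
    (hY : Y.val = matY d) (hZ : Z.val = matZ a b c d) (ha : a = (d + 1) / (d - 1)) :
    HasSwap (mk Y) (mk Z) := by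
  have h2 : (2 : ZMod p) ≠ 0 := Ring.two_ne_zero (by rwa [ZMod.ringChar_zmod_n])
  rw [eq_div_iff (sub_ne_zero.2 hd1)] at ha
  -- The columns are eigenvectors of Z for 1 and d⁻¹, scaled so that P has trace a(d − 1) − (d + 1)
  -- = 0. Then P² is scalar, and conjugation by P, which takes y to z, also takes z to y.
  let P : GL (Fin 2) (ZMod p) := GeneralLinearGroup.mkOfDetNeZero
    !![-a - 1, -b; -(d * c), d * a - d] (by
      rw [det_fin_two_of]
      have : (-a - 1) * (d * a - d) - -b * -(d * c) = 2 * d := by linear_combination -d * habc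
      rw [this]
      exact mul_ne_zero h2 hd0)
  have hP : P.val = !![-a - 1, -b; -(d * c), d * a - d] := rfl
  have hs : (GeneralLinearGroup.scalar (Fin 2) (Units.mk0 d hd0)).val = !![d, 0; 0, d] := by
    ext i j
    fin_cases i <;> fin_cases j <;> simp
  obtain ⟨α, β, hα, hβ, hZ'⟩ : ∃ α β, d * α = -a ∧ d * β = -b ∧ Z.val = !![α, β; -c, a] :=
    ⟨-a / d, -b / d, mul_div_cancel₀ _ hd0, mul_div_cancel₀ _ hd0, hZ⟩
  have hext : ∀ {a b c d a' b' c' d' : ZMod p}, a = a' → b = b' → c = c' → d = d' →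
      !![a, b; c, d] = !![a', b'; c', d'] := by
    rintro _ _ _ _ _ _ _ _ rfl rfl rfl rfl
    rfl
  have h1 : mk (Z * P) = mk (P * Y) := mk_eq_mk_iff.2 ⟨Units.mk0 d hd0, Units.ext (by
    simp only [Units.val_mul, hP, hZ', hY, hs, matY, mul_fin_two]
    refine hext ?_ ?_ ?_ ?_
    · linear_combination (-a - 1) * hα - d * c * hβ + d * habc - a * ha
    · linear_combination -b * hα + (d * a - d) * hβ - b * ha
    · linear_combination -d * c * ha
    · linear_combination d * habc + d * a * ha)⟩
  have h3 : mk (P * Z) = mk (Y * P) := mk_eq_mk_iff.2 ⟨Units.mk0 d hd0, Units.ext (by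
    simp only [Units.val_mul, hP, hZ', hY, hs, matY, mul_fin_two]
    refine hext ?_ ?_ ?_ ?_
    · linear_combination (-a - 1) * hα + d * habc - a * ha
    · linear_combination (-a - 1) * hβ - b * ha
    · linear_combination -d * c * hα - d * c * ha
    · linear_combination -d * c * hβ + d * habc + d * a * ha)⟩
  rw [map_mul, map_mul] at h1 h3
  refine ⟨MulAut.conj (mk P), ?_, ?_⟩
  · rw [MulAut.conj_apply, ← h1, mul_inv_cancel_right]
  · rw [MulAut.conj_apply, h3, mul_inv_cancel_right]

/-- With e = d^k the invariance of trace²/det factors as (e² − 1)(e²d² − 1) = 0. For j = 2k + 1 the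
two factors mean j ≡ 1 and j ≡ −1. -/
theorem not_hasSwap_of_trace (hn : 3 ≤ n) (hd : orderOf d = 2 * n) (habc : a ^ 2 + b * c + 1 = 0)
    (hY : Y.val = matY d) (hZ : Z.val = matZ a b c d) {k : ℤ}
    (htr : a - a / d = d ^ k + d ^ (-k - 1)) (hk : ¬ (2 * n : ℤ) ∣ 2 * k)
    (hk' : ¬ (2 * n : ℤ) ∣ 2 * k + 2) : ¬ HasSwap (mk Y) (mk Z) := by
  rintro ⟨σ, hσ, -⟩
  have hd0 := ZMod.ne_zero_of_orderOf hn hd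
  have h := trace_sq_mul_eq_of_mulEquiv hY σ hσ
  rw [← ZMod.zpow_eq_one_iff_of_orderOf hn hd] at hk hk'
  have htrace : Z.val.trace = d ^ k + d ^ (-k - 1) := by
    rw [hZ, matZ, trace_fin_two_of, ← htr]
    ring
  have hdet : Z.val.det = d⁻¹ := by
    rw [hZ, matZ, det_fin_two_of]
    field_simp
    linear_combination -habc
  have hk1 : d ^ (-k - 1) = (d ^ k * d)⁻¹ := by
    rw [← zpow_add_one₀ hd0, ← _root_.zpow_neg d]
    congr 1
    ring
  rw [htrace, hdet, hk1] at h
  have he : d ^ k ≠ 0 := zpow_ne_zero _ hd0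
  rw [two_mul, zpow_add₀ hd0] at hk hk'
  rw [zpow_add₀ hd0, zpow_ofNat] at hk'
  generalize d ^ k = e at *
  field_simp at h
  have h' : (e * e - 1) * (e * e * d ^ 2 - 1) = 0 := by linear_combination h
  rcases mul_eq_zero.1 h' with h' | h'
  · exact hk (sub_eq_zero.1 h')
  · exact hk' (sub_eq_zero.1 h')

end Matrix.ProjGenLinGroup

/-- The determinant is d⁻¹ in every case, so prescribing the eigenvalues amounts to prescribing the
trace. -/
theorem charpoly_matZ_eq_iff {F : Type*} [Field F] {a b c d α β : F} (hd : d ≠ 0)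
    (habc : a ^ 2 + b * c + 1 = 0) (hαβ : α * β = d⁻¹) :
    (matZ a b c d).charpoly =
      (Polynomial.X - Polynomial.C α) * (Polynomial.X - Polynomial.C β) ↔ a - a / d = α + β := by
  have htr : (matZ a b c d).trace = a - a / d := by
    rw [matZ, Matrix.trace_fin_two_of]
    ring
  have hdet : (matZ a b c d).det = α * β := by
    rw [hαβ, matZ, Matrix.det_fin_two_of]
    field_simp
    linear_combination -habc
  have h : (Polynomial.X - Polynomial.C α) * (Polynomial.X - Polynomial.C β) =
      Polynomial.X ^ 2 - Polynomial.C (α + β) * Polynomial.X + Polynomial.C (α * β) := by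
    rw [map_add, map_mul]
    ring
  rw [Matrix.charpoly_fin_two, htr, hdet, h, add_left_inj, sub_right_inj]
  constructor
  · intro h
    simpa using congrArg (Polynomial.eval 1) h
  · intro h
    rw [h]

/-! ### The order of PGL(2, F) and the example with p = 17 -/

namespace Matrix.ProjGenLinGroup

theorem card_mul_card_units {F : Type*} [Field F] [Finite F] :
    Nat.card PGL(2, F) * Nat.card Fˣ = Nat.card (GL (Fin 2) F) := by
  have hinj : Function.Injective (GeneralLinearGroup.scalar (Fin 2) : Fˣ →* GL (Fin 2) F) := by
    intro u v huv
    have h : (GeneralLinearGroup.scalar (Fin 2) u) 0 0 = (GeneralLinearGroup.scalar (Fin 2) v) 0 0 := by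
      rw [huv]
    exact Units.ext (by simpa using h)
  have h : Nat.card Fˣ = Nat.card (Subgroup.center (GL (Fin 2) F)) := by
    rw [GeneralLinearGroup.center_eq_range_scalar]
    exact Nat.card_congr (MonoidHom.ofInjective hinj).toEquiv
  rw [h]
  exact (Subgroup.card_eq_card_quotient_mul_card_subgroup (Subgroup.center (GL (Fin 2) F))).symm

end Matrix.ProjGenLinGroup

theorem fact_prime_seventeen : Fact (Nat.Prime 17) := ⟨by norm_num⟩

section

attribute [local instance] fact_prime_seventeen

theorem isDessinPair_seventeen :
    (orderOf (3 : ZMod 17) = 16 ∧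
      (∀ X Y Z : GL (Fin 2) (ZMod 17),
        X.val = !![2, 3; 4, -2] → Y.val = !![3, 0; 0, 1] → Z = (X * Y)⁻¹ →
        Z.val = !![5, -1; -4, 2] ∧
        IsGeneratingTriple 8 (toPGL2 X) (toPGL2 Y) (toPGL2 Z) ∧
        ∃ H₁ H₂ : Hypermap PGL(2, ZMod 17),
          IsDessinPair 8 (toPGL2 X) (toPGL2 Y) (toPGL2 Z) H₁ H₂ ∧
          H₁.HasGenus 1837 ∧ H₂.HasGenus 1837 ∧ H₁.Iso H₂) ∧
      (∀ X Y Z : GL (Fin 2) (ZMod 17),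
        X.val = !![-1, 2; -1, 1] → Y.val = !![3, 0; 0, 1] → Z = (X * Y)⁻¹ →
        Z.val = !![6, 5; 1, -1] ∧
        IsGeneratingTriple 8 (toPGL2 X) (toPGL2 Y) (toPGL2 Z) ∧
        ∃ H₁ H₂ : Hypermap PGL(2, ZMod 17),
          IsDessinPair 8 (toPGL2 X) (toPGL2 Y) (toPGL2 Z) H₁ H₂ ∧
          H₁.HasGenus 1837 ∧ H₂.HasGenus 1837 ∧ ¬ H₁.Iso H₂)) := by
  have hn : 3 ≤ 8 := by norm_num
  have hp : 17 ≡ 2 * 8 + 1 [MOD 4 * 8] := rfl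
  have h3 : orderOf (3 : ZMod 17) = 2 ^ (3 + 1) :=
    orderOf_eq_prime_pow (by decide) (by decide)
  have hd : orderOf (3 : ZMod 17) = 2 * 8 := h3
  have hd0 : (3 : ZMod 17) ≠ 0 := by decide
  have hinv : (3 : ZMod 17)⁻¹ = 6 := inv_eq_of_mul_eq_one_right (by decide)
  have hcard : Nat.card PGL(2, ZMod 17) = 4896 := by
    have h := Matrix.ProjGenLinGroup.card_mul_card_units (F := ZMod 17)
    rw [Nat.card_eq_fintype_card (α := (ZMod 17)ˣ), ZMod.card_units, Matrix.card_GL_field] at h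
    simp [Fin.prod_univ_two, ZMod.card] at h
    omega
  refine ⟨h3, fun X Y Z hX hY hZ => ?_, fun X Y Z hX hY hZ => ?_⟩
  · have habc : (2 : ZMod 17) ^ 2 + 3 * 4 + 1 = 0 := by decide
    have hX' : X.val = matX 2 3 4 := hX
    have hY' : Y.val = matY 3 := hY
    have hZv := Matrix.ProjGenLinGroup.val_eq_matZ hd0 habc hX' hY' hZ
    obtain ⟨hgen, H₁, H₂, hpair, hiff, hg⟩ := Matrix.ProjGenLinGroup.exists_isDessinPair_of_trace (k := 0) hn hp hd habc
      hX' hY' hZ (by decide) (by simpa using isCoprime_one_left) (by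
        rw [neg_zero, zero_sub, zpow_neg_one, zpow_zero, div_eq_mul_inv, hinv]
        decide)
    have hg := hg 1837 (by rw [hcard])
    exact ⟨hZv.trans (by rw [matZ, div_eq_mul_inv, div_eq_mul_inv, hinv]; decide), hgen, H₁, H₂, hpair, hg.1, hg.2,
      hiff.2 (Matrix.ProjGenLinGroup.hasSwap_of_eq (by norm_num) hd0 (by decide) habc hY' hZv
        ((eq_div_iff (by decide)).2 (by decide)))⟩
  · have habc : (-1 : ZMod 17) ^ 2 + 2 * -1 + 1 = 0 := by decide
    have hX' : X.val = matX (-1) 2 (-1) := hX.trans (by decide)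
    have hY' : Y.val = matY 3 := hY
    have hZv := Matrix.ProjGenLinGroup.val_eq_matZ hd0 habc hX' hY' hZ
    have htr : (-1 : ZMod 17) - -1 / 3 = 3 ^ (1 : ℤ) + 3 ^ (-1 - 1 : ℤ) := by
      have h : (-1 - 1 : ℤ) = -(2 : ℕ) := by norm_num
      rw [h, zpow_neg, zpow_natCast, zpow_one, ← inv_pow, div_eq_mul_inv, hinv]
      decide
    obtain ⟨hgen, H₁, H₂, hpair, hiff, hg⟩ := Matrix.ProjGenLinGroup.exists_isDessinPair_of_trace (k := 1) hn hp hd habc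
      hX' hY' hZ (by decide) (by norm_num) htr
    have hg := hg 1837 (by rw [hcard])
    exact ⟨hZv.trans (by rw [matZ, div_eq_mul_inv, div_eq_mul_inv, hinv]; decide), hgen, H₁, H₂, hpair, hg.1, hg.2,
      hiff.not.2 (Matrix.ProjGenLinGroup.not_hasSwap_of_trace hn hd habc hY' hZv htr (by norm_num) (by norm_num))⟩

end
-- Assembly of the theorem
theorem mainTheorem4 :
    (∀ n : ℕ, 3 ≤ n →
      -- there are infinitely many such primes
      {p : ℕ | p.Prime ∧ p ≡ 2 * n + 1 [MOD 4 * n]}.Infinite ∧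
      ∀ (p : ℕ) [Fact p.Prime], p ≡ 2 * n + 1 [MOD 4 * n] →
        -- `L₂(p)` is the unique subgroup of index two
        (∀ S : Subgroup PGL(2, ZMod p), S.index = 2 ↔ S = subgroupL2 (ZMod p)) ∧
        (∃ d : ZMod p, orderOf d = 2 * n) ∧
        ∀ d : ZMod p, orderOf d = 2 * n →
          -- the triples
          (∀ (a b c : ZMod p) (X Y Z : GL (Fin 2) (ZMod p)),
            a ^ 2 + b * c + 1 = 0 →
            X.val = matX a b c → Y.val = matY d → Z = (X * Y)⁻¹ →
            Z.val = matZ a b c d ∧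
            toPGL2 X ∈ subgroupL2 (ZMod p) ∧ orderOf (toPGL2 X) = 2 ∧
            toPGL2 Y ∉ subgroupL2 (ZMod p) ∧ orderOf (toPGL2 Y) = 2 * n ∧
            -- first choice of `a`: the two dessins are isomorphic
            (a = (d + 1) / (d - 1) →
              IsGeneratingTriple n (toPGL2 X) (toPGL2 Y) (toPGL2 Z) ∧
              ∃ H₁ H₂ : Hypermap PGL(2, ZMod p),
                IsDessinPair n (toPGL2 X) (toPGL2 Y) (toPGL2 Z) H₁ H₂ ∧
                (H₁.Iso H₂ ↔ HasSwap (toPGL2 Y) (toPGL2 Z)) ∧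
                HasSwap (toPGL2 Y) (toPGL2 Z) ∧ H₁.Iso H₂) ∧
            -- other choices of `a`: the two dessins are not isomorphic
            (∀ j : ℤ, IsCoprime j (2 * n : ℤ) →
              ¬ j ≡ 1 [ZMOD 2 * n] → ¬ j ≡ -1 [ZMOD 2 * n] →
              a ^ 2 ≠ -1 →
              (matZ a b c d).charpoly =
                (Polynomial.X - Polynomial.C (d ^ ((j - 1) / 2))) *
                (Polynomial.X - Polynomial.C (d ^ ((-j - 1) / 2))) →
              IsGeneratingTriple n (toPGL2 X) (toPGL2 Y) (toPGL2 Z) ∧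
              ∃ H₁ H₂ : Hypermap PGL(2, ZMod p),
                IsDessinPair n (toPGL2 X) (toPGL2 Y) (toPGL2 Z) H₁ H₂ ∧
                (H₁.Iso H₂ ↔ HasSwap (toPGL2 Y) (toPGL2 Z)) ∧
                ¬ HasSwap (toPGL2 Y) (toPGL2 Z) ∧ ¬ H₁.Iso H₂)) ∧
          -- both choices of `a` are possible
          (∃ a b c : ZMod p, a ^ 2 + b * c + 1 = 0 ∧ a = (d + 1) / (d - 1)) ∧
          (∀ j : ℤ, IsCoprime j (2 * n : ℤ) →
            ¬ j ≡ n + 1 [ZMOD 2 * n] → ¬ j ≡ n - 1 [ZMOD 2 * n] →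
            ∃ a b c : ZMod p, a ^ 2 + b * c + 1 = 0 ∧ a ^ 2 ≠ -1 ∧
              (matZ a b c d).charpoly =
                (Polynomial.X - Polynomial.C (d ^ ((j - 1) / 2))) *
                (Polynomial.X - Polynomial.C (d ^ ((-j - 1) / 2))))) ∧
    -- the example `n = 8`, `p = 17`, `d = 3`
    (orderOf (3 : ZMod 17) = 16 ∧
      (∀ X Y Z : GL (Fin 2) (ZMod 17),
        X.val = !![2, 3; 4, -2] → Y.val = !![3, 0; 0, 1] → Z = (X * Y)⁻¹ →
        Z.val = !![5, -1; -4, 2] ∧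
        IsGeneratingTriple 8 (toPGL2 X) (toPGL2 Y) (toPGL2 Z) ∧
        ∃ H₁ H₂ : Hypermap PGL(2, ZMod 17),
          IsDessinPair 8 (toPGL2 X) (toPGL2 Y) (toPGL2 Z) H₁ H₂ ∧
          H₁.HasGenus 1837 ∧ H₂.HasGenus 1837 ∧ H₁.Iso H₂) ∧
      (∀ X Y Z : GL (Fin 2) (ZMod 17),
        X.val = !![-1, 2; -1, 1] → Y.val = !![3, 0; 0, 1] → Z = (X * Y)⁻¹ →
        Z.val = !![6, 5; 1, -1] ∧
        IsGeneratingTriple 8 (toPGL2 X) (toPGL2 Y) (toPGL2 Z) ∧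
        ∃ H₁ H₂ : Hypermap PGL(2, ZMod 17),
          IsDessinPair 8 (toPGL2 X) (toPGL2 Y) (toPGL2 Z) H₁ H₂ ∧
          H₁.HasGenus 1837 ∧ H₂.HasGenus 1837 ∧ ¬ H₁.Iso H₂)) := by
  refine ⟨fun n hn => ⟨?_, fun p _ hp => ?_⟩, ?_⟩
  · refine Nat.infinite_setOfPred_prime_and_modEq (by omega) ?_
    have h2 : Nat.Coprime (2 * n + 1) (2 * (2 * n)) := by
      refine Nat.Coprime.mul_right ?_ ?_
      · rw [Nat.coprime_two_right]
        exact ⟨n, rfl⟩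
      · simp
    rwa [← mul_assoc] at h2
  · have hp2 := ZMod.ne_two_of_modEq hn hp
    refine ⟨Matrix.ProjGenLinGroup.index_eq_two_iff hp2, ZMod.exists_orderOf_eq hn hp, fun d hd => ?_⟩
    have hd0 := ZMod.ne_zero_of_orderOf hn hd
    have hd1 : d ≠ 1 := by simpa using ZMod.pow_ne_one_of_orderOf hn hd one_pos (by norm_num)
    have hsq := ZMod.not_isSquare_of_orderOf hn hp hd
    have h2 : (2 : ZMod p) ≠ 0 := Ring.two_ne_zero (by rwa [ZMod.ringChar_zmod_n])
    have hprod : ∀ k : ℤ, d ^ k * d ^ (-k - 1) = d⁻¹ := fun k => by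
      rw [← zpow_add₀ hd0, ← zpow_neg_one]
      congr 1
      ring
    have hodd : ∀ j : ℤ, IsCoprime j (2 * n : ℤ) →
        ∃ k, j = 2 * k + 1 ∧ (j - 1) / 2 = k ∧ (-j - 1) / 2 = -k - 1 := fun j hj => by
      have h : IsCoprime j 2 := hj.of_mul_right_left
      rw [Int.isCoprime_iff_gcd_eq_one] at h
      have hj2 : ¬ 2 ∣ j := fun h' => by
        have := Int.dvd_coe_gcd h' (dvd_refl 2)
        rw [h] at this
        norm_num at this
      exact ⟨(j - 1) / 2, by omega, rfl, by omega⟩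
    refine ⟨fun a b c X Y Z habc hX hY hZ => ⟨Matrix.ProjGenLinGroup.val_eq_matZ hd0 habc hX hY hZ,
      Matrix.ProjGenLinGroup.mk_mem_subgroupL2_of_matX habc hX, Matrix.ProjGenLinGroup.orderOf_mk_of_matX hp2 habc hX,
      Matrix.ProjGenLinGroup.mk_notMem_subgroupL2_of_matY hsq hY, (Matrix.ProjGenLinGroup.orderOf_mk_of_matY hd1 hY).trans hd, fun ha => ?_,
      fun j hj hj1 hj2 ha hchar => ?_⟩, ?_, fun j hj hj1 hj2 => ?_⟩
    · have hZv := Matrix.ProjGenLinGroup.val_eq_matZ hd0 habc hX hY hZ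
      have hsub := sub_ne_zero.2 hd1
      -- In case (i), a² = −1 would mean (d + 1)² = −(d − 1)², so d² = −1 and d⁴ = 1, against the
      -- order 2n ≥ 6.
      obtain ⟨hgen, H₁, H₂, hpair, hiff, -⟩ := Matrix.ProjGenLinGroup.exists_isDessinPair_of_trace (k := 0) hn hp hd habc
        hX hY hZ (fun h => by
          rw [ha, div_pow, div_eq_iff (pow_ne_zero _ hsub)] at h
          have h' : d ^ 2 = -1 := mul_left_cancel₀ h2 (by linear_combination h)
          refine ZMod.pow_ne_one_of_orderOf hn hd (m := 4) (by norm_num) (by norm_num) ?_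
          linear_combination (d ^ 2 - 1) * h')
        (by simpa using isCoprime_one_left) (by
          rw [ha, zpow_zero, neg_zero, zero_sub, zpow_neg_one]
          field_simp)
      have hswap := Matrix.ProjGenLinGroup.hasSwap_of_eq hp2 hd0 hd1 habc hY hZv ha
      exact ⟨hgen, H₁, H₂, hpair, hiff, hswap, hiff.2 hswap⟩
    · obtain ⟨k, rfl, hk, hk'⟩ := hodd j hj
      rw [hk, hk', charpoly_matZ_eq_iff hd0 habc (hprod k)] at hchar
      obtain ⟨hgen, H₁, H₂, hpair, hiff, -⟩ := Matrix.ProjGenLinGroup.exists_isDessinPair_of_trace hn hp hd habc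
        hX hY hZ ha hj hchar
      have hswap := Matrix.ProjGenLinGroup.not_hasSwap_of_trace hn hd habc hY (Matrix.ProjGenLinGroup.val_eq_matZ hd0 habc hX hY hZ) hchar
        (fun h => hj1 ((Int.modEq_iff_dvd.2 (by ring_nf at h ⊢; exact h)).symm))
        (fun h => hj2 ((Int.modEq_iff_dvd.2 (by ring_nf at h ⊢; exact h)).symm))
      exact ⟨hgen, H₁, H₂, hpair, hiff, hswap, hiff.not.2 hswap⟩
    · exact ⟨_, -1 - ((d + 1) / (d - 1)) ^ 2, 1, by ring, rfl⟩
    · obtain ⟨k, rfl, hk, hk'⟩ := hodd j hj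
      have hsub := sub_ne_zero.2 hd1
      have hinv : d ^ (-k - 1) = (d ^ k * d)⁻¹ := by
        rw [← zpow_add_one₀ hd0, ← zpow_neg]
        congr 1
        ring
      have he : d ^ k ≠ 0 := zpow_ne_zero _ hd0
      rw [hk, hk']
      -- The value of a solves a − a/d = d^k + d^(−k−1); taking c = 1 then determines b.
      refine ⟨d * (d ^ k + d ^ (-k - 1)) / (d - 1), _, 1, ?_, ?_,
        (charpoly_matZ_eq_iff (b := -1 - (d * (d ^ k + d ^ (-k - 1)) / (d - 1)) ^ 2) (c := 1) hd0
          (by ring) (hprod k)).2 ?_⟩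
      · ring
      · have hneg : d ^ (n : ℤ) = -1 := by
          rw [zpow_natCast]
          exact ZMod.pow_eq_neg_one_of_orderOf hn hd
        have key : ∀ m : ℤ, d ^ m = -1 → (2 * n : ℤ) ∣ m - n := fun m hm => by
          rw [← ZMod.zpow_eq_one_iff_of_orderOf hn hd, zpow_sub₀ hd0, hm, hneg]
          norm_num
        have h1 : d ^ k * d ^ k ≠ -1 := fun h => hj1 (by
          rw [← zpow_add₀ hd0] at h
          have := key _ h
          exact (Int.modEq_iff_dvd.2 (by ring_nf at this ⊢; exact this)).symm)
        have h2 : d ^ k * d ^ k * d ^ 2 ≠ -1 := fun h => hj2 (by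
          rw [← zpow_add₀ hd0, ← zpow_natCast, ← zpow_add₀ hd0] at h
          have := key _ h
          push_cast at this
          exact (Int.modEq_iff_dvd.2 (by ring_nf at this ⊢; exact this)).symm)
        rw [hinv]
        generalize d ^ k = e at *
        intro h
        field_simp at h
        have h' : (e * e + 1) * (e * e * d ^ 2 + 1) = 0 := by linear_combination h
        rcases mul_eq_zero.1 h' with h' | h'
        · exact h1 (eq_neg_of_add_eq_zero_left h')
        · exact h2 (eq_neg_of_add_eq_zero_left h')
      · rw [hinv]
        generalize d ^ k = e at *
        field_simp
  · exact isDessinPair_seventeen
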